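/- Let $q\ge 2$, $\mathcal Q=\mathbb Z/q\mathbb Z$, and let $\mathcal Y_3$ be a finite set. Consider the memoryless three-user multiaccess/degraded broadcast (MA/DB) two-way channel in which users 1, 2, 3 have inputs $X_1,X_2,X_3\in\mathcal Q$, user 3 receives $Y_3\in\mathcal Y_3$ according to a transition probability $P_{Y_3|X_1,X_2,X_3}$, and users 1 and 2 receive $$Y_1=X_1+X_3+Z_1,\qquad Y_2=X_2+X_3+Z_1+Z_2\pmod q,$$ where, given the inputs, $Y_3,Z_1,Z_2$ are independent and $Z_1\sim P_{Z_1}$, $Z_2\sim P_{Z_2}$ on $\mathcal Q$; each channel use is conditionally independent of the past given the current inputs. User 1 sends a message $M_{13}$ and user 2 a message $M_{23}$ to user 3; user 3 sends $M_{31}$ to user 1 and $M_{32}$ to user 2; the messages are independent and uniform on $\{1,\dots,2^{nR_{13}}\}$, etc. (integers between $1$ and $2^{nR}$; all rates are nonnegative). A code of length $n$ consists of encoders $X_{1,i}=f_{1,i}(M_{13},Y_1^{i-1})$, $X_{2,i}=f_{2,i}(M_{23},Y_2^{i-1})$, $X_{3,i}=f_{3,i}(M_{31},M_{32},Y_3^{i-1})$,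 $1\le i\le n$, and decoders $\hat M_{31}=g_1(M_{13},Y_1^n)$, $\hat M_{32}=g_2(M_{23},Y_2^n)$, $(\hat M_{13},\hat M_{23})=g_3(M_{31},M_{32},Y_3^n)$. A quadruple $(R_{13},R_{23},R_{31},R_{32})$ is achievable if there is a sequence of such codes for which the probability that some message is decoded wrongly tends to $0$ as $n\to\infty$. The capacity region $\mathcal C$ is the closure of the convex hull of the set of achievable quadruples. For a distribution $P_{X_1,X_2,X_3,V}$, where $V$ is an auxiliary variable with an alphabet of at most $q+1$ elements, let $\mathcal R(P_{X_1,X_2,X_3,V})$ be the set of nonnegative quadruples with $$R_{13}\le I(X_1;Y_3|X_2,X_3),\quad R_{23}\le I(X_2;Y_3|X_1,X_3),\quad R_{13}+R_{23}\le I(X_1,X_2;Y_3|X_3),$$ $$R_{31}\le I(X_3;X_3+Z_1|V),\quad R_{32}\le I(V;X_3+Z_1+Z_2),$$ where mutual informations are in bits and are evaluated under $P_{X_1,X_2,X_3,V}\cdot P_{Y_3|X_1,X_2,X_3}\cdot P_{Z_1}\cdot P_{Z_2}$. With $\overline{\mathrm{co}}$ denoting the closure of the convex hull, put $$\mathcal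 C_{\mathrm I}=\overline{\mathrm{co}}\Big(\bigcup_{P_{X_1},P_{X_2},P_{V,X_3}}\mathcal R(P_{X_1}\cdot P_{X_2}\cdot P_{V,X_3})\Big),\qquad \mathcal C_{\mathrm O}=\overline{\mathrm{co}}\Big(\bigcup_{P_{X_1,X_2,X_3,V}}\mathcal R(P_{X_1,X_2,X_3,V})\Big)$$ (the inner and the outer bound). Theorem. Suppose that for every conditional distribution $P^{(1)}_{X_1,X_2|X_3}$ there is a product distribution $P^{(2)}_{X_1,X_2|X_3}=\tilde P_{X_1}\cdot\tilde P_{X_2}$, not depending on the value of $X_3$, such that for all $x_3\in\mathcal Q$ $$I^{(1)}(X_1;Y_3|X_2,X_3=x_3)\le I^{(2)}(X_1;Y_3|X_2,X_3=x_3),$$ $$I^{(1)}(X_2;Y_3|X_1,X_3=x_3)\le I^{(2)}(X_2;Y_3|X_1,X_3=x_3),$$ $$I^{(1)}(X_1,X_2;Y_3|X_3=x_3)\le I^{(2)}(X_1,X_2;Y_3|X_3=x_3),$$ where $I^{(l)}$ is evaluated under $P^{(l)}_{X_1,X_2|X_3}$ and $P_{Y_3|X_1,X_2,X_3}$. Then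 $\mathcal C_{\mathrm I}=\mathcal C_{\mathrm O}$, and the capacity region is $\mathcal C=\mathcal C_{\mathrm I}$. -/

import Mathlib

namespace MADB

/-! ### Finite information measures

A distribution on a finite type `Ω` is a vector `p : Ω → ℝ` with `p ∈ stdSimplex ℝ Ω`.
All logarithms are to base 2 (rates are in bits). -/

open Classical in
/-- The law of the random variable `f` when the sample space `Ω` carries the distribution `p`. -/
noncomputable def law {Ω A : Type*} [Fintype Ω] (p : Ω → ℝ) (f : Ω → A) (a : A) : ℝ :=
  ∑ ω, if f ω = a then p ω else 0

/-- The mutual information `I(f; g)` under `p`: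
`∑ P(a,b) log₂ (P(a,b) / (P(a) P(b)))`, terms with `P(a,b) = 0` being `0`. -/
noncomputable def mutualInfo {Ω A B : Type*} [Fintype Ω] [Fintype A] [Fintype B]
    (p : Ω → ℝ) (f : Ω → A) (g : Ω → B) : ℝ :=
  ∑ a, ∑ b, law p (fun ω => (f ω, g ω)) (a, b) *
    Real.logb 2 (law p (fun ω => (f ω, g ω)) (a, b) / (law p f a * law p g b))

/-- The conditional mutual information `I(f; g | h)` under `p`:
`∑ P(a,b,c) log₂ (P(a,b,c) P(c) / (P(a,c) P(b,c)))`, terms with `P(a,b,c) = 0` being `0`. -/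
noncomputable def condMutualInfo {Ω A B C : Type*} [Fintype Ω] [Fintype A] [Fintype B] [Fintype C]
    (p : Ω → ℝ) (f : Ω → A) (g : Ω → B) (h : Ω → C) : ℝ :=
  ∑ a, ∑ b, ∑ c, law p (fun ω => (f ω, g ω, h ω)) (a, b, c) *
    Real.logb 2 (law p (fun ω => (f ω, g ω, h ω)) (a, b, c) * law p h c /
      (law p (fun ω => (f ω, h ω)) (a, c) * law p (fun ω => (g ω, h ω)) (b, c)))

/-! ### The channel -/

/-- A memoryless three-user multiaccess/degraded broadcast two-way channel. All alphabets except
that of `Y₃` are the integers modulo `q`; the alphabet of `Y₃` is the finite type `Y`.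
`trans x₁ x₂ x₃ y₃` is `P_{Y₃|X₁,X₂,X₃}(y₃|x₁,x₂,x₃)`, and `noise₁`, `noise₂` are the distributions
of the additive noises `Z₁`, `Z₂`. -/
structure Channel (q : ℕ) [NeZero q] (Y : Type*) [Fintype Y] where
  trans : ZMod q → ZMod q → ZMod q → Y → ℝ
  trans_mem : ∀ x₁ x₂ x₃, trans x₁ x₂ x₃ ∈ stdSimplex ℝ Y
  noise₁ : ZMod q → ℝ
  noise₁_mem : noise₁ ∈ stdSimplex ℝ (ZMod q)
  noise₂ : ZMod q → ℝ
  noise₂_mem : noise₂ ∈ stdSimplex ℝ (ZMod q)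

/-- The one-step transition probability `P(y₁,y₂,y₃|x₁,x₂,x₃)`. The outputs `y₁ = x₁ + x₃ + z₁`
and `y₂ = x₂ + x₃ + z₁ + z₂` mean `z₁ = y₁ - x₁ - x₃` and `z₂ = y₂ - x₂ - y₁ + x₁`. -/
def Channel.prob {q : ℕ} [NeZero q] {Y : Type*} [Fintype Y] (ch : Channel q Y)
    (x₁ x₂ x₃ y₁ y₂ : ZMod q) (y₃ : Y) : ℝ :=
  ch.trans x₁ x₂ x₃ y₃ * ch.noise₁ (y₁ - x₁ - x₃) * ch.noise₂ (y₂ - x₂ - y₁ + x₁)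

/-! ### Codes, achievable rates, capacity region -/

/-- The four messages: `ij` is the message sent by user `i` to user `j`. -/
inductive Link where
  | l13 | l23 | l31 | l32
  deriving DecidableEq

instance : Fintype Link := ⟨{.l13, .l23, .l31, .l32}, fun l => by cases l <;> decide⟩

/-- The number of elements of the message set `{1, 2, …, 2^{nr}}`. -/
noncomputable def numMsg (n : ℕ) (r : ℝ) : ℕ := ⌊(2 : ℝ) ^ ((n : ℝ) * r)⌋₊

/-- The message set `{1, 2, …, 2^{nR_l}}` of the link `l`. -/
abbrev Msg (n : ℕ) (R : Link → ℝ) (l : Link) : Type := Fin (numMsg n (R l))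

/-- The past `(y_1, …, y_{i-1})` of a sequence, at time `i`. -/
def past {A : Type*} {n : ℕ} (y : Fin n → A) (i : Fin n) : Fin i.val → A :=
  fun j => y (Fin.castLE i.isLt.le j)

/-- An `(n, R₁₃, R₂₃, R₃₁, R₃₂)` code: at every time each encoder sees its own messages and the
past of its own channel output; each decoder sees its own messages and its whole output. -/
structure Code (q : ℕ) (Y : Type*) (n : ℕ) (R : Link → ℝ) where
  f₁ : (i : Fin n) → Msg n R .l13 → (Fin i.val → ZMod q) → ZMod q
  f₂ : (i : Fin n) → Msg n R .l23 → (Fin i.val → ZMod q) → ZMod q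
  f₃ : (i : Fin n) → Msg n R .l31 → Msg n R .l32 → (Fin i.val → Y) → ZMod q
  g₁ : Msg n R .l13 → (Fin n → ZMod q) → Msg n R .l31
  g₂ : Msg n R .l23 → (Fin n → ZMod q) → Msg n R .l32
  g₃ : Msg n R .l31 → Msg n R .l32 → (Fin n → Y) → Msg n R .l13 × Msg n R .l23

section Code

variable {q : ℕ} [NeZero q] {Y : Type*} [Fintype Y] {n : ℕ} {R : Link → ℝ}

/-- The probability that the outputs are `y₁, y₂, y₃` (sequences of length `n`), given that the
messages are `m` and that the encoders of the code `c` are used. -/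
def Code.outputProb (c : Code q Y n R) (ch : Channel q Y) (m : (l : Link) → Msg n R l)
    (y₁ y₂ : Fin n → ZMod q) (y₃ : Fin n → Y) : ℝ :=
  ∏ i, ch.prob (c.f₁ i (m .l13) (past y₁ i)) (c.f₂ i (m .l23) (past y₂ i))
    (c.f₃ i (m .l31) (m .l32) (past y₃ i)) (y₁ i) (y₂ i) (y₃ i)

/-- At least one of the four messages is decoded wrongly. -/
def Code.IsError (c : Code q Y n R) (m : (l : Link) → Msg n R l)
    (y₁ y₂ : Fin n → ZMod q) (y₃ : Fin n → Y) : Prop :=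
  (c.g₃ (m .l31) (m .l32) y₃).1 ≠ m .l13 ∨ (c.g₃ (m .l31) (m .l32) y₃).2 ≠ m .l23 ∨
    c.g₁ (m .l13) y₁ ≠ m .l31 ∨ c.g₂ (m .l23) y₂ ≠ m .l32

open Classical in
/-- The probability of decoding error, the four messages being independent and uniform. -/
noncomputable def Code.errorProb (c : Code q Y n R) (ch : Channel q Y) : ℝ :=
  (∑ m : (l : Link) → Msg n R l, ∑ y₁ : Fin n → ZMod q, ∑ y₂ : Fin n → ZMod q, ∑ y₃ : Fin n → Y,
      if c.IsError m y₁ y₂ y₃ then c.outputProb ch m y₁ y₂ y₃ else 0) /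
    (Fintype.card ((l : Link) → Msg n R l) : ℝ)

end Code

section Regions

variable {q : ℕ} [NeZero q] {Y : Type*} [Fintype Y]

/-- Achievability of a quadruple of (nonnegative) rates. -/
def Achievable (ch : Channel q Y) (R : Link → ℝ) : Prop :=
  (∀ l, 0 ≤ R l) ∧ ∃ c : (n : ℕ) → Code q Y n R,
    Filter.Tendsto (fun n => (c n).errorProb ch) Filter.atTop (nhds 0)

/-- The capacity region: the closure of the convex hull of the set of achievable quadruples. -/
def capacityRegion (ch : Channel q Y) : Set (Link → ℝ) :=
  closure (convexHull ℝ {R | Achievable ch R})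

/-! ### The rate region of an input distribution, the inner and the outer bound -/

/-- The sample space of `(X₁, X₂, X₃, V, Y₃, Z₁, Z₂)`, where `V` has `k` values. -/
abbrev Sample (q : ℕ) (Y : Type*) (k : ℕ) : Type _ :=
  ZMod q × ZMod q × ZMod q × Fin k × Y × ZMod q × ZMod q

/-- The joint distribution `P_{X₁,X₂,X₃,V} · P_{Y₃|X₁,X₂,X₃} · P_{Z₁} · P_{Z₂}`. -/
def jointDist (ch : Channel q Y) {k : ℕ} (P : ZMod q × ZMod q × ZMod q × Fin k → ℝ) :
    Sample q Y k → ℝ :=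
  fun (x₁, x₂, x₃, v, y₃, z₁, z₂) =>
    P (x₁, x₂, x₃, v) * ch.trans x₁ x₂ x₃ y₃ * ch.noise₁ z₁ * ch.noise₂ z₂

/-- The set of (nonnegative) rate quadruples allowed by the input distribution `P_{X₁,X₂,X₃,V}`. -/
def rateRegion (ch : Channel q Y) {k : ℕ} (P : ZMod q × ZMod q × ZMod q × Fin k → ℝ) :
    Set (Link → ℝ) :=
  let p := jointDist ch P
  let X₁ : Sample q Y k → ZMod q := fun (x₁, _, _, _, _, _, _) => x₁
  let X₂ : Sample q Y k → ZMod q := fun (_, x₂, _, _, _, _, _) => x₂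
  let X₃ : Sample q Y k → ZMod q := fun (_, _, x₃, _, _, _, _) => x₃
  let V : Sample q Y k → Fin k := fun (_, _, _, v, _, _, _) => v
  let Y₃ : Sample q Y k → Y := fun (_, _, _, _, y₃, _, _) => y₃
  let Z₁ : Sample q Y k → ZMod q := fun (_, _, _, _, _, z₁, _) => z₁
  let Z₂ : Sample q Y k → ZMod q := fun (_, _, _, _, _, _, z₂) => z₂
  {R | (∀ l, 0 ≤ R l) ∧
    R .l13 ≤ condMutualInfo p X₁ Y₃ (fun s => (X₂ s, X₃ s)) ∧
    R .l23 ≤ condMutualInfo p X₂ Y₃ (fun s => (X₁ s, X₃ s)) ∧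
    R .l13 + R .l23 ≤ condMutualInfo p (fun s => (X₁ s, X₂ s)) Y₃ X₃ ∧
    R .l31 ≤ condMutualInfo p X₃ (fun s => X₃ s + Z₁ s) V ∧
    R .l32 ≤ mutualInfo p V (fun s => X₃ s + Z₁ s + Z₂ s)}

/-- The inner bound: input distributions `P_{X₁} · P_{X₂} · P_{V,X₃}`, with `V` taking at most
`q + 1` values. -/
def innerBound (ch : Channel q Y) : Set (Link → ℝ) :=
  closure (convexHull ℝ {R | ∃ k ≤ q + 1, ∃ P₁ ∈ stdSimplex ℝ (ZMod q),
    ∃ P₂ ∈ stdSimplex ℝ (ZMod q), ∃ P₃ ∈ stdSimplex ℝ (Fin k × ZMod q),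
      R ∈ rateRegion ch (k := k) fun (x₁, x₂, x₃, v) => P₁ x₁ * P₂ x₂ * P₃ (v, x₃)})

/-- The outer bound: arbitrary input distributions `P_{X₁,X₂,X₃,V}`, with `V` taking at most
`q + 1` values. -/
def outerBound (ch : Channel q Y) : Set (Link → ℝ) :=
  closure (convexHull ℝ {R | ∃ k ≤ q + 1,
    ∃ P ∈ stdSimplex ℝ (ZMod q × ZMod q × ZMod q × Fin k), R ∈ rateRegion ch P})

/-! ### The multiple-access terms for a fixed input symbol of user 3 -/

/-- The joint distribution of `(X₁, X₂, Y₃)` given `X₃ = x₃`, where `Q` is the distribution of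
`(X₁, X₂)` given `X₃ = x₃`. -/
def macDist (ch : Channel q Y) (Q : ZMod q × ZMod q → ℝ) (x₃ : ZMod q)
    (s : ZMod q × ZMod q × Y) : ℝ :=
  Q (s.1, s.2.1) * ch.trans s.1 s.2.1 x₃ s.2.2

/-- `I(X₁; Y₃ | X₂, X₃ = x₃)`. -/
noncomputable def macInfo₁ (ch : Channel q Y) (Q : ZMod q × ZMod q → ℝ) (x₃ : ZMod q) : ℝ :=
  condMutualInfo (macDist ch Q x₃) (fun s => s.1) (fun s => s.2.2) (fun s => s.2.1)

/-- `I(X₂; Y₃ | X₁, X₃ = x₃)`. -/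
noncomputable def macInfo₂ (ch : Channel q Y) (Q : ZMod q × ZMod q → ℝ) (x₃ : ZMod q) : ℝ :=
  condMutualInfo (macDist ch Q x₃) (fun s => s.2.1) (fun s => s.2.2) (fun s => s.1)

/-- `I(X₁, X₂; Y₃ | X₃ = x₃)`. -/
noncomputable def macInfo₁₂ (ch : Channel q Y) (Q : ZMod q × ZMod q → ℝ) (x₃ : ZMod q) : ℝ :=
  mutualInfo (macDist ch Q x₃) (fun s => (s.1, s.2.1)) (fun s => s.2.2)

end Regions

end MADB

/-! Converse. Take a code and a uniformly random time, and let V consist of the time, the messages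
M13, M23, M32 and the past of Y1 and Y2. Then X1 and X2 are functions of V, so subtracting them
reduces the outputs of users 1 and 2 to X3 + Z1 and X3 + Z1 + Z2, although the encoders are
adaptive. The role of Fano's inequality and the chain rule is played by a change of measure. Each
factor of the path probability is divided by a single-letter likelihood ratio; what remains is
dominated by a causal kernel under which the data of the decoder, even enlarged by a genie, carry no
trace of the message to be decoded. Under it a guess among M messages succeeds with weight at most
1/M (`sum_guess_le`), and Gibbs' inequality turns this into (1 - ε) log M - 1 ≤ n I
(`logb_le_of_guess`, `Code.guess_bound`). This is done for each of the five informations. Only I(V;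
X3 + Z1 + Z2) needs more: averaging over M31 and Y3 destroys the product form of the path law, which
is restored by successive conditional probabilities (`le_prod_conditional`).

Use of the hypothesis. The three multiple-access terms are averages, over the law of X3, of the
terms at a fixed value of X3, and the two broadcast terms depend only on the law of (V, X3).
Replacing the conditional law of (X1, X2) given X3 by the dominating product, while keeping the law
of (V, X3), therefore enlarges the region and yields a distribution of the inner bound
(`exists_productDist_of_mem_rateRegion`). This alone gives equality of the two bounds. In the
converse the alphabet of V grows with n; it is cut to q + 1 values by moving weights of V along
linear dependences (`exists_small_support`, `exists_small_alphabet`).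

Direct part. Random codebooks are used without feedback. User 3 superposes by strategies: a letter
is a random map s from values of V to inputs, drawn independently of the auxiliary letter v, and
s(v) is sent. The decoders compare likelihoods with their averages over a wrong word: the true words
pass by Chernoff's bound (`exists_chernoff`), a wrong word rarely does by Markov's inequality
(`sum_prodDist_likelihood_le`). User 1 decodes M32 as well, which costs nothing because user 2 has
the degraded output (`mutualInfo_w₂_le`). -/

namespace MADB

open Finset

/-! ### Laws and likelihood ratios on finite sample spaces -/

section Law

variable {Ω A B C D : Type*} [Fintype Ω]

theorem law_nonneg {p : Ω → ℝ} (hp : ∀ ω, 0 ≤ p ω) (f : Ω → A) (a : A) : 0 ≤ law p f a :=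
  sum_nonneg fun ω _ => by split_ifs <;> simp [hp ω]

/-- Change of variables. It turns each information measure into an expectation over the sample
space, so that later arguments need not sum over the alphabets of the variables. -/
theorem sum_law_mul [Fintype A] (p : Ω → ℝ) (f : Ω → A) (φ : A → ℝ) :
    ∑ a, law p f a * φ a = ∑ ω, p ω * φ (f ω) := by
  classical
  simp only [law, sum_mul]
  rw [sum_comm]
  refine sum_congr rfl fun ω _ => ?_
  rw [Finset.sum_eq_single (f ω)]
  · simp
  · intro b _ hb
    simp [hb.symm]
  · simp

theorem sum_law [Fintype A] (p : Ω → ℝ) (f : Ω → A) : ∑ a, law p f a = ∑ ω, p ω := by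
  simpa using sum_law_mul p f fun _ => 1

theorem le_law {p : Ω → ℝ} (hp : ∀ ω, 0 ≤ p ω) (f : Ω → A) (ω : Ω) : p ω ≤ law p f (f ω) := by
  classical
  have := single_le_sum (f := fun ω' => if f ω' = f ω then p ω' else 0)
    (fun ω' _ => by split_ifs <;> simp [hp ω']) (mem_univ ω)
  simpa [law] using this

theorem law_pos {p : Ω → ℝ} (hp : ∀ ω, 0 ≤ p ω) (f : Ω → A) {ω : Ω} (hω : 0 < p ω) :
    0 < law p f (f ω) := hω.trans_le (le_law hp f ω)

theorem law_mem_stdSimplex [Fintype A] {p : Ω → ℝ} (hp : p ∈ stdSimplex ℝ Ω) (f : Ω → A) :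
    law p f ∈ stdSimplex ℝ A :=
  ⟨law_nonneg hp.1 f, by rw [sum_law, hp.2]⟩

theorem law_law [Fintype A] (p : Ω → ℝ) (f : Ω → A) (g : A → B) :
    law (law p f) g = law p fun ω => g (f ω) := by
  classical
  funext b
  have := sum_law_mul p f fun a => if g a = b then (1 : ℝ) else 0
  simpa [law] using this

theorem law_id (p : Ω → ℝ) : law p (fun ω => ω) = p := by
  classical
  funext ω
  simp [law]

theorem law_smul (c : ℝ) (p : Ω → ℝ) (f : Ω → A) (a : A) :
    law (fun ω => c * p ω) f a = c * law p f a := by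
  simp [law, mul_sum]

theorem law_comp_injective (p : Ω → ℝ) (f : Ω → A) {e : A → B} (he : Function.Injective e) (a : A) :
    law p (fun ω => e (f ω)) (e a) = law p f a := by
  refine sum_congr rfl fun ω _ => ?_
  by_cases h : f ω = a <;> simp [h, he.eq_iff]

theorem sum_law_pair_right [Fintype B] (p : Ω → ℝ) (f : Ω → A) (g : Ω → B) (a : A) :
    ∑ b, law p (fun ω => (f ω, g ω)) (a, b) = law p f a := by
  classical
  simp only [law, Prod.mk.injEq]
  rw [sum_comm]
  refine sum_congr rfl fun ω _ => ?_
  by_cases h : f ω = a <;> simp [h]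

theorem sum_law_pair_left [Fintype A] (p : Ω → ℝ) (f : Ω → A) (g : Ω → B) (b : B) :
    ∑ a, law p (fun ω => (f ω, g ω)) (a, b) = law p g b := by
  classical
  simp only [law, Prod.mk.injEq]
  rw [sum_comm]
  refine sum_congr rfl fun ω _ => ?_
  by_cases h : g ω = b <;> simp [h]

/-- The likelihood ratio whose expected logarithm is the mutual information. -/
noncomputable def ratio (p : Ω → ℝ) (f : Ω → A) (g : Ω → B) (ω : Ω) : ℝ :=
  law p (fun ω => (f ω, g ω)) (f ω, g ω) / (law p f (f ω) * law p g (g ω))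

/-- The likelihood ratio whose expected logarithm is the conditional mutual information. -/
noncomputable def condRatio (p : Ω → ℝ) (f : Ω → A) (g : Ω → B) (h : Ω → C) (ω : Ω) : ℝ :=
  law p (fun ω => (f ω, g ω, h ω)) (f ω, g ω, h ω) * law p h (h ω) /
    (law p (fun ω => (f ω, h ω)) (f ω, h ω) * law p (fun ω => (g ω, h ω)) (g ω, h ω))

theorem ratio_pos {p : Ω → ℝ} (hp : ∀ ω, 0 ≤ p ω) (f : Ω → A) (g : Ω → B) {ω : Ω} (hω : 0 < p ω) :
    0 < ratio p f g ω := by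
  have h1 := law_pos hp (fun ω => (f ω, g ω)) hω
  have h2 := law_pos hp f hω
  have h3 := law_pos hp g hω
  unfold ratio
  positivity

theorem condRatio_pos {p : Ω → ℝ} (hp : ∀ ω, 0 ≤ p ω) (f : Ω → A) (g : Ω → B) (h : Ω → C) {ω : Ω}
    (hω : 0 < p ω) : 0 < condRatio p f g h ω := by
  have h1 := law_pos hp (fun ω => (f ω, g ω, h ω)) hω
  have h2 := law_pos hp h hω
  have h3 := law_pos hp (fun ω => (f ω, h ω)) hω
  have h4 := law_pos hp (fun ω => (g ω, h ω)) hω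
  unfold condRatio
  positivity

variable [Fintype A] [Fintype B] [Fintype C] [Fintype D]

theorem mutualInfo_eq_sum (p : Ω → ℝ) (f : Ω → A) (g : Ω → B) :
    mutualInfo p f g = ∑ ω, p ω * Real.logb 2 (ratio p f g ω) := by
  have := sum_law_mul p (fun ω => (f ω, g ω)) fun x =>
    Real.logb 2 (law p (fun ω => (f ω, g ω)) x / (law p f x.1 * law p g x.2))
  rw [Fintype.sum_prod_type] at this
  exact this

theorem condMutualInfo_eq_sum (p : Ω → ℝ) (f : Ω → A) (g : Ω → B) (h : Ω → C) :
    condMutualInfo p f g h = ∑ ω, p ω * Real.logb 2 (condRatio p f g h ω) := by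
  have := sum_law_mul p (fun ω => (f ω, g ω, h ω)) fun x =>
    Real.logb 2 (law p (fun ω => (f ω, g ω, h ω)) x * law p h x.2.2 /
      (law p (fun ω => (f ω, h ω)) (x.1, x.2.2) * law p (fun ω => (g ω, h ω)) (x.2.1, x.2.2)))
  simp only [Fintype.sum_prod_type] at this
  exact this

theorem mutualInfo_law (p : Ω → ℝ) (F : Ω → D) (f : D → A) (g : D → B) :
    mutualInfo (law p F) f g = mutualInfo p (fun ω => f (F ω)) (fun ω => g (F ω)) := by
  simp only [mutualInfo, law_law]

theorem condMutualInfo_law (p : Ω → ℝ) (F : Ω → D) (f : D → A) (g : D → B) (h : D → C) :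
    condMutualInfo (law p F) f g h =
      condMutualInfo p (fun ω => f (F ω)) (fun ω => g (F ω)) (fun ω => h (F ω)) := by
  simp only [condMutualInfo, law_law]

/-- Relabelling the conditioning variable does not change the conditional mutual information. -/
theorem condMutualInfo_relabel (p : Ω → ℝ) (f : Ω → A) (g : Ω → B) (h : Ω → C) {e : C → D}
    (he : Function.Injective e) :
    condMutualInfo p f g (fun ω => e (h ω)) = condMutualInfo p f g h := by
  rw [condMutualInfo_eq_sum, condMutualInfo_eq_sum]
  refine sum_congr rfl fun ω _ => ?_
  unfold condRatio
  rw [law_comp_injective p h he,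
    law_comp_injective p (fun ω => (f ω, h ω)) (e := fun x : A × C => (x.1, e x.2))
      (fun x y => by simp only [he.eq_iff, Prod.ext_iff]; exact id) (f ω, h ω),
    law_comp_injective p (fun ω => (g ω, h ω)) (e := fun x : B × C => (x.1, e x.2))
      (fun x y => by simp only [he.eq_iff, Prod.ext_iff]; exact id) (g ω, h ω),
    law_comp_injective p (fun ω => (f ω, g ω, h ω))
      (e := fun x : A × B × C => (x.1, x.2.1, e x.2.2))
      (fun x y => by simp only [he.eq_iff, Prod.ext_iff]; exact id) (f ω, g ω, h ω)]

end Law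

/-! ### Gibbs' inequality, blind guessing, nonnegativity and data processing -/

section Gibbs

variable {Ω A B C : Type*} [Fintype Ω]

/-- Gibbs' inequality. -/
theorem sum_mul_logb_nonpos {p φ : Ω → ℝ} (hp : p ∈ stdSimplex ℝ Ω)
    (hφ : ∀ ω, 0 < p ω → 0 < φ ω) (h : ∑ ω, p ω * φ ω ≤ 1) :
    ∑ ω, p ω * Real.logb 2 (φ ω) ≤ 0 := by
  have h2 : (0 : ℝ) < Real.log 2 := Real.log_pos (by norm_num)
  have : ∑ ω, p ω * Real.logb 2 (φ ω) ≤ ∑ ω, p ω * ((φ ω - 1) / Real.log 2) := by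
    refine sum_le_sum fun ω _ => ?_
    rcases (hp.1 ω).eq_or_lt with h0 | h0
    · simp [← h0]
    · refine mul_le_mul_of_nonneg_left ?_ h0.le
      exact div_le_div_of_nonneg_right (Real.log_le_sub_one_of_pos (hφ ω h0)) h2.le
  refine this.trans ?_
  have e : ∑ ω, p ω * ((φ ω - 1) / Real.log 2) = (∑ ω, p ω * φ ω - ∑ ω, p ω) / Real.log 2 := by
    rw [← sum_sub_distrib, sum_div]
    exact sum_congr rfl fun ω _ => by ring
  rw [e, hp.2]
  exact div_nonpos_of_nonpos_of_nonneg (by linarith) h2.le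

theorem sum_mul_logb_nonneg {p r : Ω → ℝ} (hp : p ∈ stdSimplex ℝ Ω)
    (hr : ∀ ω, 0 < p ω → 0 < r ω) (h : ∑ ω, p ω * (r ω)⁻¹ ≤ 1) :
    0 ≤ ∑ ω, p ω * Real.logb 2 (r ω) := by
  have := sum_mul_logb_nonpos hp (φ := fun ω => (r ω)⁻¹) (fun ω h => inv_pos.2 (hr ω h)) h
  simp only [Real.logb_inv, mul_neg, sum_neg_distrib] at this
  linarith

/-- If `r` is a likelihood ratio of `p` for which the inverse has expectation at most `1`, and at
most `1 / M` on the event that a guess is correct, then the logarithm of `M` is bounded by the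
expected log-likelihood ratio. -/
theorem logb_le_of_guess {p L : Ω → ℝ} {S : Ω → Prop} [DecidablePred S] {M : ℝ}
    (hp : p ∈ stdSimplex ℝ Ω) (hL : ∀ ω, 0 < p ω → 0 < L ω) (hM : 0 < M)
    (h1 : ∑ ω, p ω * (L ω)⁻¹ ≤ 1)
    (h2 : ∑ ω, (if S ω then p ω * (L ω)⁻¹ else 0) ≤ 1 / M) :
    (∑ ω, if S ω then p ω else 0) * Real.logb 2 M - 1 ≤ ∑ ω, p ω * Real.logb 2 (L ω) := by
  -- Gibbs' inequality is applied to `2 * L`, divided by `M` on the event `S`. The factor 2 pays for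
  -- the two halves: the whole space contributes at most 1/2 to the mean of the inverse, and so does
  -- `S` with its extra factor `M`. It is also the source of the lost bit.
  have key := sum_mul_logb_nonneg hp (r := fun ω => 2 * L ω / (if S ω then M else 1))
    (fun ω h => by have := hL ω h; split_ifs <;> positivity) (by
      have e : ∑ ω, p ω * (2 * L ω / (if S ω then M else 1))⁻¹ ≤
          (1 / 2) * (∑ ω, p ω * (L ω)⁻¹)
            + (M / 2) * ∑ ω, (if S ω then p ω * (L ω)⁻¹ else 0) := by
        rw [mul_sum, mul_sum, ← sum_add_distrib]
        refine sum_le_sum fun ω _ => ?_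
        have hp0 := hp.1 ω
        rcases hp0.eq_or_lt with h0 | h0
        · simp [← h0]
        have hL0 := hL ω h0
        have : 0 ≤ p ω * (L ω)⁻¹ := by positivity
        split_ifs
        · rw [inv_div, div_eq_mul_inv, mul_inv]
          nlinarith
        · rw [inv_div, div_eq_mul_inv, mul_inv]
          nlinarith
      have h3 : M / 2 * ∑ ω, (if S ω then p ω * (L ω)⁻¹ else 0) ≤ M / 2 * (1 / M) :=
        mul_le_mul_of_nonneg_left h2 (by positivity)
      have h4 : M / 2 * (1 / M) = 1 / 2 := by field_simp
      linarith)
  have e : ∑ ω, p ω * Real.logb 2 (2 * L ω / (if S ω then M else 1)) =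
      ∑ ω, p ω * Real.logb 2 (L ω) + ∑ ω, p ω - (∑ ω, if S ω then p ω else 0) * Real.logb 2 M := by
    rw [sum_mul, ← sum_add_distrib, ← sum_sub_distrib]
    refine sum_congr rfl fun ω _ => ?_
    rcases (hp.1 ω).eq_or_lt with h0 | h0
    · simp [← h0]
    have hL0 := hL ω h0
    rw [Real.logb_div (by positivity) (by split_ifs <;> positivity),
      Real.logb_mul (by norm_num) hL0.ne', Real.logb_self_eq_one (by norm_num)]
    split_ifs
    · ring
    · rw [Real.logb_one]; ring
  rw [e, hp.2] at key
  linarith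

variable [Fintype A] [Fintype B] [Fintype C]

/-- The inverse likelihood ratio has mean at most the sum of P(a,c) P(b,c) / P(c), which is 1. It is
only at most this because triples of probability zero drop out of the mean. -/
theorem condMutualInfo_nonneg {p : Ω → ℝ} (hp : p ∈ stdSimplex ℝ Ω) (f : Ω → A) (g : Ω → B)
    (h : Ω → C) : 0 ≤ condMutualInfo p f g h := by
  rw [condMutualInfo_eq_sum]
  refine sum_mul_logb_nonneg hp (fun ω hω => condRatio_pos hp.1 f g h hω) ?_
  have e := sum_law_mul p (fun ω => (f ω, g ω, h ω)) fun x =>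
    (law p (fun ω => (f ω, g ω, h ω)) x * law p h x.2.2 /
      (law p (fun ω => (f ω, h ω)) (x.1, x.2.2) * law p (fun ω => (g ω, h ω)) (x.2.1, x.2.2)))⁻¹
  change _ = ∑ ω, p ω * (condRatio p f g h ω)⁻¹ at e
  rw [← e]
  have b : ∀ x : A × B × C, law p (fun ω => (f ω, g ω, h ω)) x *
      (law p (fun ω => (f ω, g ω, h ω)) x * law p h x.2.2 /
      (law p (fun ω => (f ω, h ω)) (x.1, x.2.2) * law p (fun ω => (g ω, h ω)) (x.2.1, x.2.2)))⁻¹ ≤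
      law p (fun ω => (f ω, h ω)) (x.1, x.2.2) * law p (fun ω => (g ω, h ω)) (x.2.1, x.2.2) /
        law p h x.2.2 := by
    intro x
    have h1 := law_nonneg hp.1 (fun ω => (f ω, h ω)) (x.1, x.2.2)
    have h2 := law_nonneg hp.1 (fun ω => (g ω, h ω)) (x.2.1, x.2.2)
    have h3 := law_nonneg hp.1 h x.2.2
    rcases (law_nonneg hp.1 (fun ω => (f ω, g ω, h ω)) x).eq_or_lt with h0 | h0
    · rw [← h0]; simp only [zero_mul]; positivity
    · rw [inv_div, mul_div_assoc', mul_div_mul_left _ _ h0.ne']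
  refine (sum_le_sum fun x _ => b x).trans ?_
  simp only [Fintype.sum_prod_type]
  have : ∀ c, ∑ a, ∑ b, law p (fun ω => (f ω, h ω)) (a, c) *
      law p (fun ω => (g ω, h ω)) (b, c) / law p h c = law p h c := by
    intro c
    simp only [← sum_div, ← mul_sum, ← sum_mul, sum_law_pair_left, mul_self_div_self]
  rw [sum_congr rfl fun a _ => sum_comm, sum_comm]
  simp only [this, sum_law, hp.2, le_refl]

/-- Total mass 1 is essential: the conditional form is invariant under scaling inside the logarithm,
the unconditional one is not. -/
theorem mutualInfo_eq_cond_unit {p : Ω → ℝ} (hp : p ∈ stdSimplex ℝ Ω) (f : Ω → A) (g : Ω → B) :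
    mutualInfo p f g = condMutualInfo p f g (fun _ => ()) := by
  rw [condMutualInfo_eq_sum, mutualInfo_eq_sum]
  refine sum_congr rfl fun ω _ => ?_
  unfold condRatio ratio
  rw [law_comp_injective p f (e := fun x => (x, ())) (fun x y h => by simpa using h) (f ω),
    law_comp_injective p g (e := fun x => (x, ())) (fun x y h => by simpa using h) (g ω),
    law_comp_injective p (fun ω => (f ω, g ω)) (e := fun x => (x.1, x.2, ()))
      (fun x y h => by simpa [Prod.ext_iff] using h) (f ω, g ω)]
  have : law p (fun _ => ()) () = 1 := by simp [law, hp.2]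
  rw [this, mul_one]

theorem mutualInfo_nonneg {p : Ω → ℝ} (hp : p ∈ stdSimplex ℝ Ω) (f : Ω → A) (g : Ω → B) :
    0 ≤ mutualInfo p f g := by
  rw [mutualInfo_eq_cond_unit hp]
  exact condMutualInfo_nonneg hp f g _

/-- Data processing: `g'` is obtained from `g` by a channel `κ`. -/
theorem mutualInfo_le_of_channel {p : Ω → ℝ} (hp : p ∈ stdSimplex ℝ Ω) (f : Ω → A) (g : Ω → B)
    (g' : Ω → C) (κ : B → C → ℝ) (hκ0 : ∀ b c, 0 ≤ κ b c) (hκ : ∀ b, ∑ c, κ b c = 1)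
    (h : ∀ a b c, law p (fun ω => (f ω, g ω, g' ω)) (a, b, c) =
      law p (fun ω => (f ω, g ω)) (a, b) * κ b c) :
    mutualInfo p f g' ≤ mutualInfo p f g := by
  -- The difference of the two informations is the mean logarithm of a quotient of ratios. By the
  -- Markov property its mean is at most the sum of P(a|c) P(b) κ(c|b), which is at most 1.
  have key := sum_mul_logb_nonpos hp (φ := fun ω => ratio p f g' ω / ratio p f g ω)
    (fun ω hω => div_pos (ratio_pos hp.1 f g' hω) (ratio_pos hp.1 f g hω)) (by
      have e := sum_law_mul p (fun ω => (f ω, g ω, g' ω)) fun x =>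
        (law p (fun ω => (f ω, g' ω)) (x.1, x.2.2) / (law p f x.1 * law p g' x.2.2)) /
        (law p (fun ω => (f ω, g ω)) (x.1, x.2.1) / (law p f x.1 * law p g x.2.1))
      change _ = ∑ ω, p ω * (ratio p f g' ω / ratio p f g ω) at e
      rw [← e]
      have b : ∀ x : A × B × C, law p (fun ω => (f ω, g ω, g' ω)) x *
          ((law p (fun ω => (f ω, g' ω)) (x.1, x.2.2) / (law p f x.1 * law p g' x.2.2)) /
          (law p (fun ω => (f ω, g ω)) (x.1, x.2.1) / (law p f x.1 * law p g x.2.1))) ≤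
          law p (fun ω => (f ω, g' ω)) (x.1, x.2.2) / law p g' x.2.2 *
            (law p g x.2.1 * κ x.2.1 x.2.2) := by
        rintro ⟨a, b, c⟩
        have n1 := law_nonneg hp.1 (fun ω => (f ω, g' ω)) (a, c)
        have n2 := law_nonneg hp.1 g' c
        have n3 := law_nonneg hp.1 g b
        have n4 := hκ0 b c
        rw [h]
        simp only
        rcases (law_nonneg hp.1 (fun ω => (f ω, g ω)) (a, b)).eq_or_lt with h0 | h0
        · rw [← h0]; simp only [zero_mul]; positivity
        rcases (law_nonneg hp.1 f a).eq_or_lt with h1 | h1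
        · rw [← h1]; simp only [zero_mul, div_zero, mul_zero]; positivity
        refine le_of_eq ?_
        by_cases h2 : law p g b = 0
        · simp [h2]
        by_cases h3 : law p g' c = 0
        · simp [h3]
        field_simp
      refine (sum_le_sum fun x _ => b x).trans ?_
      simp only [Fintype.sum_prod_type]
      rw [sum_congr rfl fun a _ => sum_comm]
      simp only [← mul_sum]
      rw [sum_comm]
      simp only [← sum_mul, ← sum_div, sum_law_pair_left]
      calc ∑ c, law p g' c / law p g' c * ∑ b, law p g b * κ b c
          ≤ ∑ c, 1 * ∑ b, law p g b * κ b c := by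
            refine sum_le_sum fun c _ => mul_le_mul_of_nonneg_right (div_self_le_one _) ?_
            exact sum_nonneg fun b _ => mul_nonneg (law_nonneg hp.1 g b) (hκ0 b c)
        _ = 1 := by
            simp only [one_mul]
            rw [sum_comm]
            simp only [← mul_sum, hκ, mul_one, sum_law, hp.2])
  have e : ∑ ω, p ω * Real.logb 2 (ratio p f g' ω / ratio p f g ω) =
      mutualInfo p f g' - mutualInfo p f g := by
    rw [mutualInfo_eq_sum, mutualInfo_eq_sum, ← sum_sub_distrib]
    refine sum_congr rfl fun ω _ => ?_
    rcases (hp.1 ω).eq_or_lt with h0 | h0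
    · simp [← h0]
    rw [Real.logb_div (ratio_pos hp.1 f g' h0).ne' (ratio_pos hp.1 f g h0).ne']
    ring
  linarith

end Gibbs

/-! ### Conditional mutual information as an average over slices -/

section Slice

variable {Ω A B C D : Type*} [Fintype Ω] [Fintype D]

theorem law_slice (r : D → ℝ) (p : D → Ω → ℝ) (f : Ω → A) (a : A) (d : D) :
    law (fun s : Ω × D => r s.2 * p s.2 s.1) (fun s => (f s.1, s.2)) (a, d) =
      r d * law (p d) f a := by
  classical
  simp only [law, Fintype.sum_prod_type, mul_sum]
  refine sum_congr rfl fun ω _ => ?_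
  rw [Finset.sum_eq_single d]
  · by_cases h : f ω = a <;> simp [h]
  · intro b _ hb
    simp [hb]
  · simp

variable [Fintype A] [Fintype B] [Fintype C]

/-- The conditional ratio is homogeneous of degree zero, so the weight `r d` cancels inside the
logarithm. Neither the weights nor the slices need be normalized; this is used later with the
unnormalized laws of X3 on the values of V. -/
theorem condMutualInfo_slice (r : D → ℝ) (p : D → Ω → ℝ) (f : Ω → A) (g : Ω → B) (h : Ω → C) :
    condMutualInfo (fun s : Ω × D => r s.2 * p s.2 s.1) (fun s => f s.1) (fun s => g s.1)
      (fun s => (h s.1, s.2)) = ∑ d, r d * condMutualInfo (p d) f g h := by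
  simp only [condMutualInfo_eq_sum, mul_sum]
  rw [Fintype.sum_prod_type, sum_comm]
  refine sum_congr rfl fun d _ => sum_congr rfl fun ω _ => ?_
  by_cases hr : r d = 0
  · simp [hr]
  rw [mul_assoc]
  congr 3
  unfold condRatio
  have e1 := law_slice r p h (h ω) d
  have e2 := law_slice r p (fun ω => (f ω, h ω)) (f ω, h ω) d
  have e3 := law_slice r p (fun ω => (g ω, h ω)) (g ω, h ω) d
  have e4 := law_slice r p (fun ω => (f ω, g ω, h ω)) (f ω, g ω, h ω) d
  rw [← law_comp_injective _ _ (e := fun x : (A × C) × D => (x.1.1, x.1.2, x.2))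
    (fun x y => by simp [Prod.ext_iff, and_assoc])] at e2
  rw [← law_comp_injective _ _ (e := fun x : (B × C) × D => (x.1.1, x.1.2, x.2))
    (fun x y => by simp [Prod.ext_iff, and_assoc])] at e3
  rw [← law_comp_injective _ _ (e := fun x : (A × B × C) × D => (x.1.1, x.1.2.1, x.1.2.2, x.2))
    (fun x y => by simp [Prod.ext_iff, and_assoc])] at e4
  simp only at e2 e3 e4 ⊢
  rw [e1, e2, e3, e4]
  field_simp

theorem condMutualInfo_slice_unit (r : D → ℝ) (p : D → Ω → ℝ) (f : Ω → A) (g : Ω → B) :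
    condMutualInfo (fun s : Ω × D => r s.2 * p s.2 s.1) (fun s => f s.1) (fun s => g s.1)
      (fun s => s.2) = ∑ d, r d * condMutualInfo (p d) f g (fun _ => ()) := by
  rw [← condMutualInfo_slice, ← condMutualInfo_relabel _ _ _ _ (e := fun x : D => ((), x))]
  intro x y; simp

theorem condMutualInfo_slice_mutualInfo (r : D → ℝ) (p : D → Ω → ℝ)
    (hp : ∀ d, p d ∈ stdSimplex ℝ Ω) (f : Ω → A) (g : Ω → B) :
    condMutualInfo (fun s : Ω × D => r s.2 * p s.2 s.1) (fun s => f s.1) (fun s => g s.1)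
      (fun s => s.2) = ∑ d, r d * mutualInfo (p d) f g := by
  simp only [condMutualInfo_slice_unit, mutualInfo_eq_cond_unit (hp _)]

end Slice

end MADB

namespace MADB

open Finset

/-! ### Path measures of causal kernels, and guessing a message that leaves no trace -/

section Path

variable {A : Type*}

/-- The probability of a path of length `n` under history-dependent kernels. -/
def pathProb {n : ℕ} (k : (i : Fin n) → (Fin i.val → A) → A → ℝ) (y : Fin n → A) : ℝ :=
  ∏ i, k i (past y i) (y i)

theorem past_snoc_castSucc {n : ℕ} (y : Fin n → A) (a : A) (i : Fin n) :
    past (Fin.snoc (α := fun _ => A) y a) i.castSucc = past y i := by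
  funext j
  exact Fin.snoc_castSucc (α := fun _ => A) a y (Fin.castLE i.isLt.le j)

theorem past_snoc_last {n : ℕ} (y : Fin n → A) (a : A) :
    past (Fin.snoc (α := fun _ => A) y a) (Fin.last n) = y := by
  funext j
  exact Fin.snoc_castSucc (α := fun _ => A) a y j

theorem pathProb_snoc {n : ℕ} (k : (i : Fin (n + 1)) → (Fin i.val → A) → A → ℝ) (y : Fin n → A)
    (a : A) : pathProb k (Fin.snoc (α := fun _ => A) y a) =
      pathProb (fun i => k i.castSucc) y * k (Fin.last n) y a := by
  unfold pathProb
  rw [Fin.prod_univ_castSucc, past_snoc_last, Fin.snoc_last]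
  congr 1
  refine prod_congr rfl fun i _ => ?_
  rw [past_snoc_castSucc, Fin.snoc_castSucc]

theorem pathProb_nonneg {n : ℕ} {k : (i : Fin n) → (Fin i.val → A) → A → ℝ}
    (hk : ∀ i h a, 0 ≤ k i h a) (y : Fin n → A) : 0 ≤ pathProb k y :=
  prod_nonneg fun i _ => hk i _ _

variable [Fintype A]

theorem sum_snoc {n : ℕ} (F : (Fin (n + 1) → A) → ℝ) :
    ∑ y, F y = ∑ y : Fin n → A, ∑ a, F (Fin.snoc (α := fun _ => A) y a) := by
  rw [← (Fin.snocEquiv fun _ => A).sum_comp, Fintype.sum_prod_type, sum_comm]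
  rfl

/-- The last letter is summed first. The bounds `c` vary with time because in `sum_guess_le` they
are the values of a kernel of another output sequence, which is held fixed. -/
theorem sum_pathProb_le {n : ℕ} {k : (i : Fin n) → (Fin i.val → A) → A → ℝ}
    (hk : ∀ i h a, 0 ≤ k i h a) {c : Fin n → ℝ} (hc0 : ∀ i, 0 ≤ c i)
    (hc : ∀ i h, ∑ a, k i h a ≤ c i) : ∑ y, pathProb k y ≤ ∏ i, c i := by
  induction n with
  | zero => simp [pathProb]
  | succ n ih =>
    rw [sum_snoc, Fin.prod_univ_castSucc]
    simp only [pathProb_snoc, ← mul_sum]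
    calc _ ≤ ∑ y, pathProb (fun i => k (Fin.castSucc i)) y * c (Fin.last n) :=
          sum_le_sum fun y _ => mul_le_mul_of_nonneg_left (hc (Fin.last n) y)
            (pathProb_nonneg (fun i => hk i.castSucc) y)
      _ ≤ _ := by
          rw [← sum_mul]
          exact mul_le_mul_of_nonneg_right
            (ih (fun i => hk i.castSucc) (fun i => hc0 i.castSucc) fun i => hc i.castSucc) (hc0 _)

theorem sum_pathProb {n : ℕ} {k : (i : Fin n) → (Fin i.val → A) → A → ℝ}
    (hk : ∀ i h, ∑ a, k i h a = 1) : ∑ y, pathProb k y = 1 := by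
  induction n with
  | zero => simp [pathProb]
  | succ n ih =>
    rw [sum_snoc]
    simp only [pathProb_snoc, ← mul_sum]
    rw [sum_congr rfl fun y _ => by rw [hk (Fin.last n) y, mul_one]]
    exact ih fun i => hk i.castSucc

/-- The output at time `i` may be averaged over its conditional law given the past. -/
theorem sum_pathProb_mul {n : ℕ} {k : (i : Fin n) → (Fin i.val → A) → A → ℝ}
    (hk : ∀ i h, ∑ a, k i h a = 1) (i : Fin n) (φ : (Fin i.val → A) → A → ℝ) :
    ∑ y, pathProb k y * φ (past y i) (y i) =
      ∑ y, pathProb k y * ∑ a, k i (past y i) a * φ (past y i) a := by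
  induction n with
  | zero => exact i.elim0
  | succ n ih =>
    rw [sum_snoc, sum_snoc]
    induction i using Fin.lastCases with
    | last =>
      simp only [pathProb_snoc, past_snoc_last, Fin.snoc_last]
      refine sum_congr rfl fun y _ => ?_
      rw [← sum_mul, ← mul_sum, hk (Fin.last n) y, mul_one, mul_sum]
      exact sum_congr rfl fun a _ => by ring
    | cast i =>
      have := ih (fun i => hk i.castSucc) i φ
      simp only [pathProb_snoc, past_snoc_castSucc, Fin.snoc_castSucc]
      -- For an earlier time the last letter does not occur in the integrand and sums out to 1.
      have e : ∀ (y : Fin n → A) (x : ℝ), ∑ a, pathProb (fun i => k i.castSucc) y *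
          k (Fin.last n) y a * x = pathProb (fun i => k i.castSucc) y * x := by
        intro y x
        rw [← sum_mul, ← mul_sum, hk (Fin.last n) y, mul_one]
      simp only [e]
      exact this

end Path

section Guess

variable {MA MB B C : Type*} [Fintype MA] [Fintype MB] [Fintype B] [Fintype C]

/-- Suppose that, after summing out the outputs `C`, the kernel of the outputs `B` does not depend
on the message in `MA`. Then this message cannot be guessed from `B` better than blindly. -/
theorem sum_guess_le {n : ℕ}
    (k : MA → MB → (i : Fin n) → (Fin i.val → B) → (Fin i.val → C) → B → C → ℝ)
    (K : MB → (i : Fin n) → (Fin i.val → B) → B → ℝ)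
    (hk0 : ∀ ma mb i hb hc b c, 0 ≤ k ma mb i hb hc b c)
    (hK0 : ∀ mb i hb b, 0 ≤ K mb i hb b)
    (hk : ∀ ma mb i hb hc b, ∑ c, k ma mb i hb hc b c ≤ K mb i hb b)
    (hK : ∀ mb i hb, ∑ b, K mb i hb b ≤ 1)
    (w : MA → MB → (Fin n → B) → ℝ) (hw0 : ∀ ma mb b, 0 ≤ w ma mb b)
    (W : ℝ) (hW : ∀ mb b, ∑ ma, w ma mb b ≤ W) (hW0 : 0 ≤ W) :
    ∑ ma, ∑ mb, ∑ b : Fin n → B, ∑ c : Fin n → C,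
      w ma mb b * ∏ i, k ma mb i (past b i) (past c i) (b i) (c i) ≤ W * Fintype.card MB := by
  have h1 : ∀ ma mb (b : Fin n → B), ∑ c : Fin n → C,
      w ma mb b * ∏ i, k ma mb i (past b i) (past c i) (b i) (c i) ≤
        w ma mb b * pathProb (K mb) b := by
    intro ma mb b
    rw [← mul_sum]
    exact mul_le_mul_of_nonneg_left (sum_pathProb_le
      (k := fun i hc c => k ma mb i (past b i) hc (b i) c) (fun i hc c => hk0 ..)
      (fun i => hK0 ..) fun i hc => hk ..) (hw0 ..)
  calc _ ≤ ∑ ma, ∑ mb, ∑ b : Fin n → B, w ma mb b * pathProb (K mb) b :=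
        sum_le_sum fun ma _ => sum_le_sum fun mb _ => sum_le_sum fun b _ => h1 ma mb b
    _ = ∑ mb, ∑ b : Fin n → B, (∑ ma, w ma mb b) * pathProb (K mb) b := by
        rw [sum_comm]
        refine sum_congr rfl fun mb _ => ?_
        rw [sum_comm]
        simp only [sum_mul]
    _ ≤ ∑ mb : MB, ∑ b : Fin n → B, W * pathProb (K mb) b :=
        sum_le_sum fun mb _ => sum_le_sum fun b _ =>
          mul_le_mul_of_nonneg_right (hW mb b) (pathProb_nonneg (hK0 mb) b)
    _ ≤ ∑ mb : MB, W := by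
        refine sum_le_sum fun mb _ => ?_
        rw [← mul_sum]
        refine mul_le_of_le_one_right hW0 ?_
        simpa using sum_pathProb_le (k := K mb) (hK0 mb) (fun _ => zero_le_one) (hK mb)
    _ = W * Fintype.card MB := by simp [mul_comm]

end Guess

section Telescope

/-- A finite measure on paths is dominated by the product of its successive conditional
probabilities. -/
theorem le_prod_conditional {n : ℕ} {B : Type*} [Fintype B] [DecidableEq B]
    {ν : (Fin n → B) → ℝ} (hν : ∀ b, 0 ≤ ν b) (b : Fin n → B) :
    ν b ≤ (∑ b', ν b') *
      ∏ i : Fin n, (∑ b', if past b' i = past b i ∧ b' i = b i then ν b' else 0) /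
        (∑ b', if past b' i = past b i then ν b' else 0) := by
  -- `g k` is the mass of the paths that agree with `b` in the first `k` letters, so the quotients
  -- `g (k + 1) / g k` are the successive conditional probabilities.
  set g : ℕ → ℝ := fun k => ∑ b', if ∀ j : Fin n, j.val < k → b' j = b j then ν b' else 0 with hg
  have hg0 : ∀ k, 0 ≤ g k := fun k => sum_nonneg fun b' _ => by split_ifs <;> simp [hν b']
  have hmono : ∀ k, g (k + 1) ≤ g k := by
    intro k
    refine sum_le_sum fun b' _ => ?_
    split_ifs with h1 h2
    · exact le_rfl
    · exact absurd (fun j hj => h1 j (by omega)) h2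
    · exact hν b'
    · exact le_rfl
  have htel : ∀ k, g k = g 0 * ∏ i ∈ range k, g (i + 1) / g i := by
    intro k
    induction k with
    | zero => simp
    | succ k ih =>
      rw [prod_range_succ, ← mul_assoc, ← ih]
      -- Once `g k` vanishes so does `g (k + 1)`, by monotonicity; hence the convention 0/0 = 0 does
      -- not spoil the telescoping product.
      by_cases h : g k = 0
      · have := hmono k
        have h' := hg0 (k + 1)
        rw [h] at this ⊢
        simp [le_antisymm this h']
      · field_simp
  have hpast : ∀ (b' : Fin n → B) (i : Fin n),
      past b' i = past b i ↔ ∀ j : Fin n, j.val < i.val → b' j = b j := by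
    intro b' i
    constructor
    · intro h j hj
      exact congrFun h ⟨j.val, hj⟩
    · intro h
      funext j
      exact h _ j.isLt
  have e0 : g 0 = ∑ b', ν b' := by simp [hg]
  have en : g n = ν b := by
    have : ∀ b' : Fin n → B, (∀ j : Fin n, j.val < n → b' j = b j) ↔ b' = b :=
      fun b' => ⟨fun h => funext fun j => h j j.isLt, fun h j _ => by rw [h]⟩
    simp only [hg]
    rw [sum_congr rfl fun b' _ => if_congr (this b') rfl rfl]
    simp
  refine le_of_eq ?_
  rw [← en, htel n, e0, ← Fin.prod_univ_eq_prod_range (fun i => g (i + 1) / g i)]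
  congr 1
  refine prod_congr rfl fun i _ => ?_
  congr 1
  · refine sum_congr rfl fun b' _ => ?_
    refine if_congr ?_ rfl rfl
    rw [hpast]
    constructor
    · intro h
      exact ⟨fun j hj => h j (by omega), h i (by omega)⟩
    · rintro ⟨h, h'⟩ j hj
      rcases Nat.lt_succ_iff_lt_or_eq.1 hj with h1 | h1
      · exact h j h1
      · rw [Fin.ext h1]; exact h'
  · refine sum_congr rfl fun b' _ => ?_
    exact if_congr (hpast b' i).symm rfl rfl

end Telescope

end MADB

namespace MADB

open Finset

/-! ### The single-letter joint law and its channels -/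

section Kernel

variable {S T A B : Type*} [Fintype S] [Fintype T]

theorem law_equiv {Ω Ω' : Type*} [Fintype Ω] [Fintype Ω'] (e : Ω' ≃ Ω) (p : Ω → ℝ) (f : Ω → A) :
    law p f = law (fun ω => p (e ω)) (fun ω => f (e ω)) := by
  classical
  funext a
  simp only [law]
  exact (e.sum_comp fun ω => if f ω = a then p ω else 0).symm

theorem law_fst {p : S × T → ℝ} {p₁ : S → ℝ} {κ : S → T → ℝ} (hp : ∀ s t, p (s, t) = p₁ s * κ s t)
    (hκ : ∀ s, ∑ t, κ s t = 1) (f : S → A) (a : A) :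
    law p (fun x => f x.1) a = law p₁ f a := by
  classical
  simp only [law, Fintype.sum_prod_type, hp]
  refine sum_congr rfl fun s _ => ?_
  by_cases h : f s = a
  · simp [h, ← mul_sum, hκ]
  · simp [h]

open Classical in
/-- Joint law of a function of the input and of the output of a channel. -/
theorem law_kernel {p : S × T → ℝ} {p₁ : S → ℝ} {κ : S → T → ℝ}
    (hp : ∀ s t, p (s, t) = p₁ s * κ s t) (f : S → A) (γ : S → T → B)
    (κ' : A → B → ℝ) (h : ∀ s b, (∑ t, if γ s t = b then κ s t else 0) = κ' (f s) b) (a : A) (b : B) :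
    law p (fun x => (f x.1, γ x.1 x.2)) (a, b) = law p₁ f a * κ' a b := by
  simp only [law, Fintype.sum_prod_type, hp, Prod.mk.injEq, sum_mul]
  refine sum_congr rfl fun s _ => ?_
  by_cases hs : f s = a
  · subst hs
    simp only [true_and, if_true, ← h, mul_sum]
    refine sum_congr rfl fun t _ => ?_
    split_ifs <;> simp
  · simp [hs]

end Kernel

section Joint

variable {q : ℕ} [NeZero q] {Y : Type*} [Fintype Y]

namespace Sample

variable {k : ℕ}

def x₁ (s : Sample q Y k) : ZMod q := s.1
def x₂ (s : Sample q Y k) : ZMod q := s.2.1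
def x₃ (s : Sample q Y k) : ZMod q := s.2.2.1
def v (s : Sample q Y k) : Fin k := s.2.2.2.1
def y₃ (s : Sample q Y k) : Y := s.2.2.2.2.1
def z₁ (s : Sample q Y k) : ZMod q := s.2.2.2.2.2.1
def z₂ (s : Sample q Y k) : ZMod q := s.2.2.2.2.2.2
/-- What user 1 receives after subtracting its own input. -/
def w₁ (s : Sample q Y k) : ZMod q := s.x₃ + s.z₁
/-- What user 2 receives after subtracting its own input. -/
def w₂ (s : Sample q Y k) : ZMod q := s.x₃ + s.z₁ + s.z₂
def x₂₃ (s : Sample q Y k) : ZMod q × ZMod q := (s.x₂, s.x₃)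
def x₁₃ (s : Sample q Y k) : ZMod q × ZMod q := (s.x₁, s.x₃)
def x₁₂ (s : Sample q Y k) : ZMod q × ZMod q := (s.x₁, s.x₂)

/-- Separation of the inputs and the randomness of the channel. -/
def split (q : ℕ) (Y : Type*) (k : ℕ) :
    (ZMod q × ZMod q × ZMod q × Fin k) × (Y × ZMod q × ZMod q) ≃ Sample q Y k where
  toFun s := (s.1.1, s.1.2.1, s.1.2.2.1, s.1.2.2.2, s.2.1, s.2.2.1, s.2.2.2)
  invFun s := ((s.1, s.2.1, s.2.2.1, s.2.2.2.1), (s.2.2.2.2.1, s.2.2.2.2.2.1, s.2.2.2.2.2.2))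
  left_inv _ := rfl
  right_inv _ := rfl

/-- Separation of the noise `Z₂` and the rest. -/
def splitNoise (q : ℕ) (Y : Type*) (k : ℕ) :
    ((ZMod q × ZMod q × ZMod q × Fin k) × (Y × ZMod q)) × ZMod q ≃ Sample q Y k where
  toFun s := (s.1.1.1, s.1.1.2.1, s.1.1.2.2.1, s.1.1.2.2.2, s.1.2.1, s.1.2.2, s.2)
  invFun s := (((s.1, s.2.1, s.2.2.1, s.2.2.2.1), (s.2.2.2.2.1, s.2.2.2.2.2.1)), s.2.2.2.2.2.2)
  left_inv _ := rfl
  right_inv _ := rfl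

end Sample

open Sample

variable (ch : Channel q Y) {k : ℕ}

theorem mem_rateRegion (P : ZMod q × ZMod q × ZMod q × Fin k → ℝ) (R : Link → ℝ) :
    R ∈ rateRegion ch P ↔ (∀ l, 0 ≤ R l) ∧
      R .l13 ≤ condMutualInfo (jointDist ch P) x₁ y₃ x₂₃ ∧
      R .l23 ≤ condMutualInfo (jointDist ch P) x₂ y₃ x₁₃ ∧
      R .l13 + R .l23 ≤ condMutualInfo (jointDist ch P) x₁₂ y₃ x₃ ∧
      R .l31 ≤ condMutualInfo (jointDist ch P) x₃ w₁ v ∧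
      R .l32 ≤ mutualInfo (jointDist ch P) v w₂ := Iff.rfl

theorem sum_trans (x₁ x₂ x₃ : ZMod q) : ∑ y, ch.trans x₁ x₂ x₃ y = 1 := (ch.trans_mem x₁ x₂ x₃).2

theorem sum_noise₁ : ∑ z, ch.noise₁ z = 1 := ch.noise₁_mem.2

theorem sum_noise₂ : ∑ z, ch.noise₂ z = 1 := ch.noise₂_mem.2

theorem sum_randomness (x₁ x₂ x₃ : ZMod q) :
    ∑ t : Y × ZMod q × ZMod q, ch.trans x₁ x₂ x₃ t.1 * ch.noise₁ t.2.1 * ch.noise₂ t.2.2 = 1 := by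
  simp only [Fintype.sum_prod_type, ← mul_sum, sum_noise₂, sum_noise₁, sum_trans, mul_one]

theorem jointDist_split (P : ZMod q × ZMod q × ZMod q × Fin k → ℝ)
    (s : ZMod q × ZMod q × ZMod q × Fin k) (t : Y × ZMod q × ZMod q) :
    jointDist ch P (split q Y k (s, t)) =
      P s * (ch.trans s.1 s.2.1 s.2.2.1 t.1 * ch.noise₁ t.2.1 * ch.noise₂ t.2.2) := by
  simp only [jointDist, split, Equiv.coe_fn_mk]
  ring

theorem jointDist_mem_stdSimplex {P : ZMod q × ZMod q × ZMod q × Fin k → ℝ}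
    (hP : P ∈ stdSimplex ℝ _) : jointDist ch P ∈ stdSimplex ℝ (Sample q Y k) := by
  constructor
  · rintro ⟨x₁, x₂, x₃, v, y, z₁, z₂⟩
    exact mul_nonneg (mul_nonneg (mul_nonneg (hP.1 _) ((ch.trans_mem _ _ _).1 _))
      (ch.noise₁_mem.1 _)) (ch.noise₂_mem.1 _)
  · rw [← (split q Y k).sum_comp, Fintype.sum_prod_type]
    simp only [jointDist_split, ← mul_sum, sum_randomness, mul_one, hP.2]

/-- Laws of functions of the inputs. -/
theorem law_jointDist_input {A : Type*} (P : ZMod q × ZMod q × ZMod q × Fin k → ℝ)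
    (f : Sample q Y k → A) (f' : ZMod q × ZMod q × ZMod q × Fin k → A)
    (hf : ∀ s t, f (split q Y k (s, t)) = f' s) (a : A) :
    law (jointDist ch P) f a = law P f' a := by
  rw [law_equiv (split q Y k)]
  have : (fun ω => f (split q Y k ω)) = fun ω => f' ω.1 := funext fun ω => hf ω.1 ω.2
  rw [this]
  exact law_fst (fun s t => jointDist_split ch P s t) (fun s => sum_randomness ch _ _ _) f' a

theorem law_jointDist_y₃ (P : ZMod q × ZMod q × ZMod q × Fin k → ℝ) (a b c : ZMod q) (y : Y) :
    law (jointDist ch P) (fun s => ((s.x₁, s.x₂, s.x₃), s.y₃)) ((a, b, c), y) =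
      law (jointDist ch P) (fun s => (s.x₁, s.x₂, s.x₃)) (a, b, c) * ch.trans a b c y := by
  rw [law_jointDist_input ch P (fun s => (s.x₁, s.x₂, s.x₃)) (fun s => (s.1, s.2.1, s.2.2.1))
    (fun _ _ => rfl), law_equiv (split q Y k)]
  refine law_kernel (fun s t => jointDist_split ch P s t) (fun s => (s.1, s.2.1, s.2.2.1))
    (fun _ t => t.1) (fun a y => ch.trans a.1 a.2.1 a.2.2 y) ?_ (a, b, c) y
  intro s b
  rw [Fintype.sum_prod_type, Finset.sum_eq_single b]
  · simp only [if_true, Fintype.sum_prod_type, ← mul_sum, sum_noise₂, sum_noise₁, mul_one]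
  · intro y _ hy
    simp [hy]
  · simp

theorem law_jointDist_w₁ (P : ZMod q × ZMod q × ZMod q × Fin k → ℝ) (a : ZMod q) (b : Fin k)
    (y : ZMod q) :
    law (jointDist ch P) (fun s => ((s.x₃, s.v), s.w₁)) ((a, b), y) =
      law (jointDist ch P) (fun s => (s.x₃, s.v)) (a, b) * ch.noise₁ (y - a) := by
  rw [law_jointDist_input ch P (fun s => (s.x₃, s.v)) (fun s => s.2.2)
    (fun _ _ => rfl), law_equiv (split q Y k)]
  refine law_kernel (fun s t => jointDist_split ch P s t) (fun s => s.2.2)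
    (fun s t => s.2.2.1 + t.2.1) (fun a y => ch.noise₁ (y - a.1)) ?_ (a, b) y
  intro s b
  simp only [Fintype.sum_prod_type]
  rw [sum_congr rfl fun y _ => Finset.sum_eq_single (b - s.2.2.1) ?_ (by simp)]
  · simp only [add_sub_cancel, if_true, ← mul_sum, ← sum_mul, sum_noise₂, sum_trans, mul_one,
      one_mul]
  · intro z _ hz
    have : s.2.2.1 + z ≠ b := fun h => hz (by rw [← h]; ring)
    simp [this]

/-- This is the Markov chain V, X3 + Z1, X3 + Z1 + Z2. Only Z2 is split off as channel randomness,
so that Z1, and with it the output of user 1, counts as input. -/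
theorem law_jointDist_w₂ (P : ZMod q × ZMod q × ZMod q × Fin k → ℝ) (a : Fin k)
    (y y' : ZMod q) :
    law (jointDist ch P) (fun s => ((s.v, s.w₁), s.w₂)) ((a, y), y') =
      law (jointDist ch P) (fun s => (s.v, s.w₁)) (a, y) * ch.noise₂ (y' - y) := by
  have hp : ∀ s t, jointDist ch P (splitNoise q Y k (s, t)) =
      (P s.1 * (ch.trans s.1.1 s.1.2.1 s.1.2.2.1 s.2.1 * ch.noise₁ s.2.2)) * ch.noise₂ t := by
    intro s t
    simp only [jointDist, splitNoise, Equiv.coe_fn_mk]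
    ring
  rw [law_equiv (splitNoise q Y k), law_equiv (splitNoise q Y k) _ fun s => (s.v, s.w₁)]
  refine (law_kernel (S := (ZMod q × ZMod q × ZMod q × Fin k) × (Y × ZMod q)) (T := ZMod q)
    (κ := fun _ t => ch.noise₂ t) hp (fun s => (s.1.2.2.2, s.1.2.2.1 + s.2.2))
    (fun s t => s.1.2.2.1 + s.2.2 + t) (fun a y => ch.noise₂ (y - a.2)) ?_ (a, y) y').trans ?_
  · intro s b
    rw [Finset.sum_eq_single (b - (s.1.2.2.1 + s.2.2)) ?_ (by simp)]
    · simp only [add_sub_cancel, if_true]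
    · intro z _ hz
      have : s.1.2.2.1 + s.2.2 + z ≠ b := fun h => hz (by rw [← h]; ring)
      simp [this]
  · congr 1
    exact (law_fst (p := fun x => jointDist ch P (splitNoise q Y k x))
      (κ := fun _ t => ch.noise₂ t) hp (fun _ => sum_noise₂ ch) (fun s => (s.1.2.2.2, s.1.2.2.1 + s.2.2)) (a, y)).symm

/-- The channel of user 2 is a degraded version of the channel of user 1. -/
theorem mutualInfo_w₂_le {P : ZMod q × ZMod q × ZMod q × Fin k → ℝ} (hP : P ∈ stdSimplex ℝ _) :
    mutualInfo (jointDist ch P) v w₂ ≤ mutualInfo (jointDist ch P) v w₁ := by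
  refine mutualInfo_le_of_channel (jointDist_mem_stdSimplex ch hP) v w₁ w₂
    (fun y y' => ch.noise₂ (y' - y)) (fun y y' => ch.noise₂_mem.1 _) (fun y => ?_) fun a b c => ?_
  · rw [← sum_noise₂ ch]
    exact (Equiv.subRight y).sum_comp fun z => ch.noise₂ z
  · rw [← law_jointDist_w₂]
    exact law_comp_injective (jointDist ch P) (fun s => ((s.v, s.w₁), s.w₂))
      (e := fun x => (x.1.1, x.1.2, x.2)) (fun x y => by simp [Prod.ext_iff, and_assoc]) ((a, b), c)

end Joint

end MADB

namespace MADB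

open Finset

/-! ### Reduction of the support of a nonnegative combination -/

section Support

variable {V J : Type*} [Fintype V] [Fintype J] [DecidableEq V]

/-- A nonnegative combination with more terms than equality constraints can be replaced by one with
fewer terms, without decreasing a given linear objective. -/
theorem exists_smaller_support (a : V → J → ℝ) (c m : V → ℝ) (ℓ : (J → ℝ) →ₗ[ℝ] ℝ)
    (hm : ∀ v, m v = ℓ (a v)) {t : V → ℝ} (ht : ∀ v, 0 ≤ t v) (hpos : ∀ v, t v ≠ 0 → 0 < m v)
    (hcard : Fintype.card J < #{v | t v ≠ 0}) :
    ∃ t' : V → ℝ, (∀ v, 0 ≤ t' v) ∧ (∀ v, t v = 0 → t' v = 0) ∧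
      #{v | t' v ≠ 0} < #{v | t v ≠ 0} ∧
      (∀ j, ∑ v, t' v * a v j = ∑ v, t v * a v j) ∧ ∑ v, t v * c v ≤ ∑ v, t' v * c v := by
  set s : Finset V := {v | t v ≠ 0} with hs
  -- The support has more points than the dimension of `J → ℝ`, so the constraint vectors on it are
  -- linearly dependent; moving along `g` preserves all constraints.
  obtain ⟨g, hg0, hg1, hgs⟩ : ∃ g : V → ℝ, (∀ j, ∑ v, g v * a v j = 0) ∧ (∃ v, g v ≠ 0) ∧
      ∀ v, t v = 0 → g v = 0 := by
    have hdep : ¬ LinearIndependent ℝ fun v : s => a v := fun h => by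
      have := h.fintype_card_le_finrank
      simp only [Fintype.card_coe, Module.finrank_fintype_fun_eq_card] at this
      omega
    obtain ⟨f, hf, i, hi⟩ := Fintype.not_linearIndependent_iff.1 hdep
    refine ⟨fun v => if h : v ∈ s then f ⟨v, h⟩ else 0, fun j => ?_, ⟨i, by simpa using hi⟩, ?_⟩
    · have hj := congrFun hf j
      simp only [Finset.sum_apply, Pi.smul_apply, smul_eq_mul, Pi.zero_apply] at hj
      refine Eq.trans ?_ hj
      rw [← sum_subset (subset_univ s) (fun v _ hv => by simp [hv]), ← sum_coe_sort s]
      simp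
    · intro v hv
      have : v ∉ s := by simp [hs, hv]
      simp [this]
  -- The sign of `g` is chosen so that the objective does not decrease.
  wlog hc : 0 ≤ ∑ v, g v * c v generalizing g
  · obtain ⟨w, hw⟩ := hg1
    refine this (fun v => -g v) (fun j => ?_) ⟨w, by simpa using hw⟩
      (fun v hv => by simp [hgs v hv]) ?_
    · simp [hg0 j]
    · simp only [neg_mul, sum_neg_distrib]
      linarith
  -- The mass is a linear function of the constraint vector, so its preservation needs no constraint
  -- of its own. Being positive on the support, it forces `g` to take a negative value.
  have hmass : ∑ v, g v * m v = 0 := by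
    have : ∑ v, g v • a v = 0 := by
      funext j
      simpa using hg0 j
    have := congrArg ℓ this
    simpa [← hm] using this
  have hneg : ∃ v, g v < 0 := by
    by_contra! h
    obtain ⟨w, hw⟩ := hg1
    have hnn : ∀ v ∈ univ, 0 ≤ g v * m v := fun v _ => by
      by_cases hv : t v = 0
      · simp [hgs v hv]
      · exact mul_nonneg (h v) (hpos v hv).le
    have := (sum_eq_zero_iff_of_nonneg hnn).1 hmass w (mem_univ w)
    have hw' : t w ≠ 0 := fun h => hw (hgs w h)
    exact (mul_ne_zero hw (hpos w hw').ne') this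
  -- Ratio test: `t w / (-g w)` is the longest step along `g` that keeps all weights nonnegative,
  -- and it makes the weight at `w` vanish.
  obtain ⟨w, hw, hmin⟩ := exists_min_image ({v | g v < 0} : Finset V) (fun v => t v / (-g v))
    (by obtain ⟨v, hv⟩ := hneg; exact ⟨v, by simpa using hv⟩)
  simp only [mem_filter, mem_univ, true_and] at hw hmin
  set r := t w / (-g w) with hr
  have hr0 : 0 ≤ r := div_nonneg (ht w) (by linarith)
  refine ⟨fun v => t v + r * g v, fun v => ?_, fun v hv => by simp [hv, hgs v hv], ?_, fun j => ?_,
    ?_⟩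
  · rcases lt_or_ge (g v) 0 with h | h
    · have := hmin v h
      rw [le_div_iff₀ (by linarith)] at this
      linarith
    · have := mul_nonneg hr0 h
      linarith [ht v]
  · refine card_lt_card ⟨fun v hv => ?_, fun hsub => ?_⟩
    · simp only [mem_filter, mem_univ, true_and, hs] at hv ⊢
      exact fun h => hv (by simp [h, hgs v h])
    · have hws : w ∈ s := by
        simp only [hs, mem_filter, mem_univ, true_and]
        exact fun h => hw.ne (hgs w h)
      have := hsub hws
      simp only [mem_filter, mem_univ, true_and] at this
      refine this ?_
      rw [hr]
      field_simp [hw.ne]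
      ring
  · simp only [add_mul, sum_add_distrib, mul_assoc, ← mul_sum, hg0 j, mul_zero, add_zero]
  · simp only [add_mul, sum_add_distrib, mul_assoc, ← mul_sum]
    have := mul_nonneg hr0 hc
    linarith

/-- A nonnegative combination can be supported on as many terms as there are equality constraints,
without decreasing a given linear objective. -/
theorem exists_small_support (a : V → J → ℝ) (c m : V → ℝ) (ℓ : (J → ℝ) →ₗ[ℝ] ℝ)
    (hm : ∀ v, m v = ℓ (a v)) (t : V → ℝ) (ht : ∀ v, 0 ≤ t v) (hpos : ∀ v, t v ≠ 0 → 0 < m v) :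
    ∃ t' : V → ℝ, (∀ v, 0 ≤ t' v) ∧ #{v | t' v ≠ 0} ≤ Fintype.card J ∧
      (∀ j, ∑ v, t' v * a v j = ∑ v, t v * a v j) ∧ ∑ v, t v * c v ≤ ∑ v, t' v * c v := by
  induction h : #{v | t v ≠ 0} using Nat.strong_induction_on generalizing t with
  | _ N ih =>
    by_cases hN : N ≤ Fintype.card J
    · exact ⟨t, ht, h.trans_le hN, fun _ => rfl, le_rfl⟩
    · obtain ⟨t₁, h0, hz, hlt, heq, hle⟩ :=
        exists_smaller_support a c m ℓ hm ht hpos (by omega)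
      obtain ⟨t₂, h0', hk, heq', hle'⟩ := ih _ (h ▸ hlt) t₁ h0
        (fun v hv => hpos v fun h => hv (hz v h)) rfl
      exact ⟨t₂, h0', hk, fun j => (heq' j).trans (heq j), hle.trans hle'⟩

end Support

end MADB

namespace MADB

open Finset Sample

/-! ### The multiple-access and broadcast terms as sums over values of X3 and of V -/

section Reduction

variable {q : ℕ} [NeZero q] {Y : Type*} [Fintype Y] (ch : Channel q Y) {k : ℕ}

theorem macDist_mem_stdSimplex {Q : ZMod q × ZMod q → ℝ} (hQ : Q ∈ stdSimplex ℝ _) (c : ZMod q) :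
    macDist ch Q c ∈ stdSimplex ℝ (ZMod q × ZMod q × Y) := by
  refine ⟨fun s => mul_nonneg (hQ.1 _) ((ch.trans_mem _ _ _).1 _), ?_⟩
  simp only [macDist, Fintype.sum_prod_type, ← mul_sum, sum_trans, mul_one]
  rw [← hQ.2, Fintype.sum_prod_type]

variable {P : ZMod q × ZMod q × ZMod q × Fin k → ℝ} {r : ZMod q → ℝ}
  {Q : ZMod q → ZMod q × ZMod q → ℝ}

/-- The hypothesis is a factorization `r c * Q c (a, b)` rather than a conditional probability; `Q
c` is thus free where `r c = 0`, and conditioning on a null event never arises. -/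
theorem law_jointDist_mac (hP : ∀ a b c, law P (fun s => (s.1, s.2.1, s.2.2.1)) (a, b, c) =
      r c * Q c (a, b)) :
    law (jointDist ch P) (fun s => ((s.x₁, s.x₂, s.y₃), s.x₃)) =
      fun s => r s.2 * macDist ch (Q s.2) s.2 s.1 := by
  funext s
  obtain ⟨⟨a, b, y⟩, c⟩ := s
  have h1 := law_comp_injective (jointDist ch P) (fun s => ((s.x₁, s.x₂, s.x₃), s.y₃))
      (e := fun x => ((x.1.1, x.1.2.1, x.2), x.1.2.2))
      (fun x y => by simp only [Prod.ext_iff]; tauto) ((a, b, c), y)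
  simp only at h1
  rw [h1, law_jointDist_y₃, law_jointDist_input ch P (fun s => (s.x₁, s.x₂, s.x₃))
    (fun s => (s.1, s.2.1, s.2.2.1)) (fun _ _ => rfl), hP, macDist]
  ring

theorem condMutualInfo_mac₁ (hP : ∀ a b c, law P (fun s => (s.1, s.2.1, s.2.2.1)) (a, b, c) =
      r c * Q c (a, b)) :
    condMutualInfo (jointDist ch P) x₁ y₃ x₂₃ = ∑ c, r c * macInfo₁ ch (Q c) c := by
  have h := condMutualInfo_law (jointDist ch P) (fun s => ((s.x₁, s.x₂, s.y₃), s.x₃))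
    (fun s => s.1.1) (fun s => s.1.2.2) (fun s => (s.1.2.1, s.2))
  rw [law_jointDist_mac ch hP, condMutualInfo_slice r (fun c => macDist ch (Q c) c)
    (fun s => s.1) (fun s => s.2.2) (fun s => s.2.1)] at h
  exact h.symm

theorem condMutualInfo_mac₂ (hP : ∀ a b c, law P (fun s => (s.1, s.2.1, s.2.2.1)) (a, b, c) =
      r c * Q c (a, b)) :
    condMutualInfo (jointDist ch P) x₂ y₃ x₁₃ = ∑ c, r c * macInfo₂ ch (Q c) c := by
  have h := condMutualInfo_law (jointDist ch P) (fun s => ((s.x₁, s.x₂, s.y₃), s.x₃))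
    (fun s => s.1.2.1) (fun s => s.1.2.2) (fun s => (s.1.1, s.2))
  rw [law_jointDist_mac ch hP, condMutualInfo_slice r (fun c => macDist ch (Q c) c)
    (fun s => s.2.1) (fun s => s.2.2) (fun s => s.1)] at h
  exact h.symm

theorem condMutualInfo_mac₁₂ (hQ : ∀ c, Q c ∈ stdSimplex ℝ _)
    (hP : ∀ a b c, law P (fun s => (s.1, s.2.1, s.2.2.1)) (a, b, c) = r c * Q c (a, b)) :
    condMutualInfo (jointDist ch P) x₁₂ y₃ x₃ = ∑ c, r c * macInfo₁₂ ch (Q c) c := by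
  have h := condMutualInfo_law (jointDist ch P) (fun s => ((s.x₁, s.x₂, s.y₃), s.x₃))
    (fun s => (s.1.1, s.1.2.1)) (fun s => s.1.2.2) (fun s => s.2)
  rw [law_jointDist_mac ch hP, condMutualInfo_slice_mutualInfo r (fun c => macDist ch (Q c) c)
    (fun c => macDist_mem_stdSimplex ch (hQ c) c) (fun s => (s.1, s.2.1)) (fun s => s.2.2)] at h
  exact h.symm

/-- The (unnormalized) law of `(X₃, Z₁, Z₂)` when `X₃` has the (unnormalized) law `u`. -/
def bcDist (u : ZMod q → ℝ) (s : ZMod q × ZMod q × ZMod q) : ℝ :=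
  u s.1 * ch.noise₁ s.2.1 * ch.noise₂ s.2.2

/-- The (unnormalized) law of `X₃ + Z₁ + Z₂` when `X₃` has the (unnormalized) law `u`. -/
noncomputable def bcOut (u : ZMod q → ℝ) : ZMod q → ℝ :=
  law (bcDist ch u) fun s => s.1 + s.2.1 + s.2.2

/-- The contribution of one value of `V` to `I(X₃; X₃ + Z₁ | V)`. -/
noncomputable def bcInfo₁ (u : ZMod q → ℝ) : ℝ :=
  condMutualInfo (bcDist ch u) (fun s => s.1) (fun s => s.1 + s.2.1) fun _ => ()

/-- The contribution of one value of `V` to `I(V; X₃ + Z₁ + Z₂)` when the output has law `N`. -/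
noncomputable def bcInfo₂ (N : ZMod q → ℝ) (u : ZMod q → ℝ) : ℝ :=
  ∑ s, bcDist ch u s * Real.logb 2 (bcOut ch u (s.1 + s.2.1 + s.2.2) /
    ((∑ x, u x) * N (s.1 + s.2.1 + s.2.2)))

theorem bcDist_smul (t : ℝ) (u : ZMod q → ℝ) :
    bcDist ch (fun x => t * u x) = fun s => t * bcDist ch u s := by
  funext s
  simp only [bcDist]
  ring

theorem bcOut_smul (t : ℝ) (u : ZMod q → ℝ) (y : ZMod q) :
    bcOut ch (fun x => t * u x) y = t * bcOut ch u y := by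
  rw [bcOut, bcDist_smul, law_smul, bcOut]

/-- Homogeneity of degree one makes the information linear in the weights of the values of V, as the
support reduction requires. -/
theorem bcInfo₁_smul (t : ℝ) (u : ZMod q → ℝ) :
    bcInfo₁ ch (fun x => t * u x) = t * bcInfo₁ ch u := by
  rw [bcInfo₁, bcDist_smul]
  -- Scaling is slicing over a one-point set.
  have := condMutualInfo_slice_unit (D := Unit) (fun _ => t) (fun _ => bcDist ch u)
    (fun s => s.1) (fun s => s.1 + s.2.1)
  simp only [univ_unique, sum_singleton] at this
  rw [bcInfo₁, ← this]
  have h := condMutualInfo_law (fun s => t * bcDist ch u s) (fun s => (s, ()))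
    (fun s => s.1.1) (fun s => s.1.1 + s.1.2.1) (fun s => s.2)
  refine h.symm.trans ?_
  congr 1
  funext s
  exact law_comp_injective (fun s => t * bcDist ch u s) (fun s => s) (e := fun s => (s, ()))
    (fun x y h => by simpa using h) s.1 |>.trans (by rw [law_id])

theorem bcInfo₂_smul (N : ZMod q → ℝ) (t : ℝ) (u : ZMod q → ℝ) :
    bcInfo₂ ch N (fun x => t * u x) = t * bcInfo₂ ch N u := by
  simp only [bcInfo₂, mul_sum]
  refine sum_congr rfl fun s _ => ?_
  by_cases ht : t = 0
  · simp [bcDist, ht]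
  rw [bcDist_smul, bcOut_smul, ← mul_sum, mul_assoc t (∑ x, u x), mul_div_mul_left _ _ ht, mul_assoc]

/-- The idle factor 1 gives the law the shape expected by the slicing lemmas, with the unnormalized
law of X3 on {V = v} as slice. -/
theorem law_jointDist_bc :
    law (jointDist ch P) (fun s => ((s.x₃, s.z₁, s.z₂), s.v)) =
      fun s => 1 * bcDist ch (fun x => law P (fun s => (s.2.2.2, s.2.2.1)) (s.2, x)) s.1 := by
  classical
  funext s
  obtain ⟨⟨x, z, z'⟩, v⟩ := s
  have h1 := law_comp_injective (jointDist ch P) (fun s => ((s.v, s.x₃), s.z₁, s.z₂))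
      (e := fun x => ((x.1.2, x.2.1, x.2.2), x.1.1))
      (fun x y => by simp only [Prod.ext_iff]; tauto) ((v, x), z, z')
  simp only at h1
  rw [h1, law_equiv (split q Y k)]
  have h2 := law_kernel (p := fun x => jointDist ch P (split q Y k x))
    (κ := fun s t => ch.trans s.1 s.2.1 s.2.2.1 t.1 * ch.noise₁ t.2.1 * ch.noise₂ t.2.2)
    (fun s t => jointDist_split ch P s t) (fun s => (s.2.2.2, s.2.2.1))
    (fun _ t => t.2) (fun _ z => ch.noise₁ z.1 * ch.noise₂ z.2) (by
      rintro s ⟨z, z'⟩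
      simp only [Fintype.sum_prod_type, Prod.mk.injEq]
      rw [sum_congr rfl fun y _ => Finset.sum_eq_single z
          (fun b _ hb => by simp [hb]) (by simp),
        sum_congr rfl fun y _ => Finset.sum_eq_single z'
          (fun b _ hb => by simp [hb]) (by simp)]
      simp only [and_self, if_true, ← sum_mul, sum_trans, one_mul]) (v, x) (z, z')
  rw [one_mul]
  refine h2.trans ?_
  simp only [bcDist]
  ring

theorem condMutualInfo_bc :
    condMutualInfo (jointDist ch P) x₃ w₁ v =
      ∑ v, bcInfo₁ ch fun x => law P (fun s => (s.2.2.2, s.2.2.1)) (v, x) := by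
  have h := condMutualInfo_law (jointDist ch P) (fun s => ((s.x₃, s.z₁, s.z₂), s.v))
    (fun s => s.1.1) (fun s => s.1.1 + s.1.2.1) (fun s => s.2)
  rw [law_jointDist_bc, condMutualInfo_slice_unit (fun _ => 1)
    (fun v => bcDist ch (fun x => law P (fun s => (s.2.2.2, s.2.2.1)) (v, x)))
    (fun s => s.1) (fun s => s.1 + s.2.1)] at h
  simp only [one_mul] at h
  exact h.symm

theorem sum_bcDist (u : ZMod q → ℝ) : ∑ s, bcDist ch u s = ∑ x, u x := by
  simp only [bcDist, Fintype.sum_prod_type, ← mul_sum, sum_noise₁, sum_noise₂, mul_one]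

/-- The output law enters as a parameter of its own, computed from the marginal of X3. When that
marginal is held fixed, what remains is a sum of one homogeneous contribution for each value of V.
-/
theorem mutualInfo_bc :
    mutualInfo (jointDist ch P) v w₂ =
      ∑ v, bcInfo₂ ch (bcOut ch fun x => ∑ v, law P (fun s => (s.2.2.2, s.2.2.1)) (v, x))
        fun x => law P (fun s => (s.2.2.2, s.2.2.1)) (v, x) := by
  have h := mutualInfo_law (jointDist ch P) (fun s => ((s.x₃, s.z₁, s.z₂), s.v))
    (fun s => s.2) (fun s => s.1.1 + s.1.2.1 + s.1.2.2)
  rw [law_jointDist_bc] at h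
  refine h.symm.trans ?_
  set u : Fin k → ZMod q → ℝ := fun v x => law P (fun s => (s.2.2.2, s.2.2.1)) (v, x)
  rw [mutualInfo_eq_sum, Fintype.sum_prod_type, sum_comm]
  refine sum_congr rfl fun v _ => sum_congr rfl fun s _ => ?_
  simp only [one_mul]
  congr 2
  unfold ratio
  have hs := fun (v : Fin k) (y : ZMod q) => law_slice (fun _ => (1 : ℝ)) (fun v => bcDist ch (u v))
    (fun s => s.1 + s.2.1 + s.2.2) y v
  simp only [one_mul] at hs
  have e1 : ∀ v y, law (fun s : (ZMod q × ZMod q × ZMod q) × Fin k => bcDist ch (u s.2) s.1)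
      (fun s => (s.2, s.1.1 + s.1.2.1 + s.1.2.2)) (v, y) = bcOut ch (u v) y := by
    intro v y
    rw [bcOut, ← hs]
    exact law_comp_injective _
      (fun s : (ZMod q × ZMod q × ZMod q) × Fin k => (s.1.1 + s.1.2.1 + s.1.2.2, s.2)) (e := Prod.swap)
      Prod.swap_injective (y, v)
  have e2 : law (fun s : (ZMod q × ZMod q × ZMod q) × Fin k => bcDist ch (u s.2) s.1)
      (fun s => s.2) v = ∑ x, u v x := by
    rw [← sum_bcDist ch, ← sum_law (bcDist ch (u v))
        (fun s : ZMod q × ZMod q × ZMod q => s.1 + s.2.1 + s.2.2),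
      ← sum_law_pair_right _ _
        fun s : (ZMod q × ZMod q × ZMod q) × Fin k => s.1.1 + s.1.2.1 + s.1.2.2]
    exact sum_congr rfl fun y _ => e1 v y
  have e3 : ∀ y, law (fun s : (ZMod q × ZMod q × ZMod q) × Fin k => bcDist ch (u s.2) s.1)
      (fun s => s.1.1 + s.1.2.1 + s.1.2.2) y = bcOut ch (fun x => ∑ v, u v x) y := by
    intro y
    rw [← sum_law_pair_left _ (fun s : (ZMod q × ZMod q × ZMod q) × Fin k => s.2)]
    simp only [e1]
    simp only [bcOut, law, bcDist, sum_mul]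
    rw [sum_comm]
    refine sum_congr rfl fun s _ => ?_
    split_ifs <;> simp
  rw [e1, e2, e3]

end Reduction

end MADB

namespace MADB

open Finset Sample

/-! ### Product inputs suffice, and q + 1 values of V suffice -/

section Regions

variable {q : ℕ} [NeZero q] {Y : Type*} [Fintype Y] (ch : Channel q Y)

/-- Independent inputs of users 1 and 2, independent of the pair `(V, X₃)`. -/
def productDist {k : ℕ} (P₁ P₂ : ZMod q → ℝ) (P₃ : Fin k × ZMod q → ℝ) :
    ZMod q × ZMod q × ZMod q × Fin k → ℝ :=
  fun (x₁, x₂, x₃, v) => P₁ x₁ * P₂ x₂ * P₃ (v, x₃)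

variable {k : ℕ} {P₁ P₂ : ZMod q → ℝ} {P₃ : Fin k × ZMod q → ℝ}

theorem productDist_mem_stdSimplex (h₁ : P₁ ∈ stdSimplex ℝ (ZMod q))
    (h₂ : P₂ ∈ stdSimplex ℝ (ZMod q)) (h₃ : P₃ ∈ stdSimplex ℝ (Fin k × ZMod q)) :
    productDist P₁ P₂ P₃ ∈ stdSimplex ℝ _ := by
  refine ⟨fun s => mul_nonneg (mul_nonneg (h₁.1 _) (h₂.1 _)) (h₃.1 _), ?_⟩
  have h : ∑ x, ∑ v, P₃ (v, x) = 1 := by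
    rw [sum_comm, ← Fintype.sum_prod_type, h₃.2]
  simp only [productDist, Fintype.sum_prod_type, ← mul_sum, h, mul_one, h₂.2, h₁.2]

theorem law_productDist_x (a b c : ZMod q) :
    law (productDist P₁ P₂ P₃) (fun s => (s.1, s.2.1, s.2.2.1)) (a, b, c) =
      (∑ v, P₃ (v, c)) * (P₁ a * P₂ b) := by
  classical
  simp only [law, Fintype.sum_prod_type, productDist]
  rw [Finset.sum_eq_single a (fun x _ hx => by simp [hx]) (by simp),
    Finset.sum_eq_single b (fun x _ hx => by simp [hx]) (by simp),
    Finset.sum_eq_single c (fun x _ hx => by simp [hx]) (by simp)]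
  simp only [if_true, ← mul_sum]
  ring

theorem law_productDist_v (h₁ : P₁ ∈ stdSimplex ℝ (ZMod q))
    (h₂ : P₂ ∈ stdSimplex ℝ (ZMod q)) (v : Fin k) (x : ZMod q) :
    law (productDist P₁ P₂ P₃) (fun s => (s.2.2.2, s.2.2.1)) (v, x) = P₃ (v, x) := by
  classical
  simp only [law, Fintype.sum_prod_type, productDist]
  rw [sum_congr rfl fun a _ => sum_congr rfl fun b _ =>
      Finset.sum_eq_single x (fun x _ hx => by simp [hx]) (by simp),
    sum_congr rfl fun a _ => sum_congr rfl fun b _ =>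
      Finset.sum_eq_single v (fun x _ hx => by simp [hx]) (by simp)]
  simp only [if_true, ← mul_sum, ← sum_mul, h₂.2, h₁.2, mul_one, one_mul]

/-- The region of a product distribution in terms of its factors. -/
theorem mem_rateRegion_productDist (h₁ : P₁ ∈ stdSimplex ℝ (ZMod q))
    (h₂ : P₂ ∈ stdSimplex ℝ (ZMod q)) (R : Link → ℝ) :
    R ∈ rateRegion ch (productDist P₁ P₂ P₃) ↔ (∀ l, 0 ≤ R l) ∧
      R .l13 ≤ ∑ c, (∑ v, P₃ (v, c)) * macInfo₁ ch (fun x => P₁ x.1 * P₂ x.2) c ∧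
      R .l23 ≤ ∑ c, (∑ v, P₃ (v, c)) * macInfo₂ ch (fun x => P₁ x.1 * P₂ x.2) c ∧
      R .l13 + R .l23 ≤ ∑ c, (∑ v, P₃ (v, c)) * macInfo₁₂ ch (fun x => P₁ x.1 * P₂ x.2) c ∧
      R .l31 ≤ ∑ v, bcInfo₁ ch (fun x => P₃ (v, x)) ∧
      R .l32 ≤ ∑ v, bcInfo₂ ch (bcOut ch fun x => ∑ v, P₃ (v, x)) fun x => P₃ (v, x) := by
  have hQ : (fun x : ZMod q × ZMod q => P₁ x.1 * P₂ x.2) ∈ stdSimplex ℝ _ :=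
    ⟨fun x => mul_nonneg (h₁.1 _) (h₂.1 _), by
      simp only [Fintype.sum_prod_type, ← mul_sum, h₂.2, h₁.2, mul_one]⟩
  have hx := law_productDist_x (P₁ := P₁) (P₂ := P₂) (P₃ := P₃)
  set r : ZMod q → ℝ := fun c => ∑ v, P₃ (v, c)
  set Q : ZMod q → ZMod q × ZMod q → ℝ := fun _ x => P₁ x.1 * P₂ x.2
  replace hx : ∀ a b c, law (productDist P₁ P₂ P₃) (fun s => (s.1, s.2.1, s.2.2.1)) (a, b, c) =
      r c * Q c (a, b) := hx
  rw [mem_rateRegion, condMutualInfo_mac₁ ch hx, condMutualInfo_mac₂ ch hx,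
    condMutualInfo_mac₁₂ ch (fun _ => hQ) hx, condMutualInfo_bc, mutualInfo_bc]
  simp only [law_productDist_v h₁ h₂]
  exact Iff.rfl

/-- Under the domination hypothesis on the multiple-access part, every region is contained in the
region of a product distribution. -/
theorem exists_productDist_of_mem_rateRegion
    (h : ∀ Q : ZMod q → ZMod q × ZMod q → ℝ,
      (∀ x₃, Q x₃ ∈ stdSimplex ℝ (ZMod q × ZMod q)) →
      ∃ P₁ ∈ stdSimplex ℝ (ZMod q), ∃ P₂ ∈ stdSimplex ℝ (ZMod q), ∀ x₃ : ZMod q,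
        macInfo₁ ch (Q x₃) x₃ ≤ macInfo₁ ch (fun x => P₁ x.1 * P₂ x.2) x₃ ∧
        macInfo₂ ch (Q x₃) x₃ ≤ macInfo₂ ch (fun x => P₁ x.1 * P₂ x.2) x₃ ∧
        macInfo₁₂ ch (Q x₃) x₃ ≤ macInfo₁₂ ch (fun x => P₁ x.1 * P₂ x.2) x₃)
    {P : ZMod q × ZMod q × ZMod q × Fin k → ℝ} (hP : P ∈ stdSimplex ℝ _) {R : Link → ℝ}
    (hR : R ∈ rateRegion ch P) :
    ∃ P₁ ∈ stdSimplex ℝ (ZMod q), ∃ P₂ ∈ stdSimplex ℝ (ZMod q),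
      ∃ P₃ ∈ stdSimplex ℝ (Fin k × ZMod q), R ∈ rateRegion ch (productDist P₁ P₂ P₃) := by
  classical
  set J := law P (fun s => (s.1, s.2.1, s.2.2.1)) with hJ
  set r := law P (fun s => s.2.2.1) with hr
  have hJ0 : ∀ x, 0 ≤ J x := law_nonneg hP.1 _
  have hr0 : ∀ c, 0 ≤ r c := law_nonneg hP.1 _
  have hJr : ∀ c, ∑ x : ZMod q × ZMod q, J (x.1, x.2, c) = r c := by
    intro c
    rw [hr, ← sum_law_pair_left P (fun s => (s.1, s.2.1))]
    exact sum_congr rfl fun x _ => (law_comp_injective P (fun s => ((s.1, s.2.1), s.2.2.1))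
      (e := fun x => (x.1.1, x.1.2, x.2)) (fun x y => by simp [Prod.ext_iff, and_assoc]) (x, c))
  -- The conditional law of (X1, X2) given X3, with an arbitrary point mass where X3 has probability
  -- zero.
  set Q : ZMod q → ZMod q × ZMod q → ℝ := fun c =>
    if r c = 0 then Pi.single (0, 0) 1 else fun x => J (x.1, x.2, c) / r c with hQdef
  have hQ : ∀ c, Q c ∈ stdSimplex ℝ (ZMod q × ZMod q) := by
    intro c
    by_cases hc : r c = 0
    · simp only [hQdef, hc, if_true]
      exact single_mem_stdSimplex ℝ (0, 0)
    · simp only [hQdef, hc, if_false]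
      exact ⟨fun x => div_nonneg (hJ0 _) (hr0 c), by rw [← sum_div, hJr, div_self hc]⟩
  have hfac : ∀ a b c, J (a, b, c) = r c * Q c (a, b) := by
    intro a b c
    by_cases hc : r c = 0
    · have := (sum_eq_zero_iff_of_nonneg fun x _ => hJ0 (x.1, x.2, c)).1 ((hJr c).trans hc) (a, b)
        (mem_univ _)
      simpa [hc] using this
    · simp only [hQdef, hc, if_false]
      field_simp
  obtain ⟨P₁, h₁, P₂, h₂, hdom⟩ := h Q hQ
  -- The law of (V, X3) is kept, so the broadcast terms do not change and the multiple-access terms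
  -- are averaged with the same weights `r`.
  refine ⟨P₁, h₁, P₂, h₂, law P (fun s => (s.2.2.2, s.2.2.1)), law_mem_stdSimplex hP _, ?_⟩
  rw [mem_rateRegion, condMutualInfo_mac₁ ch hfac, condMutualInfo_mac₂ ch hfac,
    condMutualInfo_mac₁₂ ch hQ hfac, condMutualInfo_bc, mutualInfo_bc] at hR
  rw [mem_rateRegion_productDist ch h₁ h₂]
  have hm : ∀ c, ∑ v, law P (fun s => (s.2.2.2, s.2.2.1)) (v, c) = r c := fun c =>
    sum_law_pair_left P (fun s => s.2.2.2) (fun s => s.2.2.1) c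
  simp only [hm] at hR ⊢
  obtain ⟨hR0, hR1, hR2, hR3, hR4, hR5⟩ := hR
  exact ⟨hR0, hR1.trans (sum_le_sum fun c _ => mul_le_mul_of_nonneg_left (hdom c).1 (hr0 c)),
    hR2.trans (sum_le_sum fun c _ => mul_le_mul_of_nonneg_left (hdom c).2.1 (hr0 c)),
    hR3.trans (sum_le_sum fun c _ => mul_le_mul_of_nonneg_left (hdom c).2.2 (hr0 c)), hR4, hR5⟩

/-- The alphabet of the auxiliary variable may be taken to have at most `q + 1` elements. -/
theorem exists_small_alphabet (h₁ : P₁ ∈ stdSimplex ℝ (ZMod q))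
    (h₂ : P₂ ∈ stdSimplex ℝ (ZMod q)) (h₃ : P₃ ∈ stdSimplex ℝ (Fin k × ZMod q)) {R : Link → ℝ}
    (hR : R ∈ rateRegion ch (productDist P₁ P₂ P₃)) :
    ∃ k' ≤ q + 1, ∃ P₃' ∈ stdSimplex ℝ (Fin k' × ZMod q),
      R ∈ rateRegion ch (productDist P₁ P₂ P₃') := by
  classical
  set u : Fin k → ZMod q → ℝ := fun v x => P₃ (v, x) with hu
  set N := bcOut ch fun x => ∑ v, u v x with hN
  set m : Fin k → ℝ := fun v => ∑ x, u v x with hm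
  have hm0 : ∀ v, 0 ≤ m v := fun v => sum_nonneg fun x _ => h₃.1 _
  -- Values of V with probability zero receive weight 0, because the support reduction requires
  -- positive mass wherever the weight is nonzero.
  set t : Fin k → ℝ := fun v => if m v = 0 then 0 else 1 with ht
  have htu : ∀ v, (fun x => t v * u v x) = u v := by
    intro v
    funext x
    by_cases hv : m v = 0
    · have := (sum_eq_zero_iff_of_nonneg fun x _ => h₃.1 (v, x)).1 hv x (mem_univ _)
      simp [hu, this]
    · simp [ht, hv]
  -- The q + 1 constraints are the q probabilities of X3, indexed by `some x`, and the contribution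
  -- to I(V; X3 + Z1 + Z2), indexed by `none`; the objective is I(X3; X3 + Z1 | V). Fixing the
  -- marginal of X3 fixes the output law `N` and the multiple-access terms.
  obtain ⟨t', ht0, hcard, heq, hle⟩ := exists_small_support (J := Option (ZMod q))
    (fun v j => j.elim (bcInfo₂ ch N (u v)) (u v)) (fun v => bcInfo₁ ch (u v)) m
    (∑ x, LinearMap.proj (some x)) (fun v => by simp [hm]) t
    (fun v => by simp only [ht]; split_ifs <;> simp)
    (fun v hv => (hm0 v).lt_of_ne fun h => hv (by simp [ht, ← h]))
  have heq1 : ∀ x, ∑ v, t' v * u v x = ∑ v, u v x := by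
    intro x
    have := heq (some x)
    simp only [Option.elim] at this
    rw [this]
    exact sum_congr rfl fun v _ => congrFun (htu v) x
  have heq2 : ∑ v, t' v * bcInfo₂ ch N (u v) = ∑ v, bcInfo₂ ch N (u v) := by
    have := heq none
    simp only [Option.elim] at this
    rw [this]
    exact sum_congr rfl fun v _ => by rw [← bcInfo₂_smul, htu]
  have hle1 : ∑ v, bcInfo₁ ch (u v) ≤ ∑ v, t' v * bcInfo₁ ch (u v) := by
    refine le_trans (le_of_eq ?_) hle
    exact sum_congr rfl fun v _ => by rw [← bcInfo₁_smul, htu]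
  set s : Finset (Fin k) := {v | t' v ≠ 0} with hs
  have hsum : ∀ G : Fin k → ℝ, ∑ j : Fin #s, t' (s.equivFin.symm j) * G (s.equivFin.symm j) =
      ∑ v, t' v * G v := by
    intro G
    rw [s.equivFin.symm.sum_comp fun v : s => t' v * G v, sum_coe_sort s fun v => t' v * G v]
    exact sum_subset (subset_univ s) fun v _ hv => by
      have : t' v = 0 := by simpa [hs] using hv
      simp [this]
  rw [mem_rateRegion_productDist ch h₁ h₂] at hR
  have hmarg : ∀ x, ∑ j : Fin #s, t' (s.equivFin.symm j) * u (s.equivFin.symm j) x =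
      ∑ v, P₃ (v, x) := fun x => (hsum fun v => u v x).trans (heq1 x)
  -- The new weights are absorbed into the joint law of V and X3 on the remaining values of V.
  refine ⟨#s, hcard.trans (by simp [ZMod.card]), fun y => t' (s.equivFin.symm y.1) *
    u (s.equivFin.symm y.1) y.2, ⟨fun y => mul_nonneg (ht0 _) (h₃.1 _), ?_⟩, ?_⟩
  · rw [Fintype.sum_prod_type, sum_comm]
    simp only [hmarg]
    rw [sum_comm, ← Fintype.sum_prod_type, h₃.2]
  · rw [mem_rateRegion_productDist ch h₁ h₂]
    simp only [hmarg, bcInfo₁_smul, bcInfo₂_smul]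
    obtain ⟨hR0, hR1, hR2, hR3, hR4, hR5⟩ := hR
    refine ⟨hR0, hR1, hR2, hR3, ?_, ?_⟩
    · rw [hsum fun v => bcInfo₁ ch (u v)]
      exact hR4.trans hle1
    · rw [hsum fun v => bcInfo₂ ch N (u v), heq2]
      exact hR5

end Regions

end MADB

namespace MADB

open Finset Sample

theorem sum_shift {q : ℕ} [NeZero q] (f : ZMod q → ℝ) (a : ZMod q) : ∑ y, f (y - a) = ∑ y, f y :=
  (Equiv.subRight a).sum_comp f

theorem sum_prob_eq {q : ℕ} [NeZero q] {Y : Type*} [Fintype Y] (ch : Channel q Y)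
    (x₁ x₂ x₃ : ZMod q) :
    ∑ a : ZMod q × ZMod q × Y, ch.prob x₁ x₂ x₃ a.1 a.2.1 a.2.2 = 1 := by
  simp only [Channel.prob, Fintype.sum_prod_type, ← sum_mul, sum_trans, one_mul, ← mul_sum]
  have h2 : ∀ a, ∑ b, ch.noise₂ (b - x₂ - a + x₁) = 1 := by
    intro a
    rw [← sum_noise₂ ch, ← sum_shift ch.noise₂ (x₂ + a - x₁)]
    exact sum_congr rfl fun b _ => by congr 1; ring
  have h1 : ∑ a, ch.noise₁ (a - x₁ - x₃) = 1 := by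
    rw [← sum_noise₁ ch, ← sum_shift ch.noise₁ (x₁ + x₃)]
    exact sum_congr rfl fun b _ => by congr 1; ring
  simp only [h2, h1, mul_one]

/-! ### The path measure of a code -/

section BlockCode

variable {q : ℕ} [NeZero q] {Y : Type*} [Fintype Y] {n : ℕ} {R : Link → ℝ}

/-- The four messages as a tuple. -/
abbrev Msgs (n : ℕ) (R : Link → ℝ) : Type :=
  Msg n R .l13 × Msg n R .l23 × Msg n R .l31 × Msg n R .l32

/-- Tuples of messages and families of messages. -/
def msgsEquiv (n : ℕ) (R : Link → ℝ) : Msgs n R ≃ ((l : Link) → Msg n R l) where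
  toFun m l := match l with
    | .l13 => m.1
    | .l23 => m.2.1
    | .l31 => m.2.2.1
    | .l32 => m.2.2.2
  invFun m := (m .l13, m .l23, m .l31, m .l32)
  left_inv _ := rfl
  right_inv m := by funext l; cases l <;> rfl

/-- The messages and all channel outputs. -/
abbrev Outcome (q : ℕ) (Y : Type*) (n : ℕ) (R : Link → ℝ) : Type _ :=
  Msgs n R × (Fin n → ZMod q × ZMod q × Y)

/-- Triples of sequences and sequences of triples. -/
def outputsEquiv (A B C : Type*) (n : ℕ) :
    (Fin n → A) × (Fin n → B) × (Fin n → C) ≃ (Fin n → A × B × C) where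
  toFun y i := (y.1 i, y.2.1 i, y.2.2 i)
  invFun y := (fun i => (y i).1, fun i => (y i).2.1, fun i => (y i).2.2)
  left_inv _ := rfl
  right_inv _ := rfl

namespace Code

variable (c : Code q Y n R) (ch : Channel q Y)

/-- The input of user 1, given the past of the outputs. -/
def in₁ (m : Msgs n R) (i : Fin n) (h : Fin i.val → ZMod q × ZMod q × Y) : ZMod q :=
  c.f₁ i m.1 fun j => (h j).1

/-- The input of user 2, given the past of the outputs. -/
def in₂ (m : Msgs n R) (i : Fin n) (h : Fin i.val → ZMod q × ZMod q × Y) : ZMod q :=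
  c.f₂ i m.2.1 fun j => (h j).2.1

/-- The input of user 3, given the past of the outputs. -/
def in₃ (m : Msgs n R) (i : Fin n) (h : Fin i.val → ZMod q × ZMod q × Y) : ZMod q :=
  c.f₃ i m.2.2.1 m.2.2.2 fun j => (h j).2.2

/-- The conditional law of the outputs at time `i` given the past. -/
def kernel (m : Msgs n R) (i : Fin n) (h : Fin i.val → ZMod q × ZMod q × Y)
    (a : ZMod q × ZMod q × Y) : ℝ :=
  ch.prob (c.in₁ m i h) (c.in₂ m i h) (c.in₃ m i h) a.1 a.2.1 a.2.2

/-- The joint law of messages and outputs. -/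
noncomputable def outcomeDist (ω : Outcome q Y n R) : ℝ :=
  (Fintype.card (Msgs n R) : ℝ)⁻¹ * pathProb (c.kernel ch ω.1) ω.2

/-- Some message is decoded wrongly. -/
def Err (ω : Outcome q Y n R) : Prop :=
  c.IsError (msgsEquiv n R ω.1) (fun i => (ω.2 i).1) (fun i => (ω.2 i).2.1) fun i => (ω.2 i).2.2

theorem kernel_nonneg (m : Msgs n R) (i : Fin n) (h : Fin i.val → ZMod q × ZMod q × Y)
    (a : ZMod q × ZMod q × Y) : 0 ≤ c.kernel ch m i h a :=
  mul_nonneg (mul_nonneg ((ch.trans_mem _ _ _).1 _) (ch.noise₁_mem.1 _)) (ch.noise₂_mem.1 _)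

theorem sum_kernel (m : Msgs n R) (i : Fin n) (h : Fin i.val → ZMod q × ZMod q × Y) :
    ∑ a, c.kernel ch m i h a = 1 := sum_prob_eq ch _ _ _

theorem outcomeDist_nonneg (ω : Outcome q Y n R) : 0 ≤ c.outcomeDist ch ω :=
  mul_nonneg (by positivity) (pathProb_nonneg (c.kernel_nonneg ch ω.1) ω.2)

theorem outcomeDist_mem_stdSimplex (hN : ∀ l, 0 < numMsg n (R l)) :
    c.outcomeDist ch ∈ stdSimplex ℝ (Outcome q Y n R) := by
  refine ⟨c.outcomeDist_nonneg ch, ?_⟩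
  rw [Fintype.sum_prod_type]
  simp only [outcomeDist, ← mul_sum, sum_pathProb (c.sum_kernel ch _)]
  have : (Fintype.card (Msgs n R) : ℝ) ≠ 0 := by
    simp only [Fintype.card_prod, Fintype.card_fin]
    have h1 := hN .l13
    have h2 := hN .l23
    have h3 := hN .l31
    have h4 := hN .l32
    positivity
  rw [sum_const, card_univ, nsmul_eq_mul, mul_one, inv_mul_cancel₀ this]

open Classical in
theorem errorProb_eq : c.errorProb ch = ∑ ω, if c.Err ω then c.outcomeDist ch ω else 0 := by
  unfold errorProb
  rw [div_eq_inv_mul, Fintype.card_congr (msgsEquiv n R).symm, mul_sum, Fintype.sum_prod_type,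
    ← (msgsEquiv n R).sum_comp]
  refine sum_congr rfl fun m _ => ?_
  rw [← (outputsEquiv (ZMod q) (ZMod q) Y n).sum_comp]
  simp only [Fintype.sum_prod_type, mul_sum]
  refine sum_congr rfl fun y₁ _ => sum_congr rfl fun y₂ _ => sum_congr rfl fun y₃ _ => ?_
  rw [mul_ite, mul_zero]
  rfl

end Code

end BlockCode

end MADB

namespace MADB

open Finset Sample

/-! ### Single-letter variables at a random time, and the general guessing bound -/

section SingleLetter

variable {q : ℕ} [NeZero q] {Y : Type*} [Fintype Y] {n : ℕ} {R : Link → ℝ}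

/-- The values of the auxiliary variable: a time, the messages known to users 1 and 2 together with
the message meant for user 2, and the past outputs of users 1 and 2. -/
abbrev Aux (q n : ℕ) (R : Link → ℝ) : Type :=
  (i : Fin n) × (Msg n R .l13 × Msg n R .l23 × Msg n R .l32) × (Fin i.val → ZMod q × ZMod q)

/-- The number of values of the auxiliary variable. -/
noncomputable abbrev auxCard (q n : ℕ) [NeZero q] (R : Link → ℝ) : ℕ := Fintype.card (Aux q n R)

namespace Code

variable (c : Code q Y n R) (ch : Channel q Y)

/-- The auxiliary variable at time `i`. -/
def auxAt (m : Msgs n R) (i : Fin n) (h : Fin i.val → ZMod q × ZMod q × Y) : Aux q n R :=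
  ⟨i, (m.1, m.2.1, m.2.2.2), fun j => ((h j).1, (h j).2.1)⟩

/-- The inputs and the auxiliary variable at time `i`. -/
noncomputable def inputAt (m : Msgs n R) (i : Fin n) (h : Fin i.val → ZMod q × ZMod q × Y) :
    ZMod q × ZMod q × ZMod q × Fin (auxCard q n R) :=
  (c.in₁ m i h, c.in₂ m i h, c.in₃ m i h, Fintype.equivFin _ (auxAt m i h))

/-- All single-letter variables at time `i`. -/
noncomputable def sampleAt (m : Msgs n R) (i : Fin n) (h : Fin i.val → ZMod q × ZMod q × Y)
    (a : ZMod q × ZMod q × Y) : Sample q Y (auxCard q n R) :=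
  split q Y _ (c.inputAt m i h, a.2.2, a.1 - c.in₁ m i h - c.in₃ m i h,
    a.2.1 - c.in₂ m i h - a.1 + c.in₁ m i h)

/-- The joint law of an outcome and a uniformly chosen time. -/
noncomputable def timedDist (ω : Outcome q Y n R × Fin n) : ℝ :=
  (n : ℝ)⁻¹ * c.outcomeDist ch ω.1

/-- The single-letter variables at a given time. -/
noncomputable def letter (ω : Outcome q Y n R × Fin n) : Sample q Y (auxCard q n R) :=
  c.sampleAt ω.1.1 ω.2 (past ω.1.2 ω.2) (ω.1.2 ω.2)

/-- The law of the inputs and the auxiliary variable at a uniformly chosen time. -/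
noncomputable def inputDist : ZMod q × ZMod q × ZMod q × Fin (auxCard q n R) → ℝ :=
  law (c.timedDist ch) fun ω => c.inputAt ω.1.1 ω.2 (past ω.1.2 ω.2)

theorem timedDist_mem_stdSimplex (hn : 0 < n) (hN : ∀ l, 0 < numMsg n (R l)) :
    c.timedDist ch ∈ stdSimplex ℝ _ := by
  refine ⟨fun ω => mul_nonneg (by positivity) (c.outcomeDist_nonneg ch _), ?_⟩
  rw [Fintype.sum_prod_type, sum_comm]
  simp only [timedDist, ← mul_sum, (c.outcomeDist_mem_stdSimplex ch hN).2]
  have : (n : ℝ) ≠ 0 := by positivity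
  simp [this]

open Classical in
-- A history fixes the inputs, and for fixed inputs the map from outputs to (y₃, z₁, z₂) is a
-- bijection; exactly one output contributes.
theorem sum_kernel_sampleAt (m : Msgs n R) (i : Fin n) (h : Fin i.val → ZMod q × ZMod q × Y)
    (s : ZMod q × ZMod q × ZMod q × Fin (auxCard q n R)) (t : Y × ZMod q × ZMod q) :
    ∑ a, c.kernel ch m i h a * (if c.sampleAt m i h a = split q Y _ (s, t) then 1 else 0) =
      (if c.inputAt m i h = s then 1 else 0) *
        (ch.trans s.1 s.2.1 s.2.2.1 t.1 * ch.noise₁ t.2.1 * ch.noise₂ t.2.2) := by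
  obtain ⟨y, z₁, z₂⟩ := t
  by_cases hs : c.inputAt m i h = s
  · subst hs
    rw [Finset.sum_eq_single (z₁ + c.in₃ m i h + c.in₁ m i h,
      z₂ + z₁ + c.in₃ m i h + c.in₂ m i h, y)]
    · have : c.sampleAt m i h (z₁ + c.in₃ m i h + c.in₁ m i h,
          z₂ + z₁ + c.in₃ m i h + c.in₂ m i h, y) = split q Y _ (c.inputAt m i h, y, z₁, z₂) := by
        simp only [sampleAt, EmbeddingLike.apply_eq_iff_eq, Prod.mk.injEq, true_and]
        constructor <;> ring
      rw [if_pos this, if_pos rfl, mul_one, one_mul]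
      simp only [kernel, Channel.prob, inputAt]
      congr 2
      · congr 1; ring
      · ring
    · rintro ⟨a, b, y'⟩ _ hne
      rw [if_neg, mul_zero]
      intro heq
      simp only [sampleAt, EmbeddingLike.apply_eq_iff_eq, Prod.mk.injEq, true_and] at heq
      obtain ⟨h1, h2, h3⟩ := heq
      refine hne ?_
      rw [Prod.mk.injEq, Prod.mk.injEq]
      refine ⟨by rw [← h2]; ring, by rw [← h3, ← h2]; ring, h1⟩
    · simp
  · rw [if_neg hs, zero_mul]
    refine sum_eq_zero fun a _ => ?_
    rw [if_neg, mul_zero]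
    intro heq
    simp only [sampleAt, EmbeddingLike.apply_eq_iff_eq, Prod.mk.injEq] at heq
    exact hs heq.1

open Classical in
theorem law_timedDist {A : Type*} (f : Outcome q Y n R × Fin n → A) (a : A) :
    law (c.timedDist ch) f a = ∑ m, ∑ i, ((n : ℝ)⁻¹ * (Fintype.card (Msgs n R) : ℝ)⁻¹) *
      ∑ y, pathProb (c.kernel ch m) y * (if f ((m, y), i) = a then 1 else 0) := by
  unfold law
  rw [Fintype.sum_prod_type, Fintype.sum_prod_type]
  refine sum_congr rfl fun m _ => ?_
  rw [sum_comm]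
  refine sum_congr rfl fun i _ => ?_
  rw [mul_sum]
  refine sum_congr rfl fun y _ => ?_
  simp only [timedDist, outcomeDist]
  split_ifs <;> ring

/-- The single-letter variables at a uniformly chosen time obey the channel law. -/
theorem law_letter : law (c.timedDist ch) c.letter = jointDist ch (c.inputDist ch) := by
  classical
  funext s
  obtain ⟨⟨s, t⟩, rfl⟩ := (split q Y _).surjective s
  rw [jointDist_split]
  rw [inputDist, law_timedDist, law_timedDist, sum_mul]
  refine sum_congr rfl fun m _ => ?_
  rw [sum_mul]
  refine sum_congr rfl fun i _ => ?_
  refine (congrArg (fun x : ℝ => (n : ℝ)⁻¹ * (Fintype.card (Msgs n R) : ℝ)⁻¹ * x) ?_).trans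
    (mul_assoc _ _ _).symm
  -- The inputs and V depend on the past alone, so the output at time `i` may be averaged with the
  -- channel law.
  have := sum_pathProb_mul (c.sum_kernel ch m) i fun h a =>
    if c.sampleAt m i h a = split q Y _ (s, t) then 1 else 0
  rw [sum_mul]
  refine (Eq.trans (sum_congr rfl fun y _ => ?_) this).trans (sum_congr rfl fun y _ => ?_)
  · congr
  · rw [sum_kernel_sampleAt]
    refine (mul_assoc _ _ _).symm.trans ?_
    congr

theorem inputDist_mem_stdSimplex (hn : 0 < n) (hN : ∀ l, 0 < numMsg n (R l)) :
    c.inputDist ch ∈ stdSimplex ℝ _ :=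
  law_mem_stdSimplex (c.timedDist_mem_stdSimplex ch hn hN) _

open Classical in
/-- A guess of a part `MA` of the messages from the other data, which would be blind if each factor
of the likelihood were divided by `r`, bounds the size of `MA` by the expected logarithm of `r`. -/
theorem guess_bound (hn : 0 < n) (hN : ∀ l, 0 < numMsg n (R l)) {M : ℝ} (hM : 1 ≤ M)
    (r : Sample q Y (auxCard q n R) → ℝ) (hr : ∀ s, 0 < jointDist ch (c.inputDist ch) s → 0 < r s)
    (S : Outcome q Y n R → Prop) (hS : ∀ ω, ¬ c.Err ω → S ω)
    (h1 : ∑ ω, c.outcomeDist ch ω * (∏ i, r (c.letter (ω, i)))⁻¹ ≤ 1)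
    (h2 : ∑ ω, (if S ω then c.outcomeDist ch ω * (∏ i, r (c.letter (ω, i)))⁻¹ else 0) ≤ 1 / M) :
    (1 - c.errorProb ch) * Real.logb 2 M - 1 ≤
      n * ∑ s, jointDist ch (c.inputDist ch) s * Real.logb 2 (r s) := by
  have hp := c.outcomeDist_mem_stdSimplex ch hN
  have hn' : (n : ℝ) ≠ 0 := by positivity
  have hpos : ∀ ω i, 0 < c.outcomeDist ch ω → 0 < r (c.letter (ω, i)) := by
    intro ω i hω
    refine hr _ ?_
    rw [← law_letter]
    exact law_pos (fun ω => mul_nonneg (by positivity) (c.outcomeDist_nonneg ch _)) _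
      (mul_pos (by positivity) hω)
  have key := logb_le_of_guess (L := fun ω => ∏ i, r (c.letter (ω, i))) (S := S) hp
    (fun ω hω => prod_pos fun i _ => hpos ω i hω) (by linarith) h1 h2
  -- The logarithm of the product over time is `n` times an average over the uniform time, which is
  -- where the single-letter law enters.
  have e : ∑ ω, c.outcomeDist ch ω * Real.logb 2 (∏ i, r (c.letter (ω, i))) =
      n * ∑ s, jointDist ch (c.inputDist ch) s * Real.logb 2 (r s) := by
    rw [← law_letter, sum_law_mul]
    refine Eq.trans ?_ (congrArg _ (Fintype.sum_prod_type _).symm)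
    rw [mul_sum]
    refine sum_congr rfl fun ω _ => ?_
    rcases (c.outcomeDist_nonneg ch ω).eq_or_lt with h0 | h0
    · simp [timedDist, ← h0]
    rw [Real.logb_prod _ _ fun i _ => (hpos ω i h0).ne', mul_sum, mul_sum]
    refine sum_congr rfl fun i _ => ?_
    simp only [timedDist]
    field_simp
  rw [e] at key
  refine le_trans ?_ key
  have hlog : 0 ≤ Real.logb 2 M := Real.logb_nonneg (by norm_num) hM
  have herr : 1 - c.errorProb ch ≤ ∑ ω, if S ω then c.outcomeDist ch ω else 0 := by
    rw [errorProb_eq, ← hp.2, ← sum_sub_distrib]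
    refine sum_le_sum fun ω _ => ?_
    have := hp.1 ω
    have := hS ω
    by_cases hω : S ω
    · rw [if_pos hω]
      split_ifs <;> linarith
    · rw [if_neg hω, if_pos (not_not.1 fun h => hω (this h)), sub_self]
  nlinarith

end Code

end SingleLetter

end MADB

namespace MADB

open Finset Sample

/-- Dividing a likelihood by the conditional likelihood ratio. -/
theorem mul_inv_condRatio_le {Ω A B C : Type*} [Fintype Ω] {p : Ω → ℝ} (hp : ∀ ω, 0 ≤ p ω)
    (f : Ω → A) (g : Ω → B) (h : Ω → C) (ω : Ω) {t : ℝ}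
    (hfac : law p (fun ω => (f ω, g ω, h ω)) (f ω, g ω, h ω) =
      law p (fun ω => (f ω, h ω)) (f ω, h ω) * t) :
    t * (condRatio p f g h ω)⁻¹ ≤ law p (fun ω => (g ω, h ω)) (g ω, h ω) / law p h (h ω) := by
  unfold condRatio
  rw [hfac]
  have h1 := law_nonneg hp (fun ω => (f ω, h ω)) (f ω, h ω)
  have h2 := law_nonneg hp (fun ω => (g ω, h ω)) (g ω, h ω)
  have h3 := law_nonneg hp h (h ω)
  generalize law p (fun ω => (f ω, h ω)) (f ω, h ω) = a at *
  generalize law p (fun ω => (g ω, h ω)) (g ω, h ω) = b at *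
  generalize law p h (h ω) = d at *
  -- Equality holds in the generic case; in the degenerate ones the left side is 0.
  have hbd : 0 ≤ b / d := by positivity
  by_cases ha : a = 0
  · simpa [ha] using hbd
  by_cases ht0 : t = 0
  · simpa [ht0] using hbd
  by_cases hd : d = 0
  · simp [hd]
  refine le_of_eq ?_
  field_simp

theorem sum_law_div_le {Ω B C : Type*} [Fintype Ω] [Fintype B] (p : Ω → ℝ) (g : Ω → B)
    (h : Ω → C) (c : C) : ∑ b, law p (fun ω => (g ω, h ω)) (b, c) / law p h c ≤ 1 := by
  rw [← sum_div, sum_law_pair_left]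
  exact div_self_le_one _

/-! ### Converse bounds obtained by factorwise domination of the channel kernel -/

section Bounds

variable {q : ℕ} [NeZero q] {Y : Type*} [Fintype Y] {n : ℕ} {R : Link → ℝ}

namespace Code

variable (c : Code q Y n R) (ch : Channel q Y)

theorem kernel_eq (ω : Outcome q Y n R) (i : Fin n) :
    c.kernel ch ω.1 i (past ω.2 i) (ω.2 i) =
      ch.trans (c.letter (ω, i)).x₁ (c.letter (ω, i)).x₂ (c.letter (ω, i)).x₃
        (c.letter (ω, i)).y₃ * ch.noise₁ (c.letter (ω, i)).z₁ * ch.noise₂ (c.letter (ω, i)).z₂ :=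
  rfl

/-- `MA` is the message to be guessed, `MB` the other messages, `B` the outputs shown to the decoder
and `C` the outputs to be summed out. Once `r` is divided out and `C` is summed out, the kernel of
`B` is bounded by `K`, which does not involve `MA`; then the guess is blind. -/
theorem guess_bound_of_kernel (hn : 0 < n) (hN : ∀ l, 0 < numMsg n (R l))
    (r : Sample q Y (auxCard q n R) → ℝ) (hr0 : ∀ s, 0 ≤ r s)
    (hr : ∀ s, 0 < jointDist ch (c.inputDist ch) s → 0 < r s)
    {MA MB B C : Type*} [Fintype MA] [Fintype MB] [Fintype B] [Fintype C]
    (e : MA × MB × (Fin n → B) × (Fin n → C) ≃ Outcome q Y n R)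
    (hcard : Fintype.card (Msgs n R) = Fintype.card MA * Fintype.card MB)
    (k : MA → MB → (i : Fin n) → (Fin i.val → B) → (Fin i.val → C) → B → C → ℝ)
    (K : MB → (i : Fin n) → (Fin i.val → B) → B → ℝ)
    (hk0 : ∀ ma mb i hb hc b c, 0 ≤ k ma mb i hb hc b c)
    (hK0 : ∀ mb i hb b, 0 ≤ K mb i hb b)
    (hk : ∀ ma mb i hb hc b, ∑ c, k ma mb i hb hc b c ≤ K mb i hb b)
    (hK : ∀ mb i hb, ∑ b, K mb i hb b ≤ 1)
    (hkr : ∀ ma mb b d i, c.kernel ch (e (ma, mb, b, d)).1 i (past (e (ma, mb, b, d)).2 i)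
      ((e (ma, mb, b, d)).2 i) * (r (c.letter (e (ma, mb, b, d), i)))⁻¹ ≤
        k ma mb i (past b i) (past d i) (b i) (d i))
    (dec : MB → (Fin n → B) → MA)
    (hdec : ∀ ma mb b d, ¬ c.Err (e (ma, mb, b, d)) → dec mb b = ma) :
    (1 - c.errorProb ch) * Real.logb 2 (Fintype.card MA) - 1 ≤
      n * ∑ s, jointDist ch (c.inputDist ch) s * Real.logb 2 (r s) := by
  classical
  have hpos : 0 < Fintype.card MA * Fintype.card MB := by
    rw [← hcard]
    simp only [Fintype.card_prod, Fintype.card_fin]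
    have h1 := hN .l13
    have h2 := hN .l23
    have h3 := hN .l31
    have h4 := hN .l32
    positivity
  have hA : (0 : ℝ) < Fintype.card MA := by exact_mod_cast Nat.pos_of_mul_pos_right hpos
  have hB : (0 : ℝ) < Fintype.card MB := by exact_mod_cast Nat.pos_of_mul_pos_left hpos
  -- Weight 1 with `W` equal to the number of messages bounds the total mass by 1; the indicator of
  -- a correct guess with `W = 1` bounds the mass of success by the inverse of that number.
  have main : ∀ w : MA → MB → (Fin n → B) → ℝ, (∀ ma mb b, 0 ≤ w ma mb b) → ∀ W : ℝ, 0 ≤ W →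
      (∀ mb b, ∑ ma, w ma mb b ≤ W) →
      ∑ ω, w (e.symm ω).1 (e.symm ω).2.1 (e.symm ω).2.2.1 *
        (c.outcomeDist ch ω * (∏ i, r (c.letter (ω, i)))⁻¹) ≤ W / Fintype.card MA := by
    intro w hw W hW0 hW
    rw [← e.sum_comp]
    simp only [Equiv.symm_apply_apply]
    calc _ ≤ ∑ x : MA × MB × (Fin n → B) × (Fin n → C), (Fintype.card (Msgs n R) : ℝ)⁻¹ *
          (w x.1 x.2.1 x.2.2.1 * ∏ i, k x.1 x.2.1 i (past x.2.2.1 i) (past x.2.2.2 i)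
            (x.2.2.1 i) (x.2.2.2 i)) := by
          refine sum_le_sum ?_
          rintro ⟨ma, mb, b, d⟩ _
          rw [outcomeDist, pathProb, mul_assoc, ← prod_inv_distrib, ← prod_mul_distrib,
            mul_left_comm]
          refine mul_le_mul_of_nonneg_left (mul_le_mul_of_nonneg_left ?_ (hw _ _ _)) (by positivity)
          exact prod_le_prod (fun i _ => mul_nonneg (c.kernel_nonneg ch _ _ _ _)
            (inv_nonneg.2 (hr0 _))) fun i _ => hkr ma mb b d i
      _ ≤ (Fintype.card (Msgs n R) : ℝ)⁻¹ * (W * Fintype.card MB) := by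
          rw [← mul_sum]
          refine mul_le_mul_of_nonneg_left ?_ (by positivity)
          simp only [Fintype.sum_prod_type]
          exact sum_guess_le k K hk0 hK0 hk hK w hw W hW hW0
      _ = W / Fintype.card MA := by
          rw [hcard]
          push_cast
          field_simp
  refine c.guess_bound ch hn hN (M := Fintype.card MA)
    (by exact_mod_cast Nat.pos_of_mul_pos_right hpos) r hr
    (fun ω => dec (e.symm ω).2.1 (e.symm ω).2.2.1 = (e.symm ω).1) (fun ω hω => ?_) ?_ ?_
  · refine hdec (e.symm ω).1 _ _ (e.symm ω).2.2.2 ?_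
    simpa using hω
  · have := main (fun _ _ _ => 1) (fun _ _ _ => zero_le_one) (Fintype.card MA) hA.le (by simp)
    simpa [hA.ne'] using this
  · have := main (fun ma mb b => if dec mb b = ma then 1 else 0)
      (fun _ _ _ => by split_ifs <;> simp) 1 zero_le_one (by simp)
    simpa using this

/-- `I(X₁; Y₃ | X₂, X₃)` bounds the rate from user 1 to user 3. -/
theorem bound_13 (hn : 0 < n) (hN : ∀ l, 0 < numMsg n (R l)) :
    (1 - c.errorProb ch) * Real.logb 2 (numMsg n (R .l13)) - 1 ≤
      n * condMutualInfo (jointDist ch (c.inputDist ch)) x₁ y₃ x₂₃ := by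
  set J := jointDist ch (c.inputDist ch) with hJ
  have hJ0 : ∀ s, 0 ≤ J s :=
    (jointDist_mem_stdSimplex ch (c.inputDist_mem_stdSimplex ch hn hN)).1
  let W : Y → ZMod q × ZMod q → ℝ := fun y x => law J (fun s => (s.y₃, s.x₂₃)) (y, x) / law J x₂₃ x
  have hW0 : ∀ y x, 0 ≤ W y x := fun y x => div_nonneg (law_nonneg hJ0 _ _) (law_nonneg hJ0 _ _)
  have hW : ∀ x, ∑ y, W y x ≤ 1 := fun x => sum_law_div_le J y₃ x₂₃ x
  -- The law of Z1 + Z2, which is all that remains visible of the noise when Y1 is summed out.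
  let D : ZMod q → ℝ := fun u => ∑ z, ch.noise₁ z * ch.noise₂ (u - z)
  have hD0 : ∀ u, 0 ≤ D u := fun u =>
    sum_nonneg fun z _ => mul_nonneg (ch.noise₁_mem.1 _) (ch.noise₂_mem.1 _)
  have hD : ∑ u, D u = 1 := by
    rw [sum_comm]
    simp only [← mul_sum, sum_shift, sum_noise₁, sum_noise₂, mul_one]
  have hdens : ∀ s : Sample q Y (auxCard q n R),
      ch.trans s.x₁ s.x₂ s.x₃ s.y₃ * (condRatio J x₁ y₃ x₂₃ s)⁻¹ ≤ W s.y₃ s.x₂₃ := by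
    intro s
    refine mul_inv_condRatio_le hJ0 x₁ y₃ x₂₃ s ?_
    have h1 := law_jointDist_y₃ ch (c.inputDist ch) s.x₁ s.x₂ s.x₃ s.y₃
    rw [← hJ, ← law_comp_injective J (fun s => ((s.x₁, s.x₂, s.x₃), s.y₃))
      (e := fun x => (x.1.1, x.2, x.1.2)) (fun x y => by simp only [Prod.ext_iff]; tauto)] at h1
    exact h1
  rw [condMutualInfo_eq_sum, ← Fintype.card_fin (numMsg n (R .l13))]
  -- A genie shows the decoder M23 and Y2 besides M31, M32 and Y3, so X2 and X3 are known. Y1 is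
  -- summed out, and with it all dependence on the encoder of user 1.
  let e : Msg n R .l13 × (Msg n R .l23 × Msg n R .l31 × Msg n R .l32) ×
      (Fin n → ZMod q × Y) × (Fin n → ZMod q) ≃ Outcome q Y n R :=
    { toFun := fun x => ((x.1, x.2.1.1, x.2.1.2.1, x.2.1.2.2),
        fun i => (x.2.2.2 i, (x.2.2.1 i).1, (x.2.2.1 i).2))
      invFun := fun ω => (ω.1.1, (ω.1.2.1, ω.1.2.2.1, ω.1.2.2.2),
        fun i => ((ω.2 i).2.1, (ω.2 i).2.2), fun i => (ω.2 i).1)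
      left_inv := fun _ => rfl
      right_inv := fun _ => rfl }
  refine c.guess_bound_of_kernel ch hn hN (condRatio J x₁ y₃ x₂₃)
    (fun s => div_nonneg (mul_nonneg (law_nonneg hJ0 _ _) (law_nonneg hJ0 _ _))
      (mul_nonneg (law_nonneg hJ0 _ _) (law_nonneg hJ0 _ _)))
    (fun s hs => condRatio_pos hJ0 _ _ _ hs) e (by simp [Fintype.card_prod])
    (fun m₁ m i hb hd b d =>
      W b.2 (c.f₂ i m.1 (fun j => (hb j).1), c.f₃ i m.2.1 m.2.2 fun j => (hb j).2) *
        ch.noise₁ (d - c.f₁ i m₁ hd - c.f₃ i m.2.1 m.2.2 fun j => (hb j).2) *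
        ch.noise₂ (b.1 - c.f₂ i m.1 (fun j => (hb j).1) - d + c.f₁ i m₁ hd))
    (fun m i hb b =>
      W b.2 (c.f₂ i m.1 (fun j => (hb j).1), c.f₃ i m.2.1 m.2.2 fun j => (hb j).2) *
        D (b.1 - (c.f₂ i m.1 (fun j => (hb j).1) + c.f₃ i m.2.1 m.2.2 fun j => (hb j).2)))
    (fun m₁ m i hb hd b d =>
      mul_nonneg (mul_nonneg (hW0 _ _) (ch.noise₁_mem.1 _)) (ch.noise₂_mem.1 _))
    (fun m i hb b => mul_nonneg (hW0 _ _) (hD0 _)) ?_ ?_ ?_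
    (fun m b => (c.g₃ m.2.1 m.2.2 fun i => (b i).2).1) ?_
  · intro m₁ m i hb hd b
    refine le_of_eq ?_
    simp only [mul_assoc, ← mul_sum, D]
    congr 1
    rw [← sum_shift (fun z => ch.noise₁ z * _)
      (c.f₁ i m₁ hd + c.f₃ i m.2.1 m.2.2 fun j => (hb j).2)]
    refine sum_congr rfl fun d _ => ?_
    congr 2 <;> ring
  · intro m i hb
    rw [Fintype.sum_prod_type, sum_comm]
    simp only [← mul_sum]
    simp only [sum_shift, hD, mul_one]
    exact hW _
  · intro m₁ m b d i
    have := mul_le_mul_of_nonneg_right (hdens (c.letter (e (m₁, m, b, d), i)))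
      (mul_nonneg (ch.noise₁_mem.1 (c.letter (e (m₁, m, b, d), i)).z₁)
        (ch.noise₂_mem.1 (c.letter (e (m₁, m, b, d), i)).z₂))
    refine le_trans (le_of_eq ?_) (this.trans (le_of_eq ?_))
    · rw [kernel_eq]
      ring
    · rw [← mul_assoc]
      rfl
  · intro m₁ m b d h
    have := (not_or.1 h).1
    exact not_not.1 this

/-- `I(X₂; Y₃ | X₁, X₃)` bounds the rate from user 2 to user 3. -/
theorem bound_23 (hn : 0 < n) (hN : ∀ l, 0 < numMsg n (R l)) :
    (1 - c.errorProb ch) * Real.logb 2 (numMsg n (R .l23)) - 1 ≤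
      n * condMutualInfo (jointDist ch (c.inputDist ch)) x₂ y₃ x₁₃ := by
  set J := jointDist ch (c.inputDist ch) with hJ
  have hJ0 : ∀ s, 0 ≤ J s :=
    (jointDist_mem_stdSimplex ch (c.inputDist_mem_stdSimplex ch hn hN)).1
  let W : Y → ZMod q × ZMod q → ℝ := fun y x => law J (fun s => (s.y₃, s.x₁₃)) (y, x) / law J x₁₃ x
  have hW0 : ∀ y x, 0 ≤ W y x := fun y x => div_nonneg (law_nonneg hJ0 _ _) (law_nonneg hJ0 _ _)
  have hW : ∀ x, ∑ y, W y x ≤ 1 := fun x => sum_law_div_le J y₃ x₁₃ x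
  have hdens : ∀ s : Sample q Y (auxCard q n R),
      ch.trans s.x₁ s.x₂ s.x₃ s.y₃ * (condRatio J x₂ y₃ x₁₃ s)⁻¹ ≤ W s.y₃ s.x₁₃ := by
    intro s
    refine mul_inv_condRatio_le hJ0 x₂ y₃ x₁₃ s ?_
    have h1 := law_jointDist_y₃ ch (c.inputDist ch) s.x₁ s.x₂ s.x₃ s.y₃
    rw [← hJ, ← law_comp_injective J (fun s => ((s.x₁, s.x₂, s.x₃), s.y₃))
      (e := fun x => (x.1.2.1, x.2, x.1.1, x.1.2.2))
      (fun x y => by simp only [Prod.ext_iff]; tauto),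
      ← law_comp_injective J (fun s => (s.x₁, s.x₂, s.x₃))
      (e := fun x => (x.2.1, x.1, x.2.2))
      (fun x y => by simp only [Prod.ext_iff]; tauto)] at h1
    exact h1
  rw [condMutualInfo_eq_sum, ← Fintype.card_fin (numMsg n (R .l23))]
  -- Here the genie shows M13 and Y1, and Y2 is summed out. The kernel of Y2 given the rest is a
  -- shift of the law of Z2, so it sums to 1 whatever X2 is.
  let e : Msg n R .l23 × (Msg n R .l13 × Msg n R .l31 × Msg n R .l32) ×
      (Fin n → ZMod q × Y) × (Fin n → ZMod q) ≃ Outcome q Y n R :=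
    { toFun := fun x => ((x.2.1.1, x.1, x.2.1.2.1, x.2.1.2.2),
        fun i => ((x.2.2.1 i).1, x.2.2.2 i, (x.2.2.1 i).2))
      invFun := fun ω => (ω.1.2.1, (ω.1.1, ω.1.2.2.1, ω.1.2.2.2),
        fun i => ((ω.2 i).1, (ω.2 i).2.2), fun i => (ω.2 i).2.1)
      left_inv := fun _ => rfl
      right_inv := fun _ => rfl }
  refine c.guess_bound_of_kernel ch hn hN (condRatio J x₂ y₃ x₁₃)
    (fun s => div_nonneg (mul_nonneg (law_nonneg hJ0 _ _) (law_nonneg hJ0 _ _))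
      (mul_nonneg (law_nonneg hJ0 _ _) (law_nonneg hJ0 _ _)))
    (fun s hs => condRatio_pos hJ0 _ _ _ hs) e
    (by simp only [Fintype.card_prod]; ring)
    (fun m₂ m i hb hd b d =>
      W b.2 (c.f₁ i m.1 (fun j => (hb j).1), c.f₃ i m.2.1 m.2.2 fun j => (hb j).2) *
        ch.noise₁ (b.1 - c.f₁ i m.1 (fun j => (hb j).1) - c.f₃ i m.2.1 m.2.2 fun j => (hb j).2) *
        ch.noise₂ (d - c.f₂ i m₂ hd - b.1 + c.f₁ i m.1 fun j => (hb j).1))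
    (fun m i hb b =>
      W b.2 (c.f₁ i m.1 (fun j => (hb j).1), c.f₃ i m.2.1 m.2.2 fun j => (hb j).2) *
        ch.noise₁ (b.1 - (c.f₁ i m.1 (fun j => (hb j).1) + c.f₃ i m.2.1 m.2.2 fun j => (hb j).2)))
    (fun m₂ m i hb hd b d =>
      mul_nonneg (mul_nonneg (hW0 _ _) (ch.noise₁_mem.1 _)) (ch.noise₂_mem.1 _))
    (fun m i hb b => mul_nonneg (hW0 _ _) (ch.noise₁_mem.1 _)) ?_ ?_ ?_
    (fun m b => (c.g₃ m.2.1 m.2.2 fun i => (b i).2).2) ?_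
  · intro m₂ m i hb hd b
    refine le_of_eq ?_
    rw [← mul_sum, ← sub_sub]
    refine mul_right_eq_self₀.2 (Or.inl ?_)
    rw [← sum_noise₂ ch, ← sum_shift ch.noise₂
      (c.f₂ i m₂ hd + b.1 - c.f₁ i m.1 fun j => (hb j).1)]
    refine sum_congr rfl fun d _ => ?_
    congr 1
    ring
  · intro m i hb
    rw [Fintype.sum_prod_type, sum_comm]
    simp only [← mul_sum]
    simp only [sum_shift, sum_noise₁, mul_one]
    exact hW _
  · intro m₂ m b d i
    have := mul_le_mul_of_nonneg_right (hdens (c.letter (e (m₂, m, b, d), i)))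
      (mul_nonneg (ch.noise₁_mem.1 (c.letter (e (m₂, m, b, d), i)).z₁)
        (ch.noise₂_mem.1 (c.letter (e (m₂, m, b, d), i)).z₂))
    refine le_trans (le_of_eq ?_) (this.trans (le_of_eq ?_))
    · rw [kernel_eq]
      ring
    · rw [← mul_assoc]
      rfl
  · intro m₂ m b d h
    have := (not_or.1 (not_or.1 h).2).1
    exact not_not.1 this

/-- `I(X₁, X₂; Y₃ | X₃)` bounds the sum of the rates to user 3. -/
theorem bound_sum (hn : 0 < n) (hN : ∀ l, 0 < numMsg n (R l)) :
    (1 - c.errorProb ch) *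
      (Real.logb 2 (numMsg n (R .l13)) + Real.logb 2 (numMsg n (R .l23))) - 1 ≤
      n * condMutualInfo (jointDist ch (c.inputDist ch)) x₁₂ y₃ x₃ := by
  set J := jointDist ch (c.inputDist ch) with hJ
  have hJ0 : ∀ s, 0 ≤ J s :=
    (jointDist_mem_stdSimplex ch (c.inputDist_mem_stdSimplex ch hn hN)).1
  let W : Y → ZMod q → ℝ := fun y x => law J (fun s => (s.y₃, s.x₃)) (y, x) / law J x₃ x
  have hW0 : ∀ y x, 0 ≤ W y x := fun y x => div_nonneg (law_nonneg hJ0 _ _) (law_nonneg hJ0 _ _)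
  have hW : ∀ x, ∑ y, W y x ≤ 1 := fun x => sum_law_div_le J y₃ x₃ x
  have hdens : ∀ s : Sample q Y (auxCard q n R),
      ch.trans s.x₁ s.x₂ s.x₃ s.y₃ * (condRatio J x₁₂ y₃ x₃ s)⁻¹ ≤ W s.y₃ s.x₃ := by
    intro s
    refine mul_inv_condRatio_le hJ0 x₁₂ y₃ x₃ s ?_
    have h1 := law_jointDist_y₃ ch (c.inputDist ch) s.x₁ s.x₂ s.x₃ s.y₃
    rw [← hJ, ← law_comp_injective J (fun s => ((s.x₁, s.x₂, s.x₃), s.y₃))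
      (e := fun x => ((x.1.1, x.1.2.1), x.2, x.1.2.2))
      (fun x y => by simp only [Prod.ext_iff]; tauto),
      ← law_comp_injective J (fun s => (s.x₁, s.x₂, s.x₃))
      (e := fun x => ((x.1, x.2.1), x.2.2))
      (fun x y => by simp only [Prod.ext_iff]; tauto)] at h1
    exact h1
  have h13 := hN .l13
  have h23 := hN .l23
  rw [condMutualInfo_eq_sum, ← Real.logb_mul (by positivity) (by positivity), ← Nat.cast_mul,
    ← Fintype.card_fin (numMsg n (R .l13)), ← Fintype.card_fin (numMsg n (R .l23)),
    ← Fintype.card_prod]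
  -- Both messages to user 3 are guessed from Y3, M31 and M32; Y1 and Y2 are summed out.
  let e : (Msg n R .l13 × Msg n R .l23) × (Msg n R .l31 × Msg n R .l32) ×
      (Fin n → Y) × (Fin n → ZMod q × ZMod q) ≃ Outcome q Y n R :=
    { toFun := fun x => ((x.1.1, x.1.2, x.2.1.1, x.2.1.2),
        fun i => ((x.2.2.2 i).1, (x.2.2.2 i).2, x.2.2.1 i))
      invFun := fun ω => ((ω.1.1, ω.1.2.1), (ω.1.2.2.1, ω.1.2.2.2),
        fun i => (ω.2 i).2.2, fun i => ((ω.2 i).1, (ω.2 i).2.1))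
      left_inv := fun _ => rfl
      right_inv := fun _ => rfl }
  refine c.guess_bound_of_kernel ch hn hN (condRatio J x₁₂ y₃ x₃)
    (fun s => div_nonneg (mul_nonneg (law_nonneg hJ0 _ _) (law_nonneg hJ0 _ _))
      (mul_nonneg (law_nonneg hJ0 _ _) (law_nonneg hJ0 _ _)))
    (fun s hs => condRatio_pos hJ0 _ _ _ hs) e
    (by simp only [Fintype.card_prod]; ring)
    (fun m₁₂ m i hb hd b d => W b (c.f₃ i m.1 m.2 hb) *
        (ch.noise₁ (d.1 - c.f₁ i m₁₂.1 (fun j => (hd j).1) - c.f₃ i m.1 m.2 hb) *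
        ch.noise₂ (d.2 - c.f₂ i m₁₂.2 (fun j => (hd j).2) - d.1 +
          c.f₁ i m₁₂.1 (fun j => (hd j).1))))
    (fun m i hb b => W b (c.f₃ i m.1 m.2 hb))
    (fun m₁₂ m i hb hd b d =>
      mul_nonneg (hW0 _ _) (mul_nonneg (ch.noise₁_mem.1 _) (ch.noise₂_mem.1 _)))
    (fun m i hb b => hW0 _ _) ?_ (fun m i hb => hW _) ?_
    (fun m b => c.g₃ m.1 m.2 b) ?_
  · intro m₁₂ m i hb hd b
    refine le_of_eq ?_
    rw [← mul_sum]
    refine mul_right_eq_self₀.2 (Or.inl ?_)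
    rw [Fintype.sum_prod_type]
    simp only [← mul_sum]
    have h2 : ∀ a, ∑ d, ch.noise₂ (d - c.f₂ i m₁₂.2 (fun j => (hd j).2) - a +
        c.f₁ i m₁₂.1 (fun j => (hd j).1)) = 1 := by
      intro a
      rw [← sum_noise₂ ch, ← sum_shift ch.noise₂
        (c.f₂ i m₁₂.2 (fun j => (hd j).2) + a - c.f₁ i m₁₂.1 (fun j => (hd j).1))]
      refine sum_congr rfl fun d _ => ?_
      congr 1
      ring
    simp only [h2, mul_one]
    simp only [sub_sub, sum_shift, sum_noise₁]
  · intro m₁₂ m b d i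
    have := mul_le_mul_of_nonneg_right (hdens (c.letter (e (m₁₂, m, b, d), i)))
      (mul_nonneg (ch.noise₁_mem.1 (c.letter (e (m₁₂, m, b, d), i)).z₁)
        (ch.noise₂_mem.1 (c.letter (e (m₁₂, m, b, d), i)).z₂))
    refine le_trans (le_of_eq ?_) this
    rw [kernel_eq]
    ring
  · intro m₁₂ m b d h
    exact Prod.ext (not_not.1 (not_or.1 h).1) (not_not.1 (not_or.1 (not_or.1 h).2).1)

/-- `I(X₃; X₃ + Z₁ | V)` bounds the rate from user 3 to user 1. -/
theorem bound_31 (hn : 0 < n) (hN : ∀ l, 0 < numMsg n (R l)) :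
    (1 - c.errorProb ch) * Real.logb 2 (numMsg n (R .l31)) - 1 ≤
      n * condMutualInfo (jointDist ch (c.inputDist ch)) x₃ w₁ v := by
  set J := jointDist ch (c.inputDist ch) with hJ
  have hJ0 : ∀ s, 0 ≤ J s :=
    (jointDist_mem_stdSimplex ch (c.inputDist_mem_stdSimplex ch hn hN)).1
  let W : ZMod q → Fin (auxCard q n R) → ℝ :=
    fun y x => law J (fun s => (s.w₁, s.v)) (y, x) / law J v x
  have hW0 : ∀ y x, 0 ≤ W y x := fun y x => div_nonneg (law_nonneg hJ0 _ _) (law_nonneg hJ0 _ _)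
  have hW : ∀ x, ∑ y, W y x ≤ 1 := fun x => sum_law_div_le J w₁ v x
  have hdens : ∀ s : Sample q Y (auxCard q n R),
      ch.noise₁ s.z₁ * (condRatio J x₃ w₁ v s)⁻¹ ≤ W s.w₁ s.v := by
    intro s
    refine mul_inv_condRatio_le hJ0 x₃ w₁ v s ?_
    have h1 := law_jointDist_w₁ ch (c.inputDist ch) s.x₃ s.v s.w₁
    rw [← hJ, ← law_comp_injective J (fun s => ((s.x₃, s.v), s.w₁))
      (e := fun x => (x.1.1, x.2, x.1.2)) (fun x y => by simp only [Prod.ext_iff]; tauto),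
      w₁, add_sub_cancel_left] at h1
    exact h1
  rw [condMutualInfo_eq_sum, ← Fintype.card_fin (numMsg n (R .l31))]
  -- User 1 is shown everything in V, namely M13, M23, M32 and the past of Y1 and Y2. Y3 is summed
  -- out; it was the only other way in which M31 could act, through the feedback to user 3.
  let e : Msg n R .l31 × (Msg n R .l13 × Msg n R .l23 × Msg n R .l32) ×
      (Fin n → ZMod q × ZMod q) × (Fin n → Y) ≃ Outcome q Y n R :=
    { toFun := fun x => ((x.2.1.1, x.2.1.2.1, x.1, x.2.1.2.2),
        fun i => ((x.2.2.1 i).1, (x.2.2.1 i).2, x.2.2.2 i))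
      invFun := fun ω => (ω.1.2.2.1, (ω.1.1, ω.1.2.1, ω.1.2.2.2),
        fun i => ((ω.2 i).1, (ω.2 i).2.1), fun i => (ω.2 i).2.2)
      left_inv := fun _ => rfl
      right_inv := fun _ => rfl }
  refine c.guess_bound_of_kernel ch hn hN (condRatio J x₃ w₁ v)
    (fun s => div_nonneg (mul_nonneg (law_nonneg hJ0 _ _) (law_nonneg hJ0 _ _))
      (mul_nonneg (law_nonneg hJ0 _ _) (law_nonneg hJ0 _ _)))
    (fun s hs => condRatio_pos hJ0 _ _ _ hs) e
    (by simp only [Fintype.card_prod]; ring)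
    (fun m₃ m i hb hd b d => W (b.1 - c.f₁ i m.1 fun j => (hb j).1)
        (Fintype.equivFin (Aux q n R) ⟨i, m, hb⟩) *
      ch.noise₂ (b.2 - c.f₂ i m.2.1 (fun j => (hb j).2) - b.1 + c.f₁ i m.1 fun j => (hb j).1) *
      ch.trans (c.f₁ i m.1 fun j => (hb j).1) (c.f₂ i m.2.1 (fun j => (hb j).2))
        (c.f₃ i m₃ m.2.2 hd) d)
    (fun m i hb b => W (b.1 - c.f₁ i m.1 fun j => (hb j).1)
        (Fintype.equivFin (Aux q n R) ⟨i, m, hb⟩) *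
      ch.noise₂ (b.2 - c.f₂ i m.2.1 (fun j => (hb j).2) - b.1 + c.f₁ i m.1 fun j => (hb j).1))
    (fun m₃ m i hb hd b d =>
      mul_nonneg (mul_nonneg (hW0 _ _) (ch.noise₂_mem.1 _)) ((ch.trans_mem _ _ _).1 _))
    (fun m i hb b => mul_nonneg (hW0 _ _) (ch.noise₂_mem.1 _)) ?_ ?_ ?_
    (fun m b => c.g₁ m.1 fun i => (b i).1) ?_
  · intro m₃ m i hb hd b
    rw [← mul_sum, sum_trans, mul_one]
  · intro m i hb
    rw [Fintype.sum_prod_type]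
    simp only [← mul_sum]
    have h2 : ∀ a, ∑ d, ch.noise₂ (d - c.f₂ i m.2.1 (fun j => (hb j).2) - a +
        c.f₁ i m.1 (fun j => (hb j).1)) = 1 := by
      intro a
      rw [← sum_noise₂ ch, ← sum_shift ch.noise₂
        (c.f₂ i m.2.1 (fun j => (hb j).2) + a - c.f₁ i m.1 (fun j => (hb j).1))]
      refine sum_congr rfl fun d _ => ?_
      congr 1
      ring
    simp only [h2, mul_one]
    rw [sum_shift fun a => W a _]
    exact hW _
  · intro m₃ m b d i
    set s := c.letter (e (m₃, m, b, d), i) with hs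
    have := mul_le_mul_of_nonneg_right (hdens s)
      (mul_nonneg (ch.noise₂_mem.1 s.z₂) ((ch.trans_mem s.x₁ s.x₂ s.x₃).1 s.y₃))
    refine le_trans (le_of_eq ?_) (this.trans (le_of_eq ?_))
    · rw [kernel_eq]
      ring
    · rw [← mul_assoc]
      -- X3 cancels from X3 + Z1, so the remaining factor does not depend on M31.
      have hw : s.w₁ = (b i).1 - c.f₁ i m.1 fun j => (past b i j).1 := by
        change c.f₃ i m₃ m.2.2 (past d i) + ((b i).1 - (c.f₁ i m.1 fun j => (past b i j).1) -
          c.f₃ i m₃ m.2.2 (past d i)) = _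
        ring
      rw [hw]
      rfl
  · intro m₃ m b d h
    exact not_not.1 (not_or.1 (not_or.1 (not_or.1 h).2).2).1

end Code

end Bounds

end MADB

namespace MADB

open Finset Sample

/-! ### The converse bound for the degraded receiver -/

section DegradedBound

variable {q : ℕ} [NeZero q] {Y : Type*} [Fintype Y] {n : ℕ} {R : Link → ℝ}

/-- An outcome, split into what is known to users 1 and 2 or meant for user 2, and the rest. -/
def outcomeEquiv (q : ℕ) (Y : Type*) (n : ℕ) (R : Link → ℝ) :
    ((Msg n R .l13 × Msg n R .l23 × Msg n R .l32) × (Fin n → ZMod q × ZMod q)) ×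
      (Msg n R .l31 × (Fin n → Y)) ≃ Outcome q Y n R where
  toFun x := ((x.1.1.1, x.1.1.2.1, x.2.1, x.1.1.2.2),
    fun i => ((x.1.2 i).1, (x.1.2 i).2, x.2.2 i))
  invFun ω := (((ω.1.1, ω.1.2.1, ω.1.2.2.2), fun i => ((ω.2 i).1, (ω.2 i).2.1)),
    (ω.1.2.2.1, fun i => (ω.2 i).2.2))
  left_inv _ := rfl
  right_inv _ := rfl

namespace Code

variable (c : Code q Y n R) (ch : Channel q Y)

/-- The joint law of the messages known to users 1 and 2 or meant for user 2, and the outputs of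
users 1 and 2. -/
noncomputable def margDist (s : Msg n R .l13 × Msg n R .l23 × Msg n R .l32)
    (b : Fin n → ZMod q × ZMod q) : ℝ :=
  ∑ t, c.outcomeDist ch (outcomeEquiv q Y n R ((s, b), t))

theorem margDist_nonneg (s : Msg n R .l13 × Msg n R .l23 × Msg n R .l32)
    (b : Fin n → ZMod q × ZMod q) : 0 ≤ c.margDist ch s b :=
  sum_nonneg fun _ _ => c.outcomeDist_nonneg ch _

theorem sum_margDist (hN : ∀ l, 0 < numMsg n (R l))
    (s : Msg n R .l13 × Msg n R .l23 × Msg n R .l32) : ∑ b, c.margDist ch s b =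
      (Fintype.card (Msg n R .l13 × Msg n R .l23 × Msg n R .l32) : ℝ)⁻¹ := by
  have h : ∀ m : Msgs n R, ∑ b : Fin n → ZMod q × ZMod q, ∑ y : Fin n → Y,
      pathProb (c.kernel ch m) (fun i => ((b i).1, (b i).2, y i)) = 1 := by
    intro m
    rw [← sum_pathProb (c.sum_kernel ch m), ← Fintype.sum_prod_type']
    exact Equiv.sum_comp
      { toFun := fun x : (Fin n → ZMod q × ZMod q) × (Fin n → Y) =>
          fun i => ((x.1 i).1, (x.1 i).2, x.2 i)
        invFun := fun y => (fun i => ((y i).1, (y i).2.1), fun i => (y i).2.2)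
        left_inv := fun _ => rfl
        right_inv := fun _ => rfl } fun y => pathProb (c.kernel ch m) y
  simp only [margDist, outcomeDist, Fintype.sum_prod_type]
  rw [sum_comm]
  simp only [← mul_sum]
  have h' : ∀ m₃ : Msg n R .l31, ∑ b : Fin n → ZMod q × ZMod q, ∑ y : Fin n → Y,
      pathProb (c.kernel ch (outcomeEquiv q Y n R ((s, b), m₃, y)).1)
        (outcomeEquiv q Y n R ((s, b), m₃, y)).2 = 1 := fun m₃ => h (s.1, s.2.1, m₃, s.2.2)
  simp only [h']
  have h31 := hN .l31
  simp only [Fintype.card_prod, Fintype.card_fin, sum_const, card_univ, nsmul_eq_mul, mul_one]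
  push_cast
  have : (numMsg n (R .l31) : ℝ) ≠ 0 := by positivity
  field_simp

/-- The auxiliary variable at a given time. -/
def aux (ω : Outcome q Y n R × Fin n) : Aux q n R := auxAt ω.1.1 ω.2 (past ω.1.2 ω.2)

/-- The outputs of users 1 and 2 at a given time. -/
def out₁₂ (ω : Outcome q Y n R × Fin n) : ZMod q × ZMod q := ((ω.1.2 ω.2).1, (ω.1.2 ω.2).2.1)

/-- The input of user 2 is determined by the auxiliary variable. -/
def auxIn₂ (v : Aux q n R) : ZMod q := c.f₂ v.1 v.2.1.2.1 fun j => (v.2.2 j).2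

/-- A value of V fixes the time, three messages and the past outputs, so its law is a partial sum of
`margDist`, divided by `n` for the time. The function `f` allows one statement to serve both for the
pair of V and the outputs and, with `f` constant, for V alone. -/
theorem law_aux_eq {A : Type*} [DecidableEq A] (i : Fin n)
    (s : Msg n R .l13 × Msg n R .l23 × Msg n R .l32) (hb : Fin i.val → ZMod q × ZMod q)
    (f : ZMod q × ZMod q → A) (a : A) :
    law (c.timedDist ch) (fun ω => (aux ω, f (out₁₂ ω))) (⟨i, s, hb⟩, a) =
      (n : ℝ)⁻¹ * ∑ b, if past b i = hb ∧ f (b i) = a then c.margDist ch s b else 0 := by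
  classical
  unfold law
  rw [Fintype.sum_prod_type, ← (outcomeEquiv q Y n R).sum_comp]
  have h1 : ∀ x, ∑ j, @ite ℝ ((aux (outcomeEquiv q Y n R x, j),
      f (out₁₂ (outcomeEquiv q Y n R x, j))) = ((⟨i, s, hb⟩ : Aux q n R), a))
      (Classical.propDecidable _) (c.timedDist ch (outcomeEquiv q Y n R x, j)) 0 =
      if x.1.1 = s then (if past x.1.2 i = hb ∧ f (x.1.2 i) = a then
        (n : ℝ)⁻¹ * c.outcomeDist ch (outcomeEquiv q Y n R x) else 0) else 0 := by
    intro x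
    rw [Finset.sum_eq_single i]
    · have : (aux (outcomeEquiv q Y n R x, i), f (out₁₂ (outcomeEquiv q Y n R x, i))) =
          ((⟨i, s, hb⟩ : Aux q n R), a) ↔ x.1.1 = s ∧ past x.1.2 i = hb ∧ f (x.1.2 i) = a := by
        rw [Prod.mk.injEq, aux, auxAt, Sigma.mk.injEq, heq_eq_eq, Prod.mk.injEq]
        simp only [true_and, and_assoc]
        exact Iff.rfl
      by_cases h : x.1.1 = s ∧ past x.1.2 i = hb ∧ f (x.1.2 i) = a
      · rw [if_pos (this.2 h), if_pos h.1, if_pos h.2]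
        rfl
      · rw [if_neg (mt this.1 h), ← ite_and, if_neg h]
    · intro j _ hj
      rw [if_neg]
      intro h
      rw [Prod.mk.injEq, aux, auxAt, Sigma.mk.injEq] at h
      exact hj h.1.1
    · simp
  simp only [h1]
  rw [Fintype.sum_prod_type, Fintype.sum_prod_type, Finset.sum_eq_single s]
  · simp only [if_true, margDist, mul_sum]
    refine sum_congr rfl fun b _ => ?_
    split_ifs
    · rw [mul_sum]
    · simp
  · intro s' _ hs
    simp [hs]
  · simp

theorem letter_v (ω : Outcome q Y n R × Fin n) :
    (c.letter ω).v = Fintype.equivFin (Aux q n R) (aux ω) := rfl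

theorem letter_w₂ (ω : Outcome q Y n R × Fin n) :
    (c.letter ω).w₂ = (out₁₂ ω).2 - c.auxIn₂ (aux ω) := by
  obtain ⟨⟨m, y⟩, i⟩ := ω
  change c.in₃ m i (past y i) + ((y i).1 - c.in₁ m i (past y i) - c.in₃ m i (past y i)) +
    ((y i).2.1 - c.in₂ m i (past y i) - (y i).1 + c.in₁ m i (past y i)) =
      (y i).2.1 - c.in₂ m i (past y i)
  ring

/-- `I(V; X₃ + Z₁ + Z₂)` bounds the rate from user 3 to user 2. -/
theorem bound_32 (hn : 0 < n) (hN : ∀ l, 0 < numMsg n (R l)) :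
    (1 - c.errorProb ch) * Real.logb 2 (numMsg n (R .l32)) - 1 ≤
      n * mutualInfo (jointDist ch (c.inputDist ch)) v w₂ := by
  classical
  set J := jointDist ch (c.inputDist ch) with hJ
  have hJ0 : ∀ s, 0 ≤ J s :=
    (jointDist_mem_stdSimplex ch (c.inputDist_mem_stdSimplex ch hn hN)).1
  have hp := (c.timedDist_mem_stdSimplex ch hn hN).1
  have hn' : (n : ℝ) ≠ 0 := by positivity
  let W : Outcome q Y n R × Fin n → ZMod q := fun ω => (out₁₂ ω).2 - c.auxIn₂ (aux ω)
  let G : Aux q n R → ZMod q × ZMod q → ℝ := fun v b =>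
    law (c.timedDist ch) (fun ω => (aux ω, out₁₂ ω)) (v, b)
  let Gw : Aux q n R → ZMod q → ℝ := fun v w => law (c.timedDist ch) (fun ω => (aux ω, W ω)) (v, w)
  let Gv : Aux q n R → ℝ := law (c.timedDist ch) aux
  let N : ZMod q → ℝ := law (c.timedDist ch) W
  have hG0 : ∀ v b, 0 ≤ G v b := fun v b => law_nonneg hp _ _
  have hGw0 : ∀ v b, 0 ≤ Gw v b := fun v b => law_nonneg hp _ _
  have hGv0 : ∀ v, 0 ≤ Gv v := fun v => law_nonneg hp _ _
  have hN0 : ∀ w, 0 ≤ N w := fun w => law_nonneg hp _ _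
  have hNsum : ∑ w, N w = 1 := by
    rw [sum_law, (c.timedDist_mem_stdSimplex ch hn hN).2]
  -- V determines X2, so given V the variable X3 + Z1 + Z2 is Y2 up to a known shift.
  have hGsum : ∀ v b, ∑ a, G v (a, b) = Gw v (b - c.auxIn₂ v) := by
    intro v b
    have h1 := law_comp_injective (c.timedDist ch) (fun ω => (aux ω, (out₁₂ ω).2))
      (e := fun x => (x.1, x.2 - c.auxIn₂ x.1)) (fun x y h => by
        simp only [Prod.mk.injEq] at h
        obtain ⟨h1, h2⟩ := h
        rw [h1] at h2
        exact Prod.ext h1 (sub_left_injective h2)) (v, b)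
    refine Eq.trans ?_ h1.symm
    rw [← sum_law_pair_left (c.timedDist ch) (fun ω => (out₁₂ ω).1)]
    refine sum_congr rfl fun a _ => ?_
    exact law_comp_injective (c.timedDist ch) (fun ω => ((out₁₂ ω).1, aux ω, (out₁₂ ω).2))
      (e := fun x => (x.2.1, x.1, x.2.2)) (fun x y => by simp only [Prod.ext_iff]; tauto) (a, v, b)
  have hratio : ∀ ω, ratio J v w₂ (c.letter ω) = Gw (aux ω) (W ω) / (Gv (aux ω) * N (W ω)) := by
    intro ω
    simp only [ratio, hJ, ← law_letter, law_law, letter_w₂, letter_v]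
    rw [law_comp_injective (c.timedDist ch) aux (Fintype.equivFin (Aux q n R)).injective,
      law_comp_injective (c.timedDist ch) (fun ω => (aux ω, W ω))
        (e := fun x => (Fintype.equivFin (Aux q n R) x.1, x.2))
        (fun x y => by simp only [Prod.ext_iff, EmbeddingLike.apply_eq_iff_eq]; exact id)
        (aux ω, W ω)]
  -- After M31 and Y3 are averaged out, the process of (Y1, Y2) is no longer given by the channel
  -- kernel. Its conditional probabilities given the messages and the past are G / Gv; the uniform
  -- time contributes the same factor to both and cancels.
  have hcond : ∀ s b, c.margDist ch s b ≤
      (Fintype.card (Msg n R .l13 × Msg n R .l23 × Msg n R .l32) : ℝ)⁻¹ *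
        ∏ i : Fin n, G ⟨i, s, past b i⟩ (b i) / Gv ⟨i, s, past b i⟩ := by
    intro s b
    refine (le_prod_conditional (c.margDist_nonneg ch s) b).trans (le_of_eq ?_)
    rw [c.sum_margDist ch hN s]
    congr 1
    refine prod_congr rfl fun i _ => ?_
    have h1 := c.law_aux_eq ch i s (past b i) id (b i)
    have h2 := c.law_aux_eq ch i s (past b i) (fun _ => ()) ()
    rw [law_comp_injective (c.timedDist ch) aux (e := fun x => (x, ()))
      (fun x y h => by simpa using h) ⟨i, s, past b i⟩] at h2
    simp only [id, and_true] at h1 h2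
    rw [show G ⟨i, s, past b i⟩ (b i) = _ from h1, show Gv ⟨i, s, past b i⟩ = _ from h2,
      mul_div_mul_left _ _ (inv_ne_zero hn')]
  have hS : (Fintype.card (Msg n R .l13 × Msg n R .l23 × Msg n R .l32) : ℝ) =
      numMsg n (R .l32) * Fintype.card (Msg n R .l13 × Msg n R .l23) := by
    simp only [Fintype.card_prod, Fintype.card_fin]
    push_cast
    ring
  have h13 := hN .l13
  have h23 := hN .l23
  have h32 := hN .l32
  have hM : (0 : ℝ) < numMsg n (R .l32) := by positivity
  have hMB : (0 : ℝ) < Fintype.card (Msg n R .l13 × Msg n R .l23) := by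
    simp only [Fintype.card_prod, Fintype.card_fin]
    positivity
  -- Dividing G / Gv by the likelihood ratio Gw / (Gv N) leaves G N / Gw. Summed over Y1 this is at
  -- most N, the unconditional law of X3 + Z1 + Z2, which does not know M32.
  let k : Msg n R .l32 → Msg n R .l13 × Msg n R .l23 → (i : Fin n) → (Fin i.val → ZMod q) →
      (Fin i.val → ZMod q) → ZMod q → ZMod q → ℝ := fun m₂ m i hb hd b d =>
    G ⟨i, (m.1, m.2, m₂), fun j => (hd j, hb j)⟩ (d, b) * (N (b - c.f₂ i m.2 hb) /
      Gw ⟨i, (m.1, m.2, m₂), fun j => (hd j, hb j)⟩ (b - c.f₂ i m.2 hb))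
  have main : ∀ w : Msg n R .l32 → Msg n R .l13 × Msg n R .l23 → (Fin n → ZMod q) → ℝ,
      (∀ ma mb b, 0 ≤ w ma mb b) → ∀ T : ℝ, 0 ≤ T → (∀ mb b, ∑ ma, w ma mb b ≤ T) →
      ∑ ω : Outcome q Y n R, w ω.1.2.2.2 (ω.1.1, ω.1.2.1) (fun i => (ω.2 i).2.1) *
        (c.outcomeDist ch ω * (∏ i, ratio J v w₂ (c.letter (ω, i)))⁻¹) ≤
          T / numMsg n (R .l32) := by
    intro w hw T hT0 hT
    rw [← (outcomeEquiv q Y n R).sum_comp, Fintype.sum_prod_type]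
    calc _ = ∑ x : (Msg n R .l13 × Msg n R .l23 × Msg n R .l32) × (Fin n → ZMod q × ZMod q),
          w x.1.2.2 (x.1.1, x.1.2.1) (fun i => (x.2 i).2) * (c.margDist ch x.1 x.2 *
            (∏ i : Fin n, (fun (v : Aux q n R) (u : ZMod q) => Gw v u / (Gv v * N u))
              ⟨i, x.1, past x.2 i⟩ ((x.2 i).2 - c.auxIn₂ ⟨i, x.1, past x.2 i⟩))⁻¹) := by
          refine sum_congr rfl fun x _ => ?_
          rw [margDist, sum_mul, mul_sum]
          refine sum_congr rfl fun t _ => ?_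
          simp only [hratio]
          rfl
      _ ≤ ∑ x : (Msg n R .l13 × Msg n R .l23 × Msg n R .l32) × (Fin n → ZMod q × ZMod q),
          (Fintype.card (Msg n R .l13 × Msg n R .l23 × Msg n R .l32) : ℝ)⁻¹ *
          (w x.1.2.2 (x.1.1, x.1.2.1) (fun i => (x.2 i).2) *
            ∏ i, k x.1.2.2 (x.1.1, x.1.2.1) i (past (fun i => (x.2 i).2) i)
              (past (fun i => (x.2 i).1) i) (x.2 i).2 (x.2 i).1) := by
          refine sum_le_sum fun x _ => ?_
          rw [mul_left_comm _ (w _ _ _)]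
          refine mul_le_mul_of_nonneg_left ?_ (hw _ _ _)
          refine (mul_le_mul_of_nonneg_right (hcond x.1 x.2) (inv_nonneg.2 (prod_nonneg
            fun i _ => div_nonneg (hGw0 _ _) (mul_nonneg (hGv0 _) (hN0 _))))).trans ?_
          rw [mul_assoc, ← prod_inv_distrib, ← prod_mul_distrib]
          refine mul_le_mul_of_nonneg_left ?_ (by positivity)
          refine prod_le_prod (fun i _ => mul_nonneg (div_nonneg (hG0 _ _) (hGv0 _))
            (inv_nonneg.2 (div_nonneg (hGw0 _ _) (mul_nonneg (hGv0 _) (hN0 _))))) fun i _ => ?_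
          change _ ≤ G ⟨i, x.1, past x.2 i⟩ (x.2 i) *
            (N ((x.2 i).2 - c.auxIn₂ ⟨i, x.1, past x.2 i⟩) /
              Gw ⟨i, x.1, past x.2 i⟩ ((x.2 i).2 - c.auxIn₂ ⟨i, x.1, past x.2 i⟩))
          have g1 := hG0 ⟨i, x.1, past x.2 i⟩ (x.2 i)
          have g2 := hGv0 ⟨i, x.1, past x.2 i⟩
          have g3 := hN0 ((x.2 i).2 - c.auxIn₂ ⟨i, x.1, past x.2 i⟩)
          have g4 := hGw0 ⟨i, x.1, past x.2 i⟩ ((x.2 i).2 - c.auxIn₂ ⟨i, x.1, past x.2 i⟩)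
          -- If V takes this value with probability zero, the conditional probability is 0 by
          -- convention and the inequality is trivial.
          rcases g2.eq_or_lt with h0 | h0
          · rw [← h0, div_zero, zero_mul]
            positivity
          · refine le_of_eq ?_
            rw [inv_div]
            field_simp
      _ ≤ (Fintype.card (Msg n R .l13 × Msg n R .l23 × Msg n R .l32) : ℝ)⁻¹ *
          (T * Fintype.card (Msg n R .l13 × Msg n R .l23)) := by
          rw [← mul_sum]
          refine mul_le_mul_of_nonneg_left ?_ (by positivity)
          let e : Msg n R .l32 × (Msg n R .l13 × Msg n R .l23) × (Fin n → ZMod q) ×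
              (Fin n → ZMod q) ≃
              (Msg n R .l13 × Msg n R .l23 × Msg n R .l32) × (Fin n → ZMod q × ZMod q) :=
            { toFun := fun x => ((x.2.1.1, x.2.1.2, x.1), fun i => (x.2.2.2 i, x.2.2.1 i))
              invFun := fun x => (x.1.2.2, (x.1.1, x.1.2.1), fun i => (x.2 i).2, fun i => (x.2 i).1)
              left_inv := fun _ => rfl
              right_inv := fun _ => rfl }
          rw [← e.sum_comp]
          have := sum_guess_le k (fun m i hb b => N (b - c.f₂ i m.2 hb))
            (fun m₂ m i hb hd b d => mul_nonneg (hG0 _ _) (div_nonneg (hN0 _) (hGw0 _ _)))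
            (fun m i hb b => hN0 _) (fun m₂ m i hb hd b => ?_)
            (fun m i hb => by rw [sum_shift N, hNsum]) w hw T hT hT0
          · simp only [Fintype.sum_prod_type] at this ⊢
            exact this
          · simp only [k]
            rw [← sum_mul, hGsum]
            change Gw _ (b - c.f₂ i m.2 hb) * (_ / Gw _ (b - c.f₂ i m.2 hb)) ≤ _
            rw [mul_div_left_comm]
            exact mul_le_of_le_one_right (hN0 _) (div_self_le_one _)
      _ = T / numMsg n (R .l32) := by
          rw [hS]
          field_simp
  rw [mutualInfo_eq_sum]
  refine c.guess_bound ch hn hN (M := numMsg n (R .l32)) (by exact_mod_cast h32)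
    (ratio J v w₂) (fun s hs => ratio_pos hJ0 _ _ hs)
    (fun ω => c.g₂ ω.1.2.1 (fun i => (ω.2 i).2.1) = ω.1.2.2.2) (fun ω hω => ?_) ?_ ?_
  · exact not_not.1 (not_or.1 (not_or.1 (not_or.1 hω).2).2).2
  · have := main (fun _ _ _ => 1) (fun _ _ _ => zero_le_one) (numMsg n (R .l32)) hM.le (by simp)
    simpa [hM.ne'] using this
  · have := main (fun ma mb b => if c.g₂ mb.2 b = ma then 1 else 0)
      (fun _ _ _ => by split_ifs <;> simp) 1 zero_le_one (by simp)
    simp only [ite_mul, one_mul, zero_mul] at this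
    convert this

end Code

end DegradedBound

end MADB

namespace MADB

open Finset Sample Filter Topology

/-! ### From code bounds to rates -/

section Converse

variable {q : ℕ} [NeZero q] {Y : Type*} [Fintype Y]

theorem numMsg_pos {n : ℕ} {r : ℝ} (hr : 0 ≤ r) : 0 < numMsg n r := by
  have h : (1 : ℝ) ≤ 2 ^ ((n : ℝ) * r) := Real.one_le_rpow (by norm_num) (by positivity)
  exact Nat.floor_pos.2 h

theorem le_logb_numMsg {n : ℕ} {r : ℝ} (hr : 0 ≤ r) :
    n * r - 1 ≤ Real.logb 2 (numMsg n r) := by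
  have h0 : (0 : ℝ) < 2 ^ ((n : ℝ) * r) := by positivity
  have h1 : (1 : ℝ) ≤ numMsg n r := by exact_mod_cast numMsg_pos hr
  have h2 : (2 : ℝ) ^ ((n : ℝ) * r) < numMsg n r + 1 := Nat.lt_floor_add_one _
  have h3 : (2 : ℝ) ^ ((n : ℝ) * r - 1) ≤ numMsg n r := by
    rw [Real.rpow_sub_one (by norm_num)]
    linarith
  rw [Real.le_logb_iff_rpow_le (by norm_num) (by linarith)]
  exact h3

theorem Code.errorProb_nonneg {n : ℕ} {R : Link → ℝ} (c : Code q Y n R) (ch : Channel q Y) :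
    0 ≤ c.errorProb ch := by
  classical
  rw [errorProb_eq]
  exact sum_nonneg fun ω _ => by split_ifs <;> simp [c.outcomeDist_nonneg ch ω]

/-- A code with small error probability has rates close to the region of some input
distribution. -/
theorem exists_mem_rateRegion_of_code (ch : Channel q Y) {n : ℕ} {R : Link → ℝ} (hn : 0 < n)
    (hR : ∀ l, 0 ≤ R l) (c : Code q Y n R) (hc : c.errorProb ch ≤ 1) :
    ∃ k, ∃ P ∈ stdSimplex ℝ (ZMod q × ZMod q × ZMod q × Fin k),
      (fun l => max 0 ((1 - c.errorProb ch) * R l - 3 / n)) ∈ rateRegion ch P := by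
  have hN : ∀ l, 0 < numMsg n (R l) := fun l => numMsg_pos (hR l)
  have hP := c.inputDist_mem_stdSimplex ch hn hN
  have hJ := jointDist_mem_stdSimplex ch hP
  refine ⟨_, _, hP, ?_⟩
  rw [mem_rateRegion]
  have hε := c.errorProb_nonneg ch
  have hn' : (0 : ℝ) < n := by positivity
  set ε := c.errorProb ch
  -- A single rate loses at most two bits, one in the guessing bound and one in rounding the number
  -- of messages. The sum of two rates is rounded twice, hence the 3 / n.
  have hsingle : ∀ l I, (1 - ε) * Real.logb 2 (numMsg n (R l)) - 1 ≤ n * I → 0 ≤ I →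
      max 0 ((1 - ε) * R l - 3 / n) ≤ I := by
    intro l I h hI
    refine max_le hI ?_
    have h1 := mul_le_mul_of_nonneg_left (le_logb_numMsg (n := n) (hR l)) (sub_nonneg.2 hc)
    rw [sub_le_iff_le_add, ← mul_le_mul_iff_right₀ hn', mul_add, mul_div_cancel₀ _ hn'.ne']
    linarith
  refine ⟨fun l => le_max_left _ _, hsingle _ _ (c.bound_13 ch hn hN) (condMutualInfo_nonneg hJ ..),
    hsingle _ _ (c.bound_23 ch hn hN) (condMutualInfo_nonneg hJ ..), ?_,
    hsingle _ _ (c.bound_31 ch hn hN) (condMutualInfo_nonneg hJ ..),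
    hsingle _ _ (c.bound_32 ch hn hN) (mutualInfo_nonneg hJ ..)⟩
  have hs : (1 - ε) * R .l13 + (1 - ε) * R .l23 - 3 / n ≤
      condMutualInfo (jointDist ch (c.inputDist ch)) x₁₂ y₃ x₃ := by
    have h := c.bound_sum ch hn hN
    have h1 := mul_le_mul_of_nonneg_left (le_logb_numMsg (n := n) (hR .l13)) (sub_nonneg.2 hc)
    have h2 := mul_le_mul_of_nonneg_left (le_logb_numMsg (n := n) (hR .l23)) (sub_nonneg.2 hc)
    rw [sub_le_iff_le_add, ← mul_le_mul_iff_right₀ hn', mul_add, mul_add,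
      mul_div_cancel₀ _ hn'.ne']
    linarith
  have h0 : 0 ≤ condMutualInfo (jointDist ch (c.inputDist ch)) x₁₂ y₃ x₃ :=
    condMutualInfo_nonneg hJ ..
  have h1 : 0 ≤ (1 - ε) * R .l13 := mul_nonneg (sub_nonneg.2 hc) (hR _)
  have h2 : 0 ≤ (1 - ε) * R .l23 := mul_nonneg (sub_nonneg.2 hc) (hR _)
  have h3 : (0 : ℝ) ≤ 3 / n := by positivity
  -- If one rate is truncated to 0, the bound for the sum still covers the other; if neither is, 6 /
  -- n is subtracted where 3 / n would do.
  rcases max_cases 0 ((1 - ε) * R .l13 - 3 / n) with h | h <;>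
    rcases max_cases 0 ((1 - ε) * R .l23 - 3 / n) with h' | h' <;>
    linarith

/-- The converse. -/
theorem Achievable.mem_closure {ch : Channel q Y} {R : Link → ℝ} (h : Achievable ch R) :
    R ∈ closure {R | ∃ k, ∃ P ∈ stdSimplex ℝ (ZMod q × ZMod q × ZMod q × Fin k),
      R ∈ rateRegion ch P} := by
  obtain ⟨hR, c, hc⟩ := h
  refine mem_closure_of_tendsto (b := atTop)
    (f := fun (n : ℕ) l => max 0 ((1 - (c n).errorProb ch) * R l - 3 / n)) ?_ ?_
  · rw [tendsto_pi_nhds]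
    intro l
    have h1 : Tendsto (fun n : ℕ => (3 : ℝ) / n) atTop (𝓝 0) :=
      tendsto_const_div_atTop_nhds_zero_nat 3
    have h2 := (((tendsto_const_nhds (x := (1 : ℝ))).sub hc).mul_const (R l)).sub h1
    simp only [sub_zero, one_mul] at h2
    have h3 := (tendsto_const_nhds (x := (0 : ℝ))).max h2
    rwa [max_eq_right (hR l)] at h3
  · filter_upwards [eventually_gt_atTop 0, hc.eventually (eventually_le_nhds (zero_lt_one' ℝ))]
      with n hn hn'
    exact exists_mem_rateRegion_of_code ch hn hR (c n) hn'

end Converse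

end MADB

namespace MADB

open Finset Filter Topology

/-! ### Independent words: Markov's and Chernoff's inequalities -/

section Iid

variable {ι A : Type*} [Fintype ι]

/-- The law of a family of independent random variables with law `p`. -/
def prodDist (p : A → ℝ) (x : ι → A) : ℝ := ∏ i, p (x i)

variable [Fintype A] {p : A → ℝ}

theorem prodDist_mem_stdSimplex [DecidableEq ι] (hp : p ∈ stdSimplex ℝ A) :
    prodDist p ∈ stdSimplex ℝ (ι → A) := by
  refine ⟨fun x => prod_nonneg fun i _ => hp.1 _, ?_⟩
  simp only [prodDist]
  rw [← Fintype.prod_sum (fun (_ : ι) a => p a)]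
  simp [hp.2]

theorem sum_mul_le_of_le {p F : A → ℝ} (hp : p ∈ stdSimplex ℝ A) {δ : ℝ} (h : ∀ a, F a ≤ δ) :
    ∑ a, p a * F a ≤ δ := by
  calc ∑ a, p a * F a ≤ ∑ a, p a * δ :=
        sum_le_sum fun a _ => mul_le_mul_of_nonneg_left (h a) (hp.1 a)
    _ = δ := by rw [← sum_mul, hp.2, one_mul]

/-- One codeword is separated from the rest of the codebook; applied twice, this expresses that the
true and a wrong codeword are independent. -/
theorem sum_prodDist_split [DecidableEq ι] (m : ι) (F : A → ({j // j ≠ m} → A) → ℝ) :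
    ∑ c : ι → A, prodDist p c * F (c m) (fun j => c j) =
      ∑ a, p a * ∑ r, prodDist p r * F a r := by
  rw [← (Equiv.funSplitAt m A).symm.sum_comp, Fintype.sum_prod_type]
  refine sum_congr rfl fun a _ => ?_
  rw [mul_sum]
  refine sum_congr rfl fun r _ => ?_
  have h1 : (Equiv.funSplitAt m A).symm (a, r) m = a := by simp [Equiv.funSplitAt]
  have h2 : ∀ j : {j // j ≠ m}, (Equiv.funSplitAt m A).symm (a, r) j = r j := by
    intro j
    simp [Equiv.funSplitAt, j.2]
  have h3 : prodDist p ((Equiv.funSplitAt m A).symm (a, r)) = p a * prodDist p r := by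
    unfold prodDist
    rw [Fintype.prod_eq_mul_prod_subtype_ne _ m, h1]
    congr 1
    exact prod_congr rfl fun j _ => by rw [h2]
  simp only [h1, h2, h3, mul_assoc]

theorem sum_prodDist_coord [DecidableEq ι] (hp : p ∈ stdSimplex ℝ A) (m : ι) (F : A → ℝ) :
    ∑ c : ι → A, prodDist p c * F (c m) = ∑ a, p a * F a := by
  rw [sum_prodDist_split m fun a _ => F a]
  simp only [← sum_mul, (prodDist_mem_stdSimplex hp).2, one_mul]

theorem sum_prodDist_two [DecidableEq ι] (hp : p ∈ stdSimplex ℝ A) {m m' : ι} (h : m' ≠ m)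
    (F : A → A → ℝ) :
    ∑ c : ι → A, prodDist p c * F (c m) (c m') = ∑ a, p a * ∑ b, p b * F a b := by
  rw [sum_prodDist_split m fun a r => F a (r ⟨m', h⟩)]
  refine sum_congr rfl fun a _ => ?_
  congr 1
  convert sum_prodDist_coord hp (⟨m', h⟩ : {j // j ≠ m}) (F a)

/-- An independent wrong codeword. -/
theorem sum_prodDist_two_le [DecidableEq ι] (hp : p ∈ stdSimplex ℝ A) {m m' : ι} (h : m' ≠ m)
    {F : A → A → ℝ} {δ : ℝ} (hF : ∀ a, ∑ b, p b * F a b ≤ δ) :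
    ∑ c : ι → A, prodDist p c * F (c m) (c m') ≤ δ := by
  rw [sum_prodDist_two hp h]
  exact sum_mul_le_of_le hp hF

open Classical in
/-- Markov's inequality: an independent codeword rarely has a large likelihood. -/
theorem sum_prodDist_likelihood_le [DecidableEq ι] (hp : p ∈ stdSimplex ℝ A) {w : ι → A → ℝ}
    (hw : ∀ i a, 0 ≤ w i a) {K : ℝ} (hK : 0 < K) :
    ∑ b : ι → A, prodDist p b *
      (if K * ∏ i, ∑ a, p a * w i a < ∏ i, w i (b i) then 1 else 0) ≤ K⁻¹ := by
  set D := ∏ i, ∑ a, p a * w i a with hD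
  have hD0 : 0 ≤ D := prod_nonneg fun i _ => sum_nonneg fun a _ => mul_nonneg (hp.1 a) (hw i a)
  have hsum : ∑ b : ι → A, prodDist p b * ∏ i, w i (b i) = D := by
    rw [hD, Fintype.prod_sum]
    exact sum_congr rfl fun b _ => by rw [prodDist, prod_mul_distrib]
  have hterm : ∀ b : ι → A, 0 ≤ prodDist p b * ∏ i, w i (b i) := fun b =>
    mul_nonneg ((prodDist_mem_stdSimplex hp).1 b) (prod_nonneg fun i _ => hw i _)
  rcases hD0.eq_or_lt with h0 | h0
  -- If the averaged likelihood is 0, every word of positive probability has likelihood 0, and the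
  -- strict inequality in the test fails.
  · refine le_trans (le_of_eq (sum_eq_zero fun b _ => ?_)) (inv_nonneg.2 hK.le)
    have hb := (sum_eq_zero_iff_of_nonneg fun b _ => hterm b).1 (hsum.trans h0.symm) b (mem_univ b)
    rw [← h0, mul_zero]
    rcases mul_eq_zero.1 hb with h | h
    · rw [h, zero_mul]
    · rw [h, if_neg (lt_irrefl _), mul_zero]
  · calc _ ≤ ∑ b : ι → A, (K * D)⁻¹ * (prodDist p b * ∏ i, w i (b i)) := by
          refine sum_le_sum fun b _ => ?_
          split_ifs with h
          · rw [mul_left_comm]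
            refine mul_le_mul_of_nonneg_left ?_ ((prodDist_mem_stdSimplex hp).1 b)
            rw [inv_mul_eq_div, one_le_div (by positivity)]
            exact h.le
          · rw [mul_zero]
            exact mul_nonneg (by positivity) (hterm b)
      _ = K⁻¹ := by
          rw [← mul_sum, hsum]
          field_simp

open Classical in
/-- Chernoff's bound: a product of independent positive variables is at least as large as the
expected logarithm suggests. -/
theorem exists_chernoff {μ f : A → ℝ} (hμ : μ ∈ stdSimplex ℝ A) (hf : ∀ a, 0 < μ a → 0 < f a)
    {γ : ℝ} (hγ : γ < ∑ a, μ a * Real.logb 2 (f a)) :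
    ∃ ρ : ℝ, 0 ≤ ρ ∧ ρ < 1 ∧ ∀ n : ℕ, ∑ t : Fin n → A, prodDist μ t *
      (if ∏ i, f (t i) ≤ (2 : ℝ) ^ ((n : ℝ) * γ) then 1 else 0) ≤ ρ ^ n := by
  have h2 : (0 : ℝ) < Real.log 2 := Real.log_pos (by norm_num)
  set g : A → ℝ := fun a => Real.log (f a) - γ * Real.log 2 with hg
  have hmean : 0 < ∑ a, μ a * g a := by
    have e : ∑ a, μ a * g a = (∑ a, μ a * Real.logb 2 (f a) - γ) * Real.log 2 := by
      simp only [hg, mul_sub, sum_sub_distrib, ← sum_mul, hμ.2, one_mul, sub_mul]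
      congr 1
      rw [sum_mul]
      refine sum_congr rfl fun a _ => ?_
      rw [Real.logb, mul_assoc, div_mul_cancel₀ _ h2.ne']
    rw [e]
    exact mul_pos (sub_pos.2 hγ) h2
  -- The moment generating function of `-g`. It equals 1 at 0 with negative derivative, so some
  -- small positive `l` gives φ l < 1; this is the exponential rate.
  set φ : ℝ → ℝ := fun l => ∑ a, μ a * Real.exp (-(l * g a)) with hφ
  have hφ0 : φ 0 = 1 := by simp [hφ, hμ.2]
  have hderiv : HasDerivAt φ (-∑ a, μ a * g a) 0 := by
    have : HasDerivAt φ (∑ a, μ a * (Real.exp (-(0 * g a)) * -(1 * g a))) 0 :=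
      HasDerivAt.fun_sum fun a _ =>
        ((((hasDerivAt_id (0 : ℝ)).mul_const (g a)).neg).exp).const_mul (μ a)
    simpa using this
  obtain ⟨l, hl, hlt⟩ : ∃ l : ℝ, 0 < l ∧ φ l < 1 := by
    have h1 := (hasDerivAt_iff_tendsto_slope.1 hderiv).eventually
      (eventually_lt_nhds (neg_lt_zero.2 hmean))
    have h3 : ∀ᶠ x in 𝓝[>] (0 : ℝ), slope φ 0 x < 0 :=
      h1.filter_mono (nhdsWithin_mono _ fun x hx => ne_of_gt hx)
    obtain ⟨l, hl, hl0⟩ := (h3.and self_mem_nhdsWithin).exists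
    refine ⟨l, hl0, ?_⟩
    rw [slope_def_field, hφ0, sub_zero] at hl
    have hl0' : 0 < l := hl0
    rw [div_lt_iff₀ hl0', zero_mul] at hl
    linarith
  refine ⟨φ l, sum_nonneg fun a _ => mul_nonneg (hμ.1 a) (Real.exp_pos _).le, hlt, fun n => ?_⟩
  have hprod : φ l ^ n = ∑ t : Fin n → A, prodDist μ t * ∏ i, Real.exp (-(l * g (t i))) := by
    have : φ l ^ n = ∏ _i : Fin n, φ l := by simp
    rw [this, hφ, Fintype.prod_sum]
    exact sum_congr rfl fun b _ => by rw [prodDist, prod_mul_distrib]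
  rw [hprod]
  refine sum_le_sum fun t _ => ?_
  have ht0 : 0 ≤ prodDist μ t := (prodDist_mem_stdSimplex hμ).1 t
  rcases ht0.eq_or_lt with h0 | h0
  · rw [← h0, zero_mul, zero_mul]
  refine mul_le_mul_of_nonneg_left ?_ ht0
  rw [← Real.exp_sum]
  split_ifs with h
  -- On the event the sum of the `g (t i)` is at most 0, so the exponential weight is at least 1.
  · rw [Real.one_le_exp_iff, sum_neg_distrib, neg_nonneg, ← mul_sum]
    refine mul_nonpos_of_nonneg_of_nonpos hl.le ?_
    have hpos : ∀ i, 0 < f (t i) := by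
      intro i
      refine hf _ ((hμ.1 _).lt_of_ne fun hz => h0.ne' ?_)
      exact prod_eq_zero (mem_univ i) hz.symm
    have hlog := Real.log_le_log (prod_pos fun i _ => hpos i) h
    rw [Real.log_prod fun i _ => (hpos i).ne', Real.log_rpow (by norm_num)] at hlog
    simp only [hg, sum_sub_distrib, sum_const, card_univ, Fintype.card_fin, nsmul_eq_mul]
    linarith
  · exact (Real.exp_pos _).le

end Iid

end MADB

namespace MADB

open Finset Sample

/-! ### Likelihood ratios as channel over averaged channel; strategies of user 3 -/

section Density

variable {Ω A B C : Type*} [Fintype Ω] [Fintype A] {p : Ω → ℝ}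

/-- The conditional likelihood ratio compares a channel to its average over one input. -/
theorem condRatio_mul (hp : ∀ ω, 0 ≤ p ω) (f : Ω → A) (g : Ω → B) (h : Ω → C) {ω : Ω}
    (hω : 0 < p ω) (P : A → ℝ) (κ : A → B → ℝ)
    (h1 : ∀ a b, law p (fun ω => (f ω, g ω, h ω)) (a, b, h ω) =
      law p (fun ω => (f ω, h ω)) (a, h ω) * κ a b)
    (h2 : ∀ a, law p (fun ω => (f ω, h ω)) (a, h ω) = P a * law p h (h ω)) :
    condRatio p f g h ω * ∑ a, P a * κ a (g ω) = κ (f ω) (g ω) ∧ 0 < ∑ a, P a * κ a (g ω) := by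
  have hg : law p (fun ω => (g ω, h ω)) (g ω, h ω) = law p h (h ω) * ∑ a, P a * κ a (g ω) := by
    rw [← sum_law_pair_left p f (fun ω => (g ω, h ω)), mul_sum]
    refine sum_congr rfl fun a _ => ?_
    rw [h1, h2]
    ring
  have h0 := law_pos hp h hω
  have hfh := law_pos hp (fun ω => (f ω, h ω)) hω
  have hgh := law_pos hp (fun ω => (g ω, h ω)) hω
  have hpos : 0 < ∑ a, P a * κ a (g ω) := by
    rw [hg] at hgh
    exact pos_of_mul_pos_right hgh h0.le
  refine ⟨?_, hpos⟩
  rw [condRatio, hg, h1]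
  field_simp

/-- The likelihood ratio compares a channel to its average. -/
theorem ratio_mul (hp : ∀ ω, 0 ≤ p ω) (f : Ω → A) (g : Ω → B) {ω : Ω}
    (hω : 0 < p ω) (κ : A → B → ℝ)
    (h1 : ∀ a b, law p (fun ω => (f ω, g ω)) (a, b) = law p f a * κ a b) :
    ratio p f g ω * ∑ a, law p f a * κ a (g ω) = κ (f ω) (g ω) ∧
      0 < ∑ a, law p f a * κ a (g ω) := by
  have hg : law p g (g ω) = ∑ a, law p f a * κ a (g ω) := by
    rw [← sum_law_pair_left p f g]
    exact sum_congr rfl fun a _ => h1 a _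
  have hf := law_pos hp f hω
  have hgp := law_pos hp g hω
  rw [← hg, ratio, h1]
  refine ⟨?_, hgp⟩
  field_simp

end Density

section Strategy

variable {q : ℕ} [NeZero q] {Y : Type*} [Fintype Y] {k : ℕ}

/-- The law of `V`. -/
def vLaw (P₃ : Fin k × ZMod q → ℝ) (v : Fin k) : ℝ := ∑ x, P₃ (v, x)

/-- The conditional law of `X₃` given `V`. -/
noncomputable def condX (P₃ : Fin k × ZMod q → ℝ) (v : Fin k) : ZMod q → ℝ :=
  if vLaw P₃ v = 0 then Pi.single 0 1 else fun x => P₃ (v, x) / vLaw P₃ v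

/-- The law of a random map from the values of `V` to the inputs of user 3, which realizes the
conditional law of `X₃` given `V`. -/
noncomputable def strat (P₃ : Fin k × ZMod q → ℝ) (s : Fin k → ZMod q) : ℝ :=
  ∏ v, condX P₃ v (s v)

variable {P₁ P₂ : ZMod q → ℝ} {P₃ : Fin k × ZMod q → ℝ}

theorem vLaw_mem_stdSimplex (h₃ : P₃ ∈ stdSimplex ℝ (Fin k × ZMod q)) :
    vLaw P₃ ∈ stdSimplex ℝ (Fin k) :=
  ⟨fun v => sum_nonneg fun x _ => h₃.1 _, by
    simp only [vLaw]
    rw [← Fintype.sum_prod_type, h₃.2]⟩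

theorem condX_mem_stdSimplex (h₃ : P₃ ∈ stdSimplex ℝ (Fin k × ZMod q)) (v : Fin k) :
    condX P₃ v ∈ stdSimplex ℝ (ZMod q) := by
  unfold condX
  split_ifs with h
  · exact single_mem_stdSimplex ℝ 0
  · exact ⟨fun x => div_nonneg (h₃.1 _) ((vLaw_mem_stdSimplex h₃).1 v), by
      rw [← sum_div]
      exact div_self h⟩

theorem vLaw_mul_condX (h₃ : P₃ ∈ stdSimplex ℝ (Fin k × ZMod q)) (v : Fin k) (x : ZMod q) :
    vLaw P₃ v * condX P₃ v x = P₃ (v, x) := by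
  by_cases h : vLaw P₃ v = 0
  · rw [h, zero_mul]
    exact ((sum_eq_zero_iff_of_nonneg fun x _ => h₃.1 (v, x)).1 h x (mem_univ x)).symm
  · rw [condX, if_neg h]
    field_simp

theorem strat_mem_stdSimplex (h₃ : P₃ ∈ stdSimplex ℝ (Fin k × ZMod q)) :
    strat P₃ ∈ stdSimplex ℝ (Fin k → ZMod q) := by
  refine ⟨fun s => prod_nonneg fun v _ => (condX_mem_stdSimplex h₃ v).1 _, ?_⟩
  simp only [strat]
  rw [← Fintype.prod_sum fun v x => condX P₃ v x]
  simp [(condX_mem_stdSimplex h₃ _).2]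

/-- The values of a random strategy at different points are independent, and those other than at `v`
sum out to 1. -/
theorem sum_strat_mul (h₃ : P₃ ∈ stdSimplex ℝ (Fin k × ZMod q)) (v : Fin k) (F : ZMod q → ℝ) :
    ∑ s, strat P₃ s * F (s v) = ∑ x, condX P₃ v x * F x := by
  have h1 : ∀ s : Fin k → ZMod q, strat P₃ s * F (s v) =
      ∏ u, condX P₃ u (s u) * (if u = v then F (s u) else 1) := by
    intro s
    rw [prod_mul_distrib, Finset.prod_ite_eq' univ v fun u => F (s u)]
    simp [strat]
  simp only [h1]
  rw [← Fintype.prod_sum fun u x => condX P₃ u x * (if u = v then F x else 1),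
    Finset.prod_eq_single v]
  · simp
  · intro u _ hu
    simp [hu, (condX_mem_stdSimplex h₃ u).2]
  · simp

variable (ch : Channel q Y)

/-- One letter of the random code, `((x₁, x₂, v, s), (y₁, y₂, y₃))`. -/
abbrev Letter (q : ℕ) (Y : Type*) (k : ℕ) : Type _ :=
  (ZMod q × ZMod q × Fin k × (Fin k → ZMod q)) × (ZMod q × ZMod q × Y)

/-- The law of one letter of the random code, before transmission. -/
noncomputable def wordDist (P₁ P₂ : ZMod q → ℝ) (P₃ : Fin k × ZMod q → ℝ)
    (u : ZMod q × ZMod q × Fin k × (Fin k → ZMod q)) : ℝ :=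
  P₁ u.1 * (P₂ u.2.1 * (vLaw P₃ u.2.2.1 * strat P₃ u.2.2.2))

/-- The law of one letter of the random code and the corresponding outputs. -/
noncomputable def letterDist (P₁ P₂ : ZMod q → ℝ) (P₃ : Fin k × ZMod q → ℝ)
    (t : Letter q Y k) : ℝ :=
  wordDist P₁ P₂ P₃ t.1 *
    ch.prob t.1.1 t.1.2.1 (t.1.2.2.2 t.1.2.2.1) t.2.1 t.2.2.1 t.2.2.2

/-- The single-letter variables of one letter of the random code. -/
def Letter.toSample (t : Letter q Y k) : Sample q Y k :=
  split q Y k ((t.1.1, t.1.2.1, t.1.2.2.2 t.1.2.2.1, t.1.2.2.1),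
    (t.2.2.2, t.2.1 - t.1.1 - t.1.2.2.2 t.1.2.2.1, t.2.2.1 - t.1.2.1 - t.2.1 + t.1.1))

theorem wordDist_mem_stdSimplex (h₁ : P₁ ∈ stdSimplex ℝ (ZMod q))
    (h₂ : P₂ ∈ stdSimplex ℝ (ZMod q)) (h₃ : P₃ ∈ stdSimplex ℝ (Fin k × ZMod q)) :
    wordDist P₁ P₂ P₃ ∈ stdSimplex ℝ _ := by
  refine ⟨fun u => mul_nonneg (h₁.1 _) (mul_nonneg (h₂.1 _) (mul_nonneg
    ((vLaw_mem_stdSimplex h₃).1 _) ((strat_mem_stdSimplex h₃).1 _))), ?_⟩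
  simp only [wordDist, Fintype.sum_prod_type, ← mul_sum, (strat_mem_stdSimplex h₃).2,
    (vLaw_mem_stdSimplex h₃).2, h₁.2, h₂.2, mul_one]

theorem letterDist_mem_stdSimplex (h₁ : P₁ ∈ stdSimplex ℝ (ZMod q))
    (h₂ : P₂ ∈ stdSimplex ℝ (ZMod q)) (h₃ : P₃ ∈ stdSimplex ℝ (Fin k × ZMod q)) :
    letterDist ch P₁ P₂ P₃ ∈ stdSimplex ℝ (Letter q Y k) := by
  refine ⟨fun t => mul_nonneg ((wordDist_mem_stdSimplex h₁ h₂ h₃).1 _) (mul_nonneg (mul_nonneg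
    ((ch.trans_mem _ _ _).1 _) (ch.noise₁_mem.1 _)) (ch.noise₂_mem.1 _)), ?_⟩
  rw [Fintype.sum_prod_type]
  simp only [letterDist, ← mul_sum, sum_prob_eq, mul_one]
  exact (wordDist_mem_stdSimplex h₁ h₂ h₃).2

/-- The strategy is drawn independently of V, yet its value at V has the prescribed conditional law.
Thus independent codebooks reproduce the single-letter law, in which V and X3 are dependent. -/
theorem law_letterDist (h₃ : P₃ ∈ stdSimplex ℝ (Fin k × ZMod q)) :
    law (letterDist ch P₁ P₂ P₃) Letter.toSample = jointDist ch (productDist P₁ P₂ P₃) := by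
  classical
  funext s
  obtain ⟨⟨s, t⟩, rfl⟩ := (split q Y _).surjective s
  rw [jointDist_split]
  refine (law_comp_injective (letterDist ch P₁ P₂ P₃) (fun t : Letter q Y k =>
    (((t.1.1, t.1.2.1, t.1.2.2.2 t.1.2.2.1, t.1.2.2.1) : ZMod q × ZMod q × ZMod q × Fin k),
    ((t.2.2.2, t.2.1 - t.1.1 - t.1.2.2.2 t.1.2.2.1, t.2.2.1 - t.1.2.1 - t.2.1 + t.1.1) :
      Y × ZMod q × ZMod q))) (split q Y k).injective (s, t)).trans ?_
  refine (law_kernel (p := letterDist ch P₁ P₂ P₃) (p₁ := wordDist P₁ P₂ P₃)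
    (κ := fun u a => ch.prob u.1 u.2.1 (u.2.2.2 u.2.2.1) a.1 a.2.1 a.2.2) (fun _ _ => rfl)
    (fun u => ((u.1, u.2.1, u.2.2.2 u.2.2.1, u.2.2.1) : ZMod q × ZMod q × ZMod q × Fin k))
    (fun u a => ((a.2.2, a.1 - u.1 - u.2.2.2 u.2.2.1, a.2.1 - u.2.1 - a.1 + u.1) :
      Y × ZMod q × ZMod q))
    (fun s t => ch.trans s.1 s.2.1 s.2.2.1 t.1 * ch.noise₁ t.2.1 * ch.noise₂ t.2.2) ?_
      s t).trans ?_
  · rintro ⟨x₁, x₂, v, f⟩ ⟨y, z₁, z₂⟩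
    rw [Finset.sum_eq_single (z₁ + f v + x₁, z₂ + z₁ + f v + x₂, y)]
    · rw [if_pos (by simp only [Prod.mk.injEq, true_and]; constructor <;> ring)]
      simp only [Channel.prob]
      congr 2
      · congr 1; ring
      · ring
    · rintro ⟨a, b, y'⟩ _ hne
      rw [if_neg]
      intro heq
      simp only [Prod.mk.injEq] at heq
      obtain ⟨h1, h2, h3⟩ := heq
      refine hne ?_
      rw [Prod.mk.injEq, Prod.mk.injEq]
      refine ⟨by rw [← h2]; ring, by rw [← h3, ← h2]; ring, h1⟩
    · simp
  · congr 1
    obtain ⟨x₁, x₂, x₃, v⟩ := s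
    simp only [law, Fintype.sum_prod_type, wordDist, Prod.mk.injEq, productDist]
    rw [Finset.sum_eq_single x₁ (fun x _ hx => by simp [hx]) (by simp),
      Finset.sum_eq_single x₂ (fun x _ hx => by simp [hx]) (by simp),
      Finset.sum_eq_single v (fun x _ hx => by simp [hx]) (by simp)]
    have h := sum_strat_mul h₃ v fun x => if x = x₃ then 1 else 0
    simp only [mul_ite, mul_one, mul_zero, Finset.sum_ite_eq', mem_univ, if_true] at h
    rw [← vLaw_mul_condX h₃, ← h]
    simp only [true_and, and_true, mul_sum]
    refine sum_congr rfl fun f _ => ?_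
    split_ifs <;> ring

end Strategy

end MADB

namespace MADB

open Finset Sample

/-! ### The single-letter densities of the six tests -/

section Densities

variable {q : ℕ} [NeZero q] {Y : Type*} [Fintype Y] {k : ℕ} (ch : Channel q Y)
  {P₁ P₂ : ZMod q → ℝ} {P₃ : Fin k × ZMod q → ℝ}

/-- The channel from `V` to user 1 (which subtracts its own input). -/
noncomputable def bcChannel₁ (P₃ : Fin k × ZMod q → ℝ) (v : Fin k) (y : ZMod q) : ℝ :=
  ∑ s, strat P₃ s * ch.noise₁ (y - s v)

/-- The channel from `V` to user 2 (which subtracts its own input). -/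
noncomputable def bcChannel₂ (P₃ : Fin k × ZMod q → ℝ) (v : Fin k) (y : ZMod q) : ℝ :=
  ∑ y', bcChannel₁ ch P₃ v y' * ch.noise₂ (y - y')

theorem bcChannel₁_nonneg (h₃ : P₃ ∈ stdSimplex ℝ (Fin k × ZMod q)) (v : Fin k) (y : ZMod q) :
    0 ≤ bcChannel₁ ch P₃ v y :=
  sum_nonneg fun s _ => mul_nonneg ((strat_mem_stdSimplex h₃).1 s) (ch.noise₁_mem.1 _)

theorem bcChannel₂_nonneg (h₃ : P₃ ∈ stdSimplex ℝ (Fin k × ZMod q)) (v : Fin k) (y : ZMod q) :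
    0 ≤ bcChannel₂ ch P₃ v y :=
  sum_nonneg fun y' _ => mul_nonneg (bcChannel₁_nonneg ch h₃ v y') (ch.noise₂_mem.1 _)

theorem law_inputs (a b c : ZMod q) :
    law (jointDist ch (productDist P₁ P₂ P₃)) (fun s => (s.x₁, s.x₂, s.x₃)) (a, b, c) =
      (∑ v, P₃ (v, c)) * (P₁ a * P₂ b) := by
  rw [law_jointDist_input ch _ (fun s => (s.x₁, s.x₂, s.x₃)) (fun s => (s.1, s.2.1, s.2.2.1))
    (fun _ _ => rfl), law_productDist_x]

theorem law_v_x₃ (h₁ : P₁ ∈ stdSimplex ℝ (ZMod q)) (h₂ : P₂ ∈ stdSimplex ℝ (ZMod q))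
    (a : Fin k) (b : ZMod q) :
    law (jointDist ch (productDist P₁ P₂ P₃)) (fun s => (s.v, s.x₃)) (a, b) = P₃ (a, b) := by
  rw [law_jointDist_input ch _ (fun s => (s.v, s.x₃)) (fun s => (s.2.2.2, s.2.2.1))
    (fun _ _ => rfl), law_productDist_v h₁ h₂]

theorem law_x₂_x₁₃ (a b c : ZMod q) :
    law (jointDist ch (productDist P₁ P₂ P₃)) (fun s => (s.x₂, s.x₁₃)) (b, (a, c)) =
      (∑ v, P₃ (v, c)) * (P₁ a * P₂ b) := by
  rw [← law_inputs ch]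
  exact law_comp_injective _ (fun s : Sample q Y k => (s.x₁, s.x₂, s.x₃))
    (e := fun x => (x.2.1, (x.1, x.2.2))) (fun x y => by simp only [Prod.ext_iff]; tauto) (a, b, c)

theorem law_x₁₂_x₃ (a b c : ZMod q) :
    law (jointDist ch (productDist P₁ P₂ P₃)) (fun s => (s.x₁₂, s.x₃)) ((a, b), c) =
      (∑ v, P₃ (v, c)) * (P₁ a * P₂ b) := by
  rw [← law_inputs ch]
  exact law_comp_injective _ (fun s : Sample q Y k => (s.x₁, s.x₂, s.x₃))
    (e := fun x => ((x.1, x.2.1), x.2.2)) (fun x y => by simp only [Prod.ext_iff]; tauto) (a, b, c)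

theorem law_x₃_v (h₁ : P₁ ∈ stdSimplex ℝ (ZMod q)) (h₂ : P₂ ∈ stdSimplex ℝ (ZMod q))
    (a : ZMod q) (b : Fin k) :
    law (jointDist ch (productDist P₁ P₂ P₃)) (fun s => (s.x₃, s.v)) (a, b) = P₃ (b, a) := by
  rw [← law_v_x₃ (P₃ := P₃) ch h₁ h₂]
  exact law_comp_injective _ (fun s : Sample q Y k => (s.v, s.x₃))
    (e := fun x => (x.2, x.1)) (fun x y => by simp only [Prod.ext_iff]; tauto) (b, a)

theorem law_v (h₁ : P₁ ∈ stdSimplex ℝ (ZMod q)) (h₂ : P₂ ∈ stdSimplex ℝ (ZMod q)) (a : Fin k) :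
    law (jointDist ch (productDist P₁ P₂ P₃)) v a = vLaw P₃ a := by
  rw [← sum_law_pair_right _ v x₃]
  exact sum_congr rfl fun b _ => law_v_x₃ ch h₁ h₂ a b

variable {s : Sample q Y k}

/-- The denominator is the channel averaged over an independent competing input, which is exactly
the mean likelihood of a wrong word. Multiplicative form and positivity allow the identity to be
multiplied over letters and the denominator to be cancelled. -/
theorem density_x₁ (h₁ : P₁ ∈ stdSimplex ℝ (ZMod q)) (h₂ : P₂ ∈ stdSimplex ℝ (ZMod q))
    (h₃ : P₃ ∈ stdSimplex ℝ (Fin k × ZMod q))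
    (hs : 0 < jointDist ch (productDist P₁ P₂ P₃) s) :
    condRatio (jointDist ch (productDist P₁ P₂ P₃)) x₁ y₃ x₂₃ s *
        ∑ a, P₁ a * ch.trans a s.x₂ s.x₃ s.y₃ = ch.trans s.x₁ s.x₂ s.x₃ s.y₃ ∧
      0 < ∑ a, P₁ a * ch.trans a s.x₂ s.x₃ s.y₃ := by
  refine condRatio_mul (jointDist_mem_stdSimplex ch (productDist_mem_stdSimplex h₁ h₂ h₃)).1
    x₁ y₃ x₂₃ hs P₁ (fun a y => ch.trans a s.x₂ s.x₃ y) (fun a b => ?_) fun a => ?_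
  · exact (law_comp_injective _ (fun s : Sample q Y k => ((s.x₁, s.x₂, s.x₃), s.y₃))
      (e := fun x => (x.1.1, x.2, (x.1.2.1, x.1.2.2))) (fun x y => by
        simp only [Prod.ext_iff]; tauto) ((a, s.x₂, s.x₃), b)).trans
      (law_jointDist_y₃ ch _ a s.x₂ s.x₃ b)
  · rw [← sum_law_pair_left _ x₁ x₂₃]
    simp only [x₂₃, law_inputs]
    rw [← mul_sum, ← sum_mul, h₁.2]
    ring

theorem density_x₂ (h₁ : P₁ ∈ stdSimplex ℝ (ZMod q)) (h₂ : P₂ ∈ stdSimplex ℝ (ZMod q))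
    (h₃ : P₃ ∈ stdSimplex ℝ (Fin k × ZMod q))
    (hs : 0 < jointDist ch (productDist P₁ P₂ P₃) s) :
    condRatio (jointDist ch (productDist P₁ P₂ P₃)) x₂ y₃ x₁₃ s *
        ∑ a, P₂ a * ch.trans s.x₁ a s.x₃ s.y₃ = ch.trans s.x₁ s.x₂ s.x₃ s.y₃ ∧
      0 < ∑ a, P₂ a * ch.trans s.x₁ a s.x₃ s.y₃ := by
  refine condRatio_mul (jointDist_mem_stdSimplex ch (productDist_mem_stdSimplex h₁ h₂ h₃)).1
    x₂ y₃ x₁₃ hs P₂ (fun a y => ch.trans s.x₁ a s.x₃ y) (fun a b => ?_) fun a => ?_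
  · refine (law_comp_injective _ (fun s : Sample q Y k => ((s.x₁, s.x₂, s.x₃), s.y₃))
      (e := fun x => (x.1.2.1, x.2, (x.1.1, x.1.2.2))) (fun x y => by
        simp only [Prod.ext_iff]; tauto) ((s.x₁, a, s.x₃), b)).trans ?_
    rw [law_jointDist_y₃, x₁₃, law_x₂_x₁₃, law_inputs]
  · rw [← sum_law_pair_left _ x₂ x₁₃]
    simp only [x₁₃]
    simp only [show ∀ a b c, law (jointDist ch (productDist P₁ P₂ P₃))
      (fun s => (s.x₂, s.x₁, s.x₃)) (b, (a, c)) = _ from law_x₂_x₁₃ ch]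
    rw [← mul_sum, ← mul_sum, h₂.2]
    ring

theorem density_x₁₂ (h₁ : P₁ ∈ stdSimplex ℝ (ZMod q)) (h₂ : P₂ ∈ stdSimplex ℝ (ZMod q))
    (h₃ : P₃ ∈ stdSimplex ℝ (Fin k × ZMod q))
    (hs : 0 < jointDist ch (productDist P₁ P₂ P₃) s) :
    condRatio (jointDist ch (productDist P₁ P₂ P₃)) x₁₂ y₃ x₃ s *
        ∑ a : ZMod q × ZMod q, P₁ a.1 * P₂ a.2 * ch.trans a.1 a.2 s.x₃ s.y₃ =
          ch.trans s.x₁ s.x₂ s.x₃ s.y₃ ∧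
      0 < ∑ a : ZMod q × ZMod q, P₁ a.1 * P₂ a.2 * ch.trans a.1 a.2 s.x₃ s.y₃ := by
  refine condRatio_mul (jointDist_mem_stdSimplex ch (productDist_mem_stdSimplex h₁ h₂ h₃)).1
    x₁₂ y₃ x₃ hs (fun a => P₁ a.1 * P₂ a.2) (fun a y => ch.trans a.1 a.2 s.x₃ y)
    (fun a b => ?_) fun a => ?_
  · refine (law_comp_injective _ (fun s : Sample q Y k => ((s.x₁, s.x₂, s.x₃), s.y₃))
      (e := fun x => ((x.1.1, x.1.2.1), x.2, x.1.2.2)) (fun x y => by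
        simp only [Prod.ext_iff]; tauto) ((a.1, a.2, s.x₃), b)).trans ?_
    rw [law_jointDist_y₃, law_x₁₂_x₃, law_inputs]
  · rw [← sum_law_pair_left _ x₁₂ x₃, Fintype.sum_prod_type]
    simp only [law_x₁₂_x₃, ← mul_sum, ← sum_mul, h₁.2, h₂.2]
    refine (law_x₁₂_x₃ ch a.1 a.2 s.x₃).trans ?_
    ring

/-- The competitor is a wrong strategy; at the true auxiliary letter only its value there matters,
and this has the conditional law of X3. -/
theorem density_x₃ (h₁ : P₁ ∈ stdSimplex ℝ (ZMod q)) (h₂ : P₂ ∈ stdSimplex ℝ (ZMod q))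
    (h₃ : P₃ ∈ stdSimplex ℝ (Fin k × ZMod q))
    (hs : 0 < jointDist ch (productDist P₁ P₂ P₃) s) :
    condRatio (jointDist ch (productDist P₁ P₂ P₃)) x₃ w₁ v s * bcChannel₁ ch P₃ s.v s.w₁ =
        ch.noise₁ (s.w₁ - s.x₃) ∧ 0 < bcChannel₁ ch P₃ s.v s.w₁ := by
  have h := condRatio_mul
    (jointDist_mem_stdSimplex ch (productDist_mem_stdSimplex h₁ h₂ h₃)).1
    x₃ w₁ v hs (condX P₃ s.v) (fun a y => ch.noise₁ (y - a)) (fun a b => ?_) fun a => ?_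
  · rw [bcChannel₁, sum_strat_mul h₃ s.v fun x => ch.noise₁ (s.w₁ - x)]
    exact h
  · exact (law_comp_injective _ (fun s : Sample q Y k => ((s.x₃, s.v), s.w₁))
      (e := fun x => (x.1.1, x.2, x.1.2)) (fun x y => by
        simp only [Prod.ext_iff]; tauto) ((a, s.v), b)).trans (law_jointDist_w₁ ch _ a s.v b)
  · rw [law_x₃_v ch h₁ h₂, law_v ch h₁ h₂, mul_comm, vLaw_mul_condX h₃]

theorem law_v_w₁ (h₁ : P₁ ∈ stdSimplex ℝ (ZMod q)) (h₂ : P₂ ∈ stdSimplex ℝ (ZMod q))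
    (h₃ : P₃ ∈ stdSimplex ℝ (Fin k × ZMod q))
    (a : Fin k) (y : ZMod q) :
    law (jointDist ch (productDist P₁ P₂ P₃)) (fun s => (s.v, s.w₁)) (a, y) =
      vLaw P₃ a * bcChannel₁ ch P₃ a y := by
  rw [← sum_law_pair_left _ x₃ fun s => (s.v, s.w₁), bcChannel₁,
    sum_strat_mul h₃ a fun x => ch.noise₁ (y - x), mul_sum]
  refine sum_congr rfl fun x _ => ?_
  rw [← mul_assoc, vLaw_mul_condX h₃, ← law_x₃_v (P₃ := P₃) ch h₁ h₂, ← law_jointDist_w₁]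
  exact law_comp_injective _ (fun s : Sample q Y k => ((s.x₃, s.v), s.w₁))
      (e := fun x => (x.1.1, x.1.2, x.2)) (fun x y => by
        simp only [Prod.ext_iff]; tauto) ((x, a), y)

theorem density_v₁ (h₁ : P₁ ∈ stdSimplex ℝ (ZMod q)) (h₂ : P₂ ∈ stdSimplex ℝ (ZMod q))
    (h₃ : P₃ ∈ stdSimplex ℝ (Fin k × ZMod q))
    (hs : 0 < jointDist ch (productDist P₁ P₂ P₃) s) :
    ratio (jointDist ch (productDist P₁ P₂ P₃)) v w₁ s *
        ∑ a, vLaw P₃ a * bcChannel₁ ch P₃ a s.w₁ = bcChannel₁ ch P₃ s.v s.w₁ ∧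
      0 < ∑ a, vLaw P₃ a * bcChannel₁ ch P₃ a s.w₁ := by
  have h := ratio_mul
    (jointDist_mem_stdSimplex ch (productDist_mem_stdSimplex h₁ h₂ h₃)).1
    v w₁ hs (bcChannel₁ ch P₃) fun a b => ?_
  · simpa only [law_v ch h₁ h₂] using h
  · rw [law_v ch h₁ h₂, law_v_w₁ ch h₁ h₂ h₃]

theorem density_v₂ (h₁ : P₁ ∈ stdSimplex ℝ (ZMod q)) (h₂ : P₂ ∈ stdSimplex ℝ (ZMod q))
    (h₃ : P₃ ∈ stdSimplex ℝ (Fin k × ZMod q))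
    (hs : 0 < jointDist ch (productDist P₁ P₂ P₃) s) :
    ratio (jointDist ch (productDist P₁ P₂ P₃)) v w₂ s *
        ∑ a, vLaw P₃ a * bcChannel₂ ch P₃ a s.w₂ = bcChannel₂ ch P₃ s.v s.w₂ ∧
      0 < ∑ a, vLaw P₃ a * bcChannel₂ ch P₃ a s.w₂ := by
  have h := ratio_mul
    (jointDist_mem_stdSimplex ch (productDist_mem_stdSimplex h₁ h₂ h₃)).1
    v w₂ hs (bcChannel₂ ch P₃) fun a b => ?_
  · simpa only [law_v ch h₁ h₂] using h
  · rw [law_v ch h₁ h₂, ← sum_law_pair_left _ w₁ fun s => (s.v, s.w₂), bcChannel₂, mul_sum]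
    refine sum_congr rfl fun y _ => ?_
    rw [← mul_assoc, ← law_v_w₁ ch h₁ h₂ h₃, ← law_jointDist_w₂]
    exact law_comp_injective _ (fun s : Sample q Y k => ((s.v, s.w₁), s.w₂))
      (e := fun x => (x.1.2, x.1.1, x.2)) (fun x y => by
        simp only [Prod.ext_iff]; tauto) ((a, y), b)

end Densities

end MADB

namespace MADB

open Finset Sample

/-! ### Threshold tests -/

section Threshold

open Classical in
/-- The indicator of a proposition. -/
noncomputable def ind (p : Prop) : ℝ := if p then 1 else 0

theorem ind_nonneg (p : Prop) : 0 ≤ ind p := by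
  unfold ind
  split_ifs <;> norm_num

theorem ind_le_one (p : Prop) : ind p ≤ 1 := by
  unfold ind
  split_ifs <;> norm_num

theorem ind_mono {p p' : Prop} (h : p → p') : ind p ≤ ind p' := by
  by_cases hp : p
  · simp [ind, hp, h hp]
  · rw [ind, if_neg hp]
    exact ind_nonneg _

theorem ind_or_le (p p' : Prop) : ind (p ∨ p') ≤ ind p + ind p' := by
  unfold ind
  by_cases h1 : p <;> by_cases h2 : p' <;> simp [h1, h2]

theorem ind_exists_le {M : Type*} (s : Finset M) (p : M → Prop) :
    ind (∃ m ∈ s, p m) ≤ ∑ m ∈ s, ind (p m) := by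
  by_cases h : ∃ m ∈ s, p m
  · obtain ⟨m, hm, hp⟩ := h
    refine (ind_le_one _).trans ?_
    refine le_trans (le_of_eq ?_) (single_le_sum (fun m _ => ind_nonneg (p m)) hm)
    simp [ind, hp]
  · rw [ind, if_neg h]
    exact sum_nonneg fun m _ => ind_nonneg _

variable {n : ℕ}

/-- A likelihood `∏ w` exceeds the averaged likelihood `∏ w'` by a factor `K`. -/
def Passes (K : ℝ) (w w' : Fin n → ℝ) : Prop := K * ∏ i, w' i < ∏ i, w i

/-- A word drawn independently of the output rarely passes. -/
theorem sum_passes_le {A : Type*} [Fintype A] {p : A → ℝ} (hp : p ∈ stdSimplex ℝ A)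
    {w : Fin n → A → ℝ} (hw : ∀ i a, 0 ≤ w i a) {K : ℝ} (hK : 0 < K) :
    ∑ b : Fin n → A, prodDist p b *
      ind (Passes K (fun i => w i (b i)) fun i => ∑ a, p a * w i a) ≤ K⁻¹ :=
  sum_prodDist_likelihood_le hp hw hK

/-- A transmitted word passes with high probability. -/
theorem exists_sum_not_passes_le {T Ω : Type*} [Fintype T] [Fintype Ω] {L : T → ℝ}
    (hL : L ∈ stdSimplex ℝ T) (τ : T → Ω) {p r : Ω → ℝ} (hp : law L τ = p)
    (hr : ∀ ω, 0 < p ω → 0 < r ω) {w w' : T → ℝ}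
    (hw : ∀ t, 0 < p (τ t) → r (τ t) * w' t = w t ∧ 0 < w' t) {γ : ℝ}
    (hγ : γ < ∑ ω, p ω * Real.logb 2 (r ω)) :
    ∃ ρ : ℝ, 0 ≤ ρ ∧ ρ < 1 ∧ ∀ n : ℕ, ∑ t : Fin n → T, prodDist L t *
      ind (¬ Passes ((2 : ℝ) ^ ((n : ℝ) * γ)) (fun i => w (t i)) fun i => w' (t i)) ≤ ρ ^ n := by
  have hpos : ∀ t, 0 < L t → 0 < p (τ t) := fun t ht => hp ▸ law_pos hL.1 τ ht
  rw [← hp, sum_law_mul] at hγ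
  obtain ⟨ρ, h0, h1, h⟩ := exists_chernoff hL (fun t ht => hr _ (hpos t ht)) hγ
  refine ⟨ρ, h0, h1, fun n => le_trans (sum_le_sum fun t _ => ?_) (h n)⟩
  rcases ((prodDist_mem_stdSimplex hL).1 t).eq_or_lt with ht | ht
  · rw [← ht, zero_mul, zero_mul]
  refine mul_le_mul_of_nonneg_left (ind_mono fun hf => ?_) ht.le
  have hLt : ∀ i, 0 < p (τ (t i)) := fun i => hpos _ ((hL.1 _).lt_of_ne fun hz =>
    ht.ne' (prod_eq_zero (mem_univ i) hz.symm))
  -- The likelihood is the product of the ratios times the averaged likelihood, so failing the test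
  -- means that the product of ratios is small, as in Chernoff's bound.
  have hprod : ∏ i, w (t i) = (∏ i, r (τ (t i))) * ∏ i, w' (t i) := by
    rw [← prod_mul_distrib]
    exact prod_congr rfl fun i _ => (hw _ (hLt i)).1.symm
  rw [Passes, not_lt, hprod] at hf
  exact le_of_mul_le_mul_right hf (prod_pos fun i _ => (hw _ (hLt i)).2)

end Threshold

section Tests

variable {q : ℕ} [NeZero q] {Y : Type*} [Fintype Y] {k n : ℕ} (ch : Channel q Y)
  (P₁ P₂ : ZMod q → ℝ) (P₃ : Fin k × ZMod q → ℝ) (K : ℝ)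

/-- The test of user 3 for the word of user 1. -/
def Test₁ (a b x : Fin n → ZMod q) (y : Fin n → Y) : Prop :=
  Passes K (fun i => ch.trans (a i) (b i) (x i) (y i))
    fun i => ∑ a', P₁ a' * ch.trans a' (b i) (x i) (y i)

/-- The test of user 3 for the word of user 2. -/
def Test₂ (a b x : Fin n → ZMod q) (y : Fin n → Y) : Prop :=
  Passes K (fun i => ch.trans (a i) (b i) (x i) (y i))
    fun i => ∑ b', P₂ b' * ch.trans (a i) b' (x i) (y i)

/-- The test of user 3 for the words of users 1 and 2. -/
def Test₁₂ (a b x : Fin n → ZMod q) (y : Fin n → Y) : Prop :=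
  Passes K (fun i => ch.trans (a i) (b i) (x i) (y i))
    fun i => ∑ a' : ZMod q × ZMod q, P₁ a'.1 * P₂ a'.2 * ch.trans a'.1 a'.2 (x i) (y i)

/-- The test of user 1 for the auxiliary word. -/
def TestV₁ (v : Fin n → Fin k) (u : Fin n → ZMod q) : Prop :=
  Passes K (fun i => bcChannel₁ ch P₃ (v i) (u i))
    fun i => ∑ v', vLaw P₃ v' * bcChannel₁ ch P₃ v' (u i)

/-- The test of user 1 for the word of user 3. -/
def TestX (v : Fin n → Fin k) (s : Fin n → Fin k → ZMod q) (u : Fin n → ZMod q) : Prop :=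
  Passes K (fun i => ch.noise₁ (u i - s i (v i))) fun i => bcChannel₁ ch P₃ (v i) (u i)

/-- The test of user 2 for the auxiliary word. -/
def TestV₂ (v : Fin n → Fin k) (u : Fin n → ZMod q) : Prop :=
  Passes K (fun i => bcChannel₂ ch P₃ (v i) (u i))
    fun i => ∑ v', vLaw P₃ v' * bcChannel₂ ch P₃ v' (u i)

variable {P₁ P₂ P₃ K}

theorem sum_test₁_le (h₁ : P₁ ∈ stdSimplex ℝ (ZMod q)) (hK : 0 < K) (b x : Fin n → ZMod q)
    (y : Fin n → Y) : ∑ a, prodDist P₁ a * ind (Test₁ ch P₁ K a b x y) ≤ K⁻¹ :=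
  sum_passes_le h₁ (w := fun i a => ch.trans a (b i) (x i) (y i))
    (fun _ _ => (ch.trans_mem _ _ _).1 _) hK

theorem sum_test₂_le (h₂ : P₂ ∈ stdSimplex ℝ (ZMod q)) (hK : 0 < K) (a x : Fin n → ZMod q)
    (y : Fin n → Y) : ∑ b, prodDist P₂ b * ind (Test₂ ch P₂ K a b x y) ≤ K⁻¹ :=
  sum_passes_le h₂ (w := fun i b => ch.trans (a i) b (x i) (y i))
    (fun _ _ => (ch.trans_mem _ _ _).1 _) hK

theorem sum_test₁₂_le (h₁ : P₁ ∈ stdSimplex ℝ (ZMod q)) (h₂ : P₂ ∈ stdSimplex ℝ (ZMod q))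
    (hK : 0 < K) (x : Fin n → ZMod q) (y : Fin n → Y) :
    ∑ a, prodDist P₁ a * ∑ b, prodDist P₂ b * ind (Test₁₂ ch P₁ P₂ K a b x y) ≤ K⁻¹ := by
  have hp : (fun a : ZMod q × ZMod q => P₁ a.1 * P₂ a.2) ∈ stdSimplex ℝ _ :=
    ⟨fun a => mul_nonneg (h₁.1 _) (h₂.1 _), by
      simp only [Fintype.sum_prod_type, ← mul_sum, h₂.2, h₁.2, mul_one]⟩
  refine le_trans (le_of_eq ?_) (sum_passes_le hp
    (w := fun i a => ch.trans a.1 a.2 (x i) (y i)) (fun _ _ => (ch.trans_mem _ _ _).1 _) hK)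
  rw [← (Equiv.arrowProdEquivProdArrow (Fin n) (fun _ => ZMod q) (fun _ => ZMod q)).symm.sum_comp,
    Fintype.sum_prod_type]
  refine sum_congr rfl fun a _ => ?_
  rw [mul_sum]
  refine sum_congr rfl fun b _ => ?_
  rw [← mul_assoc]
  congr 1
  simp only [prodDist, ← prod_mul_distrib]
  rfl

theorem sum_testV₁_le (h₃ : P₃ ∈ stdSimplex ℝ (Fin k × ZMod q)) (hK : 0 < K) (u : Fin n → ZMod q) :
    ∑ v, prodDist (vLaw P₃) v * ind (TestV₁ ch P₃ K v u) ≤ K⁻¹ :=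
  sum_passes_le (vLaw_mem_stdSimplex h₃) (w := fun i v => bcChannel₁ ch P₃ v (u i))
    (fun _ _ => bcChannel₁_nonneg ch h₃ _ _) hK

theorem sum_testX_le (h₃ : P₃ ∈ stdSimplex ℝ (Fin k × ZMod q)) (hK : 0 < K) (v : Fin n → Fin k)
    (u : Fin n → ZMod q) :
    ∑ s, prodDist (strat P₃) s * ind (TestX ch P₃ K v s u) ≤ K⁻¹ :=
  sum_passes_le (strat_mem_stdSimplex h₃) (w := fun i s => ch.noise₁ (u i - s (v i)))
    (fun _ _ => ch.noise₁_mem.1 _) hK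

theorem sum_testV₂_le (h₃ : P₃ ∈ stdSimplex ℝ (Fin k × ZMod q)) (hK : 0 < K) (u : Fin n → ZMod q) :
    ∑ v, prodDist (vLaw P₃) v * ind (TestV₂ ch P₃ K v u) ≤ K⁻¹ :=
  sum_passes_le (vLaw_mem_stdSimplex h₃) (w := fun i v => bcChannel₂ ch P₃ v (u i))
    (fun _ _ => bcChannel₂_nonneg ch h₃ _ _) hK

variable (P₁ P₂ P₃ K)

/-- The transmitted words and the received sequences fail one of the six tests. -/
def Fails (K₁ K₂ K₁₂ KV₁ KX KV₂ : ℝ) (t : Fin n → Letter q Y k) : Prop :=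
  ¬ Test₁ ch P₁ K₁ (fun i => (t i).1.1) (fun i => (t i).1.2.1)
      (fun i => (t i).1.2.2.2 (t i).1.2.2.1) (fun i => (t i).2.2.2) ∨
  ¬ Test₂ ch P₂ K₂ (fun i => (t i).1.1) (fun i => (t i).1.2.1)
      (fun i => (t i).1.2.2.2 (t i).1.2.2.1) (fun i => (t i).2.2.2) ∨
  ¬ Test₁₂ ch P₁ P₂ K₁₂ (fun i => (t i).1.1) (fun i => (t i).1.2.1)
      (fun i => (t i).1.2.2.2 (t i).1.2.2.1) (fun i => (t i).2.2.2) ∨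
  ¬ TestV₁ ch P₃ KV₁ (fun i => (t i).1.2.2.1) (fun i => (t i).2.1 - (t i).1.1) ∨
  ¬ TestX ch P₃ KX (fun i => (t i).1.2.2.1) (fun i => (t i).1.2.2.2)
      (fun i => (t i).2.1 - (t i).1.1) ∨
  ¬ TestV₂ ch P₃ KV₂ (fun i => (t i).1.2.2.1) (fun i => (t i).2.2.1 - (t i).1.2.1)

variable {P₁ P₂ P₃}

/-- The transmitted words pass all tests with high probability, as long as the thresholds are
below the mutual informations. -/
theorem exists_sum_fails_le (h₁ : P₁ ∈ stdSimplex ℝ (ZMod q)) (h₂ : P₂ ∈ stdSimplex ℝ (ZMod q))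
    (h₃ : P₃ ∈ stdSimplex ℝ (Fin k × ZMod q)) {γ₁ γ₂ γ₁₂ γV₁ γX γV₂ : ℝ}
    (hγ₁ : γ₁ < condMutualInfo (jointDist ch (productDist P₁ P₂ P₃)) x₁ y₃ x₂₃)
    (hγ₂ : γ₂ < condMutualInfo (jointDist ch (productDist P₁ P₂ P₃)) x₂ y₃ x₁₃)
    (hγ₁₂ : γ₁₂ < condMutualInfo (jointDist ch (productDist P₁ P₂ P₃)) x₁₂ y₃ x₃)
    (hγV₁ : γV₁ < mutualInfo (jointDist ch (productDist P₁ P₂ P₃)) v w₁)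
    (hγX : γX < condMutualInfo (jointDist ch (productDist P₁ P₂ P₃)) x₃ w₁ v)
    (hγV₂ : γV₂ < mutualInfo (jointDist ch (productDist P₁ P₂ P₃)) v w₂) :
    ∃ ρ : ℝ, 0 ≤ ρ ∧ ρ < 1 ∧ ∀ n : ℕ, ∑ t : Fin n → Letter q Y k,
      prodDist (letterDist ch P₁ P₂ P₃) t *
        ind (Fails ch P₁ P₂ P₃ ((2 : ℝ) ^ ((n : ℝ) * γ₁)) ((2 : ℝ) ^ ((n : ℝ) * γ₂))
          ((2 : ℝ) ^ ((n : ℝ) * γ₁₂)) ((2 : ℝ) ^ ((n : ℝ) * γV₁)) ((2 : ℝ) ^ ((n : ℝ) * γX))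
          ((2 : ℝ) ^ ((n : ℝ) * γV₂)) t) ≤ 6 * ρ ^ n := by
  have hJ := jointDist_mem_stdSimplex ch (productDist_mem_stdSimplex h₁ h₂ h₃)
  have hL := letterDist_mem_stdSimplex ch h₁ h₂ h₃
  have hlaw := law_letterDist (P₁ := P₁) (P₂ := P₂) ch h₃
  have hw₁ : ∀ t : Letter q Y k, t.toSample.w₁ = t.2.1 - t.1.1 := fun t => by
    simp only [Letter.toSample, split, w₁, Sample.x₃, Sample.z₁, Equiv.coe_fn_mk]
    ring
  have hw₂ : ∀ t : Letter q Y k, t.toSample.w₂ = t.2.2.1 - t.1.2.1 := fun t => by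
    simp only [Letter.toSample, split, w₂, Sample.x₃, Sample.z₁, Sample.z₂, Equiv.coe_fn_mk]
    ring
  rw [condMutualInfo_eq_sum] at hγ₁ hγ₂ hγ₁₂ hγX
  rw [mutualInfo_eq_sum] at hγV₁ hγV₂
  obtain ⟨ρ₁, a₁, b₁, c₁⟩ := exists_sum_not_passes_le hL Letter.toSample hlaw
    (fun ω hω => condRatio_pos hJ.1 _ _ _ hω) (fun t ht => density_x₁ ch h₁ h₂ h₃ ht) hγ₁
  obtain ⟨ρ₂, a₂, b₂, c₂⟩ := exists_sum_not_passes_le hL Letter.toSample hlaw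
    (fun ω hω => condRatio_pos hJ.1 _ _ _ hω) (fun t ht => density_x₂ ch h₁ h₂ h₃ ht) hγ₂
  obtain ⟨ρ₃, a₃, b₃, c₃⟩ := exists_sum_not_passes_le hL Letter.toSample hlaw
    (fun ω hω => condRatio_pos hJ.1 _ _ _ hω) (fun t ht => density_x₁₂ ch h₁ h₂ h₃ ht) hγ₁₂
  obtain ⟨ρ₄, a₄, b₄, c₄⟩ := exists_sum_not_passes_le hL Letter.toSample hlaw
    (fun ω hω => ratio_pos hJ.1 _ _ hω) (fun t ht => density_v₁ ch h₁ h₂ h₃ ht) hγV₁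
  obtain ⟨ρ₅, a₅, b₅, c₅⟩ := exists_sum_not_passes_le hL Letter.toSample hlaw
    (fun ω hω => condRatio_pos hJ.1 _ _ _ hω) (fun t ht => density_x₃ ch h₁ h₂ h₃ ht) hγX
  obtain ⟨ρ₆, a₆, b₆, c₆⟩ := exists_sum_not_passes_le hL Letter.toSample hlaw
    (fun ω hω => ratio_pos hJ.1 _ _ hω) (fun t ht => density_v₂ ch h₁ h₂ h₃ ht) hγV₂
  simp only [hw₁, hw₂] at c₄ c₅ c₆
  -- The worst of the six exponential rates serves for all tests.
  set ρ := max ρ₁ (max ρ₂ (max ρ₃ (max ρ₄ (max ρ₅ ρ₆)))) with hρ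
  refine ⟨ρ, le_max_of_le_left a₁, by simp only [hρ, max_lt_iff]; tauto, fun n => ?_⟩
  have d₁ := (c₁ n).trans (pow_le_pow_left₀ a₁ (show ρ₁ ≤ ρ by simp [hρ]) n)
  have d₂ := (c₂ n).trans (pow_le_pow_left₀ a₂ (show ρ₂ ≤ ρ by simp [hρ]) n)
  have d₃ := (c₃ n).trans (pow_le_pow_left₀ a₃ (show ρ₃ ≤ ρ by simp [hρ]) n)
  have d₄ := (c₄ n).trans (pow_le_pow_left₀ a₄ (show ρ₄ ≤ ρ by simp [hρ]) n)
  have d₅ := (c₅ n).trans (pow_le_pow_left₀ a₅ (show ρ₅ ≤ ρ by simp [hρ]) n)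
  have d₆ := (c₆ n).trans (pow_le_pow_left₀ a₆ (show ρ₆ ≤ ρ by simp [hρ]) n)
  have h6 : ρ ^ n + (ρ ^ n + (ρ ^ n + (ρ ^ n + (ρ ^ n + ρ ^ n)))) = 6 * ρ ^ n := by ring
  refine le_trans ?_ ((add_le_add d₁ (add_le_add d₂ (add_le_add d₃
    (add_le_add d₄ (add_le_add d₅ d₆))))).trans_eq h6)
  simp only [← sum_add_distrib, ← mul_add]
  refine sum_le_sum fun t _ => mul_le_mul_of_nonneg_left ?_ ((prodDist_mem_stdSimplex hL).1 t)
  refine (ind_or_le _ _).trans (add_le_add le_rfl ?_)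
  refine (ind_or_le _ _).trans (add_le_add le_rfl ?_)
  refine (ind_or_le _ _).trans (add_le_add le_rfl ?_)
  refine (ind_or_le _ _).trans (add_le_add le_rfl ?_)
  exact (ind_or_le _ _).trans (add_le_add le_rfl le_rfl)

end Tests

end MADB

namespace MADB

open Finset Sample

/-! ### Averages over codebooks -/

section Averages

variable {A B C : Type*} [Fintype A] [Fintype B] [Fintype C]

/-- This lets all other randomness be frozen first, so that the bound need only hold for the average
over the wrong word. -/
theorem sum_mul_le_of_swap {p : A → ℝ} {p' : B → ℝ} {F : A → B → ℝ} {δ : ℝ}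
    (hp' : p' ∈ stdSimplex ℝ B) (h : ∀ b, ∑ a, p a * F a b ≤ δ) :
    ∑ a, p a * ∑ b, p' b * F a b ≤ δ := by
  refine le_trans (le_of_eq ?_) (sum_mul_le_of_le hp' h)
  simp only [mul_sum]
  rw [sum_comm]
  exact sum_congr rfl fun b _ => sum_congr rfl fun a _ => mul_left_comm _ _ _

theorem sum_mul_le_of_swap₂ {p : A → ℝ} {p' : B → ℝ} {r : C → ℝ} {F : A → B → C → ℝ} {δ : ℝ}
    (hr : r ∈ stdSimplex ℝ C) (h : ∀ c, ∑ a, p a * ∑ b, p' b * F a b c ≤ δ) :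
    ∑ a, p a * ∑ b, p' b * ∑ c, r c * F a b c ≤ δ := by
  refine le_trans (le_of_eq ?_) (sum_mul_le_of_le hr h)
  have h1 : ∀ a, ∑ b, p' b * ∑ c, r c * F a b c = ∑ c, r c * ∑ b, p' b * F a b c := fun a => by
    simp only [mul_sum]
    rw [sum_comm]
    exact sum_congr rfl fun b _ => sum_congr rfl fun a _ => mul_left_comm _ _ _
  simp only [h1]
  simp only [mul_sum]
  rw [sum_comm]
  exact sum_congr rfl fun b _ => sum_congr rfl fun a _ => sum_congr rfl fun c _ =>
    mul_left_comm _ _ _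

theorem exists_le_of_sum_mul_le {p F : A → ℝ} (hp : p ∈ stdSimplex ℝ A) {δ : ℝ}
    (h : ∑ a, p a * F a ≤ δ) : ∃ a, F a ≤ δ := by
  by_contra hc
  push Not at hc
  obtain ⟨a, ha⟩ : ∃ a, 0 < p a := by
    by_contra h0
    push Not at h0
    have := hp.2
    rw [sum_eq_zero fun a _ => le_antisymm (h0 a) (hp.1 a)] at this
    exact zero_ne_one this
  have : ∑ a, p a * δ < ∑ a, p a * F a :=
    sum_lt_sum (fun a _ => mul_le_mul_of_nonneg_left (hc a).le (hp.1 a))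
      ⟨a, mem_univ a, mul_lt_mul_of_pos_left (hc a) ha⟩
  rw [← sum_mul, hp.2, one_mul] at this
  exact absurd h this.not_ge

/-- Two independent wrong codewords from two codebooks. -/
theorem sum_prodDist_two_two_le {ι κ : Type*} [Fintype ι] [Fintype κ] [DecidableEq ι]
    [DecidableEq κ] {p : A → ℝ} {p' : B → ℝ} (hp : p ∈ stdSimplex ℝ A) (hp' : p' ∈ stdSimplex ℝ B)
    {m m' : ι} (h : m' ≠ m) {l l' : κ} (hl : l' ≠ l) {F : A → A → B → B → ℝ} {δ : ℝ}
    (hF : ∀ a b, ∑ a', p a' * ∑ b', p' b' * F a a' b b' ≤ δ) :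
    ∑ c : ι → A, prodDist p c * ∑ d : κ → B, prodDist p' d * F (c m) (c m') (d l) (d l') ≤ δ := by
  refine sum_prodDist_two_le hp h (F := fun a a' => ∑ d : κ → B, prodDist p' d *
    F a a' (d l) (d l')) fun a => ?_
  simp only [fun a' => sum_prodDist_two hp' hl (F a a')]
  exact sum_mul_le_of_swap hp' (hF a)

theorem sum_prodDist_prod {ι : Type*} [Fintype ι] [DecidableEq ι] {r : A × B → ℝ} {p : A → ℝ}
    {κ : A → B → ℝ} (hr : ∀ a b, r (a, b) = p a * κ a b) (F : (ι → A) → (ι → B) → ℝ) :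
    ∑ t : ι → A × B, prodDist r t * F (fun i => (t i).1) (fun i => (t i).2) =
      ∑ a, prodDist p a * ∑ b, (∏ i, κ (a i) (b i)) * F a b := by
  rw [← (Equiv.arrowProdEquivProdArrow ι (fun _ => A) (fun _ => B)).symm.sum_comp,
    Fintype.sum_prod_type]
  refine sum_congr rfl fun a _ => ?_
  rw [mul_sum]
  refine sum_congr rfl fun b _ => ?_
  rw [← mul_assoc]
  congr 1
  simp only [prodDist, ← prod_mul_distrib]
  exact prod_congr rfl fun i _ => hr _ _

end Averages

section Ensemble

variable {q : ℕ} [NeZero q] {Y : Type*} [Fintype Y] {k n : ℕ} {R : Link → ℝ} (ch : Channel q Y)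
  {P₁ P₂ : ZMod q → ℝ} {P₃ : Fin k × ZMod q → ℝ}

/-- Codebooks for the messages of users 1 and 2, for the auxiliary word and for user 3. -/
abbrev Codebook (q k n : ℕ) (R : Link → ℝ) : Type :=
  (Msg n R .l13 → Fin n → ZMod q) × (Msg n R .l23 → Fin n → ZMod q) ×
    (Msg n R .l32 → Fin n → Fin k) × (Msg n R .l31 → Fin n → Fin k → ZMod q)

/-- The law of the random codebooks. -/
noncomputable def codebookDist (P₁ P₂ : ZMod q → ℝ) (P₃ : Fin k × ZMod q → ℝ)
    (C : Codebook q k n R) : ℝ :=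
  prodDist (prodDist P₁) C.1 * (prodDist (prodDist P₂) C.2.1 *
    (prodDist (prodDist (vLaw P₃)) C.2.2.1 * prodDist (prodDist (strat P₃)) C.2.2.2))

/-- The law of the outputs given the transmitted words. -/
def blockProb (a b : Fin n → ZMod q) (v : Fin n → Fin k) (s : Fin n → Fin k → ZMod q)
    (y : Fin n → ZMod q × ZMod q × Y) : ℝ :=
  ∏ i, ch.prob (a i) (b i) (s i (v i)) (y i).1 (y i).2.1 (y i).2.2

theorem blockProb_mem_stdSimplex (a b : Fin n → ZMod q) (v : Fin n → Fin k)
    (s : Fin n → Fin k → ZMod q) : blockProb ch a b v s ∈ stdSimplex ℝ _ := by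
  refine ⟨fun y => prod_nonneg fun i _ => mul_nonneg (mul_nonneg ((ch.trans_mem _ _ _).1 _)
    (ch.noise₁_mem.1 _)) (ch.noise₂_mem.1 _), ?_⟩
  simp only [blockProb]
  rw [← Fintype.prod_sum fun i (y : ZMod q × ZMod q × Y) =>
    ch.prob (a i) (b i) (s i (v i)) y.1 y.2.1 y.2.2]
  simp only [sum_prob_eq, prod_const_one]

theorem sum_codebookDist (F : Codebook q k n R → ℝ) :
    ∑ C, codebookDist P₁ P₂ P₃ C * F C =
      ∑ a, prodDist (prodDist P₁) a * ∑ b, prodDist (prodDist P₂) b *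
        ∑ v, prodDist (prodDist (vLaw P₃)) v * ∑ s, prodDist (prodDist (strat P₃)) s *
          F (a, b, v, s) := by
  simp only [Fintype.sum_prod_type, codebookDist, mul_sum, mul_assoc]

theorem codebookDist_mem_stdSimplex (h₁ : P₁ ∈ stdSimplex ℝ (ZMod q))
    (h₂ : P₂ ∈ stdSimplex ℝ (ZMod q)) (h₃ : P₃ ∈ stdSimplex ℝ (Fin k × ZMod q)) :
    codebookDist P₁ P₂ P₃ ∈ stdSimplex ℝ (Codebook q k n R) := by
  have a := prodDist_mem_stdSimplex (ι := Msg n R .l13)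
    (prodDist_mem_stdSimplex (ι := Fin n) h₁)
  have b := prodDist_mem_stdSimplex (ι := Msg n R .l23)
    (prodDist_mem_stdSimplex (ι := Fin n) h₂)
  have c := prodDist_mem_stdSimplex (ι := Msg n R .l32)
    (prodDist_mem_stdSimplex (ι := Fin n) (vLaw_mem_stdSimplex h₃))
  have d := prodDist_mem_stdSimplex (ι := Msg n R .l31)
    (prodDist_mem_stdSimplex (ι := Fin n) (strat_mem_stdSimplex h₃))
  refine ⟨fun C => mul_nonneg (a.1 _) (mul_nonneg (b.1 _) (mul_nonneg (c.1 _) (d.1 _))), ?_⟩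
  have h := sum_codebookDist (P₁ := P₁) (P₂ := P₂) (P₃ := P₃) (n := n) (R := R) fun _ => 1
  simp only [mul_one, a.2, b.2, c.2, d.2] at h
  exact h

/-- The words of the true messages form an independent sequence of letters. -/
theorem sum_codebookDist_coord (h₁ : P₁ ∈ stdSimplex ℝ (ZMod q))
    (h₂ : P₂ ∈ stdSimplex ℝ (ZMod q)) (h₃ : P₃ ∈ stdSimplex ℝ (Fin k × ZMod q)) (m : Msgs n R)
    (G : (Fin n → ZMod q) → (Fin n → ZMod q) → (Fin n → Fin k) → (Fin n → Fin k → ZMod q) →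
      (Fin n → ZMod q × ZMod q × Y) → ℝ) :
    ∑ C : Codebook q k n R, codebookDist P₁ P₂ P₃ C *
        ∑ y, blockProb ch (C.1 m.1) (C.2.1 m.2.1) (C.2.2.1 m.2.2.2) (C.2.2.2 m.2.2.1) y *
          G (C.1 m.1) (C.2.1 m.2.1) (C.2.2.1 m.2.2.2) (C.2.2.2 m.2.2.1) y =
      ∑ t : Fin n → Letter q Y k, prodDist (letterDist ch P₁ P₂ P₃) t *
        G (fun i => (t i).1.1) (fun i => (t i).1.2.1) (fun i => (t i).1.2.2.1)
          (fun i => (t i).1.2.2.2) (fun i => (t i).2) := by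
  have a := prodDist_mem_stdSimplex (ι := Fin n) h₁
  have b := prodDist_mem_stdSimplex (ι := Fin n) h₂
  have c := prodDist_mem_stdSimplex (ι := Fin n) (vLaw_mem_stdSimplex h₃)
  have d := prodDist_mem_stdSimplex (ι := Fin n) (strat_mem_stdSimplex h₃)
  set H : (Fin n → ZMod q) → (Fin n → ZMod q) → (Fin n → Fin k) → (Fin n → Fin k → ZMod q) → ℝ :=
    fun a b v s => ∑ y, blockProb ch a b v s y * G a b v s y with hH
  rw [sum_codebookDist]
  -- The sequence of letters is peeled into its components: first the outputs are separated from the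
  -- four words, then the words from one another.
  have e : ∑ a, prodDist P₁ a * ∑ b, prodDist P₂ b * ∑ v, prodDist (vLaw P₃) v *
      ∑ s, prodDist (strat P₃) s * H a b v s = _ :=
    (sum_prodDist_prod (ι := Fin n) (r := letterDist ch P₁ P₂ P₃) (p := wordDist P₁ P₂ P₃)
      (κ := fun u y => ch.prob u.1 u.2.1 (u.2.2.2 u.2.2.1) y.1 y.2.1 y.2.2) (fun _ _ => rfl)
      fun u y => G (fun i => (u i).1) (fun i => (u i).2.1) (fun i => (u i).2.2.1)
        (fun i => (u i).2.2.2) y).trans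
    ((sum_prodDist_prod (ι := Fin n) (r := wordDist P₁ P₂ P₃) (p := P₁)
      (κ := fun _ u => P₂ u.1 * (vLaw P₃ u.2.1 * strat P₃ u.2.2)) (fun _ _ => rfl)
      fun a u => H a (fun i => (u i).1) (fun i => (u i).2.1) (fun i => (u i).2.2)).trans
    (sum_congr rfl fun a _ => congrArg (prodDist P₁ a * ·)
      ((sum_prodDist_prod (ι := Fin n) (r := fun u : ZMod q × Fin k × (Fin k → ZMod q) =>
          P₂ u.1 * (vLaw P₃ u.2.1 * strat P₃ u.2.2)) (p := P₂)
        (κ := fun _ u => vLaw P₃ u.1 * strat P₃ u.2) (fun _ _ => rfl)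
        fun b u => H a b (fun i => (u i).1) (fun i => (u i).2)).trans
      (sum_congr rfl fun b _ => congrArg (prodDist P₂ b * ·)
        (sum_prodDist_prod (ι := Fin n) (r := fun u : Fin k × (Fin k → ZMod q) =>
            vLaw P₃ u.1 * strat P₃ u.2) (p := vLaw P₃)
          (κ := fun _ u => strat P₃ u) (fun _ _ => rfl) fun v s => H a b v s)))))
      |>.symm
  refine Eq.trans ?_ e
  refine (sum_prodDist_coord a m.1 fun a => ∑ b, prodDist (prodDist P₂) b *
        ∑ v, prodDist (prodDist (vLaw P₃)) v * ∑ s, prodDist (prodDist (strat P₃)) s *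
          H a (b m.2.1) (v m.2.2.2) (s m.2.2.1)).trans ?_
  refine sum_congr rfl fun a _ => congrArg (prodDist P₁ a * ·) ?_
  refine (sum_prodDist_coord b m.2.1 fun b =>
        ∑ v, prodDist (prodDist (vLaw P₃)) v * ∑ s, prodDist (prodDist (strat P₃)) s *
          H a b (v m.2.2.2) (s m.2.2.1)).trans ?_
  refine sum_congr rfl fun b _ => congrArg (prodDist P₂ b * ·) ?_
  refine (sum_prodDist_coord c m.2.2.2 fun v => ∑ s, prodDist (prodDist (strat P₃)) s *
          H a b v (s m.2.2.1)).trans ?_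
  refine sum_congr rfl fun v _ => congrArg (prodDist (vLaw P₃) v * ·) ?_
  exact sum_prodDist_coord d m.2.2.1 fun s => H a b v s

end Ensemble

end MADB

namespace MADB

open Finset Sample

/-! ### Probability that a wrong word passes -/

section RandomCode

variable {q : ℕ} [NeZero q] {Y : Type*} [Fintype Y] {k n : ℕ} {R : Link → ℝ} (ch : Channel q Y)
  (P₁ P₂ : ZMod q → ℝ) (P₃ : Fin k × ZMod q → ℝ)

/-- The law of the outputs when the codebooks `C` are used to send the messages `m`. -/
def Codebook.outProb (C : Codebook q k n R) (m : Msgs n R) : (Fin n → ZMod q × ZMod q × Y) → ℝ :=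
  blockProb ch (C.1 m.1) (C.2.1 m.2.1) (C.2.2.1 m.2.2.2) (C.2.2.2 m.2.2.1)

/-- The probability of an event under random codebooks, given the messages. -/
noncomputable def avgProb (m : Msgs n R)
    (A : Codebook q k n R → (Fin n → ZMod q × ZMod q × Y) → Prop) : ℝ :=
  ∑ C, codebookDist P₁ P₂ P₃ C * ∑ y, C.outProb ch m y * ind (A C y)

/-- The word sent by user 3. -/
def Codebook.word₃ (C : Codebook q k n R) (m : Msg n R .l31) (m' : Msg n R .l32) (i : Fin n) :
    ZMod q :=
  C.2.2.2 m i (C.2.2.1 m' i)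

/-- The words of the messages `m` and the outputs. -/
def Codebook.letters (C : Codebook q k n R) (m : Msgs n R) (y : Fin n → ZMod q × ZMod q × Y)
    (i : Fin n) : Letter q Y k :=
  ((C.1 m.1 i, C.2.1 m.2.1 i, C.2.2.1 m.2.2.2 i, C.2.2.2 m.2.2.1 i), y i)

variable {P₁ P₂ P₃}

theorem Codebook.outProb_mem_stdSimplex (C : Codebook q k n R) (m : Msgs n R) :
    C.outProb ch m ∈ stdSimplex ℝ _ := blockProb_mem_stdSimplex ch _ _ _ _

section Basic

variable (h₁ : P₁ ∈ stdSimplex ℝ (ZMod q)) (h₂ : P₂ ∈ stdSimplex ℝ (ZMod q))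
  (h₃ : P₃ ∈ stdSimplex ℝ (Fin k × ZMod q)) (m : Msgs n R)
include h₁ h₂ h₃

theorem avgProb_or_le (A B : Codebook q k n R → (Fin n → ZMod q × ZMod q × Y) → Prop) :
    avgProb ch P₁ P₂ P₃ m (fun C y => A C y ∨ B C y) ≤
      avgProb ch P₁ P₂ P₃ m A + avgProb ch P₁ P₂ P₃ m B := by
  simp only [avgProb, ← sum_add_distrib, ← mul_add]
  exact sum_le_sum fun C _ => mul_le_mul_of_nonneg_left (sum_le_sum fun y _ =>
    mul_le_mul_of_nonneg_left (ind_or_le _ _) ((C.outProb_mem_stdSimplex ch m).1 y))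
    ((codebookDist_mem_stdSimplex h₁ h₂ h₃).1 C)

theorem avgProb_exists_le {M : Type*} (s : Finset M)
    {A : M → Codebook q k n R → (Fin n → ZMod q × ZMod q × Y) → Prop} {δ : ℝ}
    (h : ∀ l ∈ s, avgProb ch P₁ P₂ P₃ m (A l) ≤ δ) :
    avgProb ch P₁ P₂ P₃ m (fun C y => ∃ l ∈ s, A l C y) ≤ #s * δ := by
  rw [← nsmul_eq_mul, ← sum_const]
  refine le_trans ?_ (sum_le_sum h)
  simp only [avgProb]
  rw [sum_comm]
  simp only [← mul_sum]
  refine sum_le_sum fun C _ => mul_le_mul_of_nonneg_left ?_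
    ((codebookDist_mem_stdSimplex h₁ h₂ h₃).1 C)
  rw [sum_comm]
  simp only [← mul_sum]
  exact sum_le_sum fun y _ =>
    mul_le_mul_of_nonneg_left (ind_exists_le _ _) ((C.outProb_mem_stdSimplex ch m).1 y)

theorem avgProb_fails {K₁ K₂ K₁₂ KV₁ KX KV₂ : ℝ} :
    avgProb ch P₁ P₂ P₃ m
      (fun C y => Fails ch P₁ P₂ P₃ K₁ K₂ K₁₂ KV₁ KX KV₂ (C.letters m y)) =
    ∑ t : Fin n → Letter q Y k, prodDist (letterDist ch P₁ P₂ P₃) t *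
      ind (Fails ch P₁ P₂ P₃ K₁ K₂ K₁₂ KV₁ KX KV₂ t) :=
  sum_codebookDist_coord ch h₁ h₂ h₃ m fun a b v s y =>
    ind (Fails ch P₁ P₂ P₃ K₁ K₂ K₁₂ KV₁ KX KV₂ fun i => ((a i, b i, v i, s i), y i))

end Basic

variable {K : ℝ}

/-- The wrong word is independent of all true words, hence of the outputs. With these frozen,
Markov's inequality bounds its chance of passing. -/
theorem avgProb_test₁_le (h₁ : P₁ ∈ stdSimplex ℝ (ZMod q)) (h₂ : P₂ ∈ stdSimplex ℝ (ZMod q))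
    (h₃ : P₃ ∈ stdSimplex ℝ (Fin k × ZMod q)) (m : Msgs n R) (hK : 0 < K) {l : Msg n R .l13}
    (hl : l ≠ m.1) :
    avgProb ch P₁ P₂ P₃ m (fun C y => Test₁ ch P₁ K (C.1 l) (C.2.1 m.2.1)
      (C.word₃ m.2.2.1 m.2.2.2) fun i => (y i).2.2) ≤ K⁻¹ := by
  rw [avgProb, sum_codebookDist]
  refine sum_mul_le_of_swap (prodDist_mem_stdSimplex (prodDist_mem_stdSimplex h₂)) fun b => ?_
  refine sum_mul_le_of_swap
    (prodDist_mem_stdSimplex (prodDist_mem_stdSimplex (vLaw_mem_stdSimplex h₃))) fun v => ?_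
  refine sum_mul_le_of_swap
    (prodDist_mem_stdSimplex (prodDist_mem_stdSimplex (strat_mem_stdSimplex h₃))) fun s => ?_
  refine sum_prodDist_two_le (prodDist_mem_stdSimplex h₁) hl (F := fun a a' =>
    ∑ y, blockProb ch a (b m.2.1) (v m.2.2.2) (s m.2.2.1) y *
      ind (Test₁ ch P₁ K a' (b m.2.1) (fun i => s m.2.2.1 i (v m.2.2.2 i)) fun i => (y i).2.2))
    fun a => ?_
  exact sum_mul_le_of_swap (blockProb_mem_stdSimplex ch _ _ _ _) fun y =>
    sum_test₁_le ch h₁ hK _ _ _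

theorem avgProb_test₂_le (h₁ : P₁ ∈ stdSimplex ℝ (ZMod q)) (h₂ : P₂ ∈ stdSimplex ℝ (ZMod q))
    (h₃ : P₃ ∈ stdSimplex ℝ (Fin k × ZMod q)) (m : Msgs n R) (hK : 0 < K) {l : Msg n R .l23}
    (hl : l ≠ m.2.1) :
    avgProb ch P₁ P₂ P₃ m (fun C y => Test₂ ch P₂ K (C.1 m.1) (C.2.1 l)
      (C.word₃ m.2.2.1 m.2.2.2) fun i => (y i).2.2) ≤ K⁻¹ := by
  rw [avgProb, sum_codebookDist]
  refine sum_mul_le_of_le (prodDist_mem_stdSimplex (prodDist_mem_stdSimplex h₁)) fun a => ?_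
  refine sum_mul_le_of_swap
    (prodDist_mem_stdSimplex (prodDist_mem_stdSimplex (vLaw_mem_stdSimplex h₃))) fun v => ?_
  refine sum_mul_le_of_swap
    (prodDist_mem_stdSimplex (prodDist_mem_stdSimplex (strat_mem_stdSimplex h₃))) fun s => ?_
  refine sum_prodDist_two_le (prodDist_mem_stdSimplex h₂) hl (F := fun b b' =>
    ∑ y, blockProb ch (a m.1) b (v m.2.2.2) (s m.2.2.1) y *
      ind (Test₂ ch P₂ K (a m.1) b' (fun i => s m.2.2.1 i (v m.2.2.2 i)) fun i => (y i).2.2))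
    fun b => ?_
  exact sum_mul_le_of_swap (blockProb_mem_stdSimplex ch _ _ _ _) fun y =>
    sum_test₂_le ch h₂ hK _ _ _

theorem avgProb_test₁₂_le (h₁ : P₁ ∈ stdSimplex ℝ (ZMod q)) (h₂ : P₂ ∈ stdSimplex ℝ (ZMod q))
    (h₃ : P₃ ∈ stdSimplex ℝ (Fin k × ZMod q)) (m : Msgs n R) (hK : 0 < K) {l : Msg n R .l13}
    (hl : l ≠ m.1) {l' : Msg n R .l23} (hl' : l' ≠ m.2.1) :
    avgProb ch P₁ P₂ P₃ m (fun C y => Test₁₂ ch P₁ P₂ K (C.1 l) (C.2.1 l')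
      (C.word₃ m.2.2.1 m.2.2.2) fun i => (y i).2.2) ≤ K⁻¹ := by
  rw [avgProb, sum_codebookDist]
  refine sum_mul_le_of_swap₂
    (prodDist_mem_stdSimplex (prodDist_mem_stdSimplex (vLaw_mem_stdSimplex h₃))) fun v => ?_
  refine sum_mul_le_of_swap₂
    (prodDist_mem_stdSimplex (prodDist_mem_stdSimplex (strat_mem_stdSimplex h₃))) fun s => ?_
  refine sum_prodDist_two_two_le (prodDist_mem_stdSimplex h₁) (prodDist_mem_stdSimplex h₂) hl hl'
    (F := fun a a' b b' => ∑ y, blockProb ch a b (v m.2.2.2) (s m.2.2.1) y *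
      ind (Test₁₂ ch P₁ P₂ K a' b' (fun i => s m.2.2.1 i (v m.2.2.2 i)) fun i => (y i).2.2))
    fun a b => ?_
  exact sum_mul_le_of_swap₂ (blockProb_mem_stdSimplex ch _ _ _ _) fun y =>
    sum_test₁₂_le ch h₁ h₂ hK _ _

/-- The test does not look at the strategy word, so a wrong auxiliary word needs only one union
bound over M32, not one over pairs. -/
theorem avgProb_testV₁_le (h₁ : P₁ ∈ stdSimplex ℝ (ZMod q)) (h₂ : P₂ ∈ stdSimplex ℝ (ZMod q))
    (h₃ : P₃ ∈ stdSimplex ℝ (Fin k × ZMod q)) (m : Msgs n R) (hK : 0 < K) {l : Msg n R .l32}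
    (hl : l ≠ m.2.2.2) :
    avgProb ch P₁ P₂ P₃ m (fun C y => TestV₁ ch P₃ K (C.2.2.1 l)
      fun i => (y i).1 - C.1 m.1 i) ≤ K⁻¹ := by
  rw [avgProb, sum_codebookDist]
  refine sum_mul_le_of_le (prodDist_mem_stdSimplex (prodDist_mem_stdSimplex h₁)) fun a => ?_
  refine sum_mul_le_of_le (prodDist_mem_stdSimplex (prodDist_mem_stdSimplex h₂)) fun b => ?_
  refine sum_mul_le_of_swap
    (prodDist_mem_stdSimplex (prodDist_mem_stdSimplex (strat_mem_stdSimplex h₃))) fun s => ?_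
  refine sum_prodDist_two_le (prodDist_mem_stdSimplex (vLaw_mem_stdSimplex h₃)) hl
    (F := fun v v' => ∑ y, blockProb ch (a m.1) (b m.2.1) v (s m.2.2.1) y *
      ind (TestV₁ ch P₃ K v' fun i => (y i).1 - a m.1 i)) fun v => ?_
  exact sum_mul_le_of_swap (blockProb_mem_stdSimplex ch _ _ _ _) fun y =>
    sum_testV₁_le ch h₃ hK _

theorem avgProb_testX_le (h₁ : P₁ ∈ stdSimplex ℝ (ZMod q)) (h₂ : P₂ ∈ stdSimplex ℝ (ZMod q))
    (h₃ : P₃ ∈ stdSimplex ℝ (Fin k × ZMod q)) (m : Msgs n R) (hK : 0 < K) {l : Msg n R .l31}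
    (hl : l ≠ m.2.2.1) :
    avgProb ch P₁ P₂ P₃ m (fun C y => TestX ch P₃ K (C.2.2.1 m.2.2.2) (C.2.2.2 l)
      fun i => (y i).1 - C.1 m.1 i) ≤ K⁻¹ := by
  rw [avgProb, sum_codebookDist]
  refine sum_mul_le_of_le (prodDist_mem_stdSimplex (prodDist_mem_stdSimplex h₁)) fun a => ?_
  refine sum_mul_le_of_le (prodDist_mem_stdSimplex (prodDist_mem_stdSimplex h₂)) fun b => ?_
  refine sum_mul_le_of_le
    (prodDist_mem_stdSimplex (prodDist_mem_stdSimplex (vLaw_mem_stdSimplex h₃))) fun v => ?_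
  refine sum_prodDist_two_le (prodDist_mem_stdSimplex (strat_mem_stdSimplex h₃)) hl
    (F := fun s s' => ∑ y, blockProb ch (a m.1) (b m.2.1) (v m.2.2.2) s y *
      ind (TestX ch P₃ K (v m.2.2.2) s' fun i => (y i).1 - a m.1 i)) fun s => ?_
  exact sum_mul_le_of_swap (blockProb_mem_stdSimplex ch _ _ _ _) fun y =>
    sum_testX_le ch h₃ hK _ _

theorem avgProb_testV₂_le (h₁ : P₁ ∈ stdSimplex ℝ (ZMod q)) (h₂ : P₂ ∈ stdSimplex ℝ (ZMod q))
    (h₃ : P₃ ∈ stdSimplex ℝ (Fin k × ZMod q)) (m : Msgs n R) (hK : 0 < K) {l : Msg n R .l32}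
    (hl : l ≠ m.2.2.2) :
    avgProb ch P₁ P₂ P₃ m (fun C y => TestV₂ ch P₃ K (C.2.2.1 l)
      fun i => (y i).2.1 - C.2.1 m.2.1 i) ≤ K⁻¹ := by
  rw [avgProb, sum_codebookDist]
  refine sum_mul_le_of_le (prodDist_mem_stdSimplex (prodDist_mem_stdSimplex h₁)) fun a => ?_
  refine sum_mul_le_of_le (prodDist_mem_stdSimplex (prodDist_mem_stdSimplex h₂)) fun b => ?_
  refine sum_mul_le_of_swap
    (prodDist_mem_stdSimplex (prodDist_mem_stdSimplex (strat_mem_stdSimplex h₃))) fun s => ?_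
  refine sum_prodDist_two_le (prodDist_mem_stdSimplex (vLaw_mem_stdSimplex h₃)) hl
    (F := fun v v' => ∑ y, blockProb ch (a m.1) (b m.2.1) v (s m.2.2.1) y *
      ind (TestV₂ ch P₃ K v' fun i => (y i).2.1 - b m.2.1 i)) fun v => ?_
  exact sum_mul_le_of_swap (blockProb_mem_stdSimplex ch _ _ _ _) fun y =>
    sum_testV₂_le ch h₃ hK _

end RandomCode

end MADB

namespace MADB

open Finset Sample

/-! ### Threshold decoding, union bound and choice of a code -/

section OneShot

variable {q : ℕ} [NeZero q] {Y : Type*} [Fintype Y] {k n : ℕ} {R : Link → ℝ} (ch : Channel q Y)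
  (P₁ P₂ : ZMod q → ℝ) (P₃ : Fin k × ZMod q → ℝ) (K₁ K₂ K₁₂ KV₁ KX KV₂ : ℝ)

/-- The code with the given codebooks, whose encoders ignore the past and whose decoders look for
messages that pass the threshold tests. -/
noncomputable def Codebook.toCode [∀ l, Nonempty (Msg n R l)] (C : Codebook q k n R) :
    Code q Y n R where
  f₁ i m _ := C.1 m i
  f₂ i m _ := C.2.1 m i
  f₃ i m m' _ := C.word₃ m m' i
  g₁ m y := (Classical.epsilon fun l : Msg n R .l31 × Msg n R .l32 =>
    TestV₁ ch P₃ KV₁ (C.2.2.1 l.2) (fun i => y i - C.1 m i) ∧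
      TestX ch P₃ KX (C.2.2.1 l.2) (C.2.2.2 l.1) fun i => y i - C.1 m i).1
  g₂ m y := Classical.epsilon fun l : Msg n R .l32 =>
    TestV₂ ch P₃ KV₂ (C.2.2.1 l) fun i => y i - C.2.1 m i
  g₃ m m' y := Classical.epsilon fun l : Msg n R .l13 × Msg n R .l23 =>
    Test₁ ch P₁ K₁ (C.1 l.1) (C.2.1 l.2) (C.word₃ m m') y ∧
      Test₂ ch P₂ K₂ (C.1 l.1) (C.2.1 l.2) (C.word₃ m m') y ∧
      Test₁₂ ch P₁ P₂ K₁₂ (C.1 l.1) (C.2.1 l.2) (C.word₃ m m') y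

/-- The true words fail a test, or wrong words pass one. -/
def Codebook.Bad (C : Codebook q k n R) (m : Msgs n R) (y : Fin n → ZMod q × ZMod q × Y) : Prop :=
  Fails ch P₁ P₂ P₃ K₁ K₂ K₁₂ KV₁ KX KV₂ (C.letters m y) ∨
  (∃ l ∈ univ.erase m.1, Test₁ ch P₁ K₁ (C.1 l) (C.2.1 m.2.1)
    (C.word₃ m.2.2.1 m.2.2.2) fun i => (y i).2.2) ∨
  (∃ l ∈ univ.erase m.2.1, Test₂ ch P₂ K₂ (C.1 m.1) (C.2.1 l)
    (C.word₃ m.2.2.1 m.2.2.2) fun i => (y i).2.2) ∨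
  (∃ l ∈ univ.erase m.1 ×ˢ univ.erase m.2.1, Test₁₂ ch P₁ P₂ K₁₂ (C.1 l.1) (C.2.1 l.2)
    (C.word₃ m.2.2.1 m.2.2.2) fun i => (y i).2.2) ∨
  (∃ l ∈ univ.erase m.2.2.2, TestV₁ ch P₃ KV₁ (C.2.2.1 l) fun i => (y i).1 - C.1 m.1 i) ∨
  (∃ l ∈ univ.erase m.2.2.1, TestX ch P₃ KX (C.2.2.1 m.2.2.2) (C.2.2.2 l)
    fun i => (y i).1 - C.1 m.1 i) ∨
  ∃ l ∈ univ.erase m.2.2.2, TestV₂ ch P₃ KV₂ (C.2.2.1 l) fun i => (y i).2.1 - C.2.1 m.2.1 i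

variable {P₁ P₂ P₃ K₁ K₂ K₁₂ KV₁ KX KV₂}

/-- If the true messages pass all tests, each decoder returns some passing tuple; if this tuple is
wrong, a wrong tuple has passed. -/
theorem Codebook.bad_of_err [∀ l, Nonempty (Msg n R l)] (C : Codebook q k n R)
    {ω : Outcome q Y n R}
    (h : (C.toCode ch P₁ P₂ P₃ K₁ K₂ K₁₂ KV₁ KX KV₂).Err ω) :
    C.Bad ch P₁ P₂ P₃ K₁ K₂ K₁₂ KV₁ KX KV₂ ω.1 ω.2 := by
  obtain ⟨m, y⟩ := ω
  by_cases hf : Fails ch P₁ P₂ P₃ K₁ K₂ K₁₂ KV₁ KX KV₂ (C.letters m y)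
  · exact Or.inl hf
  refine Or.inr ?_
  simp only [Fails, not_or, not_not] at hf
  obtain ⟨t₁, t₂, t₁₂, tV₁, tX, tV₂⟩ := hf
  have s₃ := Classical.epsilon_spec (p := fun l : Msg n R .l13 × Msg n R .l23 =>
    Test₁ ch P₁ K₁ (C.1 l.1) (C.2.1 l.2) (C.word₃ m.2.2.1 m.2.2.2) (fun i => (y i).2.2) ∧
      Test₂ ch P₂ K₂ (C.1 l.1) (C.2.1 l.2) (C.word₃ m.2.2.1 m.2.2.2) (fun i => (y i).2.2) ∧
      Test₁₂ ch P₁ P₂ K₁₂ (C.1 l.1) (C.2.1 l.2) (C.word₃ m.2.2.1 m.2.2.2)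
        (fun i => (y i).2.2)) ⟨(m.1, m.2.1), t₁, t₂, t₁₂⟩
  have s₁ := Classical.epsilon_spec (p := fun l : Msg n R .l31 × Msg n R .l32 =>
    TestV₁ ch P₃ KV₁ (C.2.2.1 l.2) (fun i => (y i).1 - C.1 m.1 i) ∧
      TestX ch P₃ KX (C.2.2.1 l.2) (C.2.2.2 l.1) fun i => (y i).1 - C.1 m.1 i)
    ⟨(m.2.2.1, m.2.2.2), tV₁, tX⟩
  have s₂ := Classical.epsilon_spec (p := fun l : Msg n R .l32 =>
    TestV₂ ch P₃ KV₂ (C.2.2.1 l) fun i => (y i).2.1 - C.2.1 m.2.1 i) ⟨m.2.2.2, tV₂⟩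
  simp only [Code.Err, Code.IsError, toCode, msgsEquiv, Equiv.coe_fn_mk] at h
  revert h s₁ s₂ s₃
  generalize Classical.epsilon (fun l : Msg n R .l13 × Msg n R .l23 => _) = l₃
  generalize Classical.epsilon (fun l : Msg n R .l31 × Msg n R .l32 => _) = l₁
  generalize Classical.epsilon (fun l : Msg n R .l32 => _) = l₂
  rintro h ⟨u₁, u₂, u₁₂⟩ ⟨uV₁, uX⟩ uV₂
  -- One test is used for each pattern of wrong components, so that the components still correct are
  -- the true words in that test.
  have hu : l₃.1 ≠ m.1 ∨ l₃.2 ≠ m.2.1 → (∃ l ∈ univ.erase m.1, Test₁ ch P₁ K₁ (C.1 l) (C.2.1 m.2.1)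
        (C.word₃ m.2.2.1 m.2.2.2) fun i => (y i).2.2) ∨
      (∃ l ∈ univ.erase m.2.1, Test₂ ch P₂ K₂ (C.1 m.1) (C.2.1 l)
        (C.word₃ m.2.2.1 m.2.2.2) fun i => (y i).2.2) ∨
      (∃ l ∈ univ.erase m.1 ×ˢ univ.erase m.2.1, Test₁₂ ch P₁ P₂ K₁₂ (C.1 l.1) (C.2.1 l.2)
        (C.word₃ m.2.2.1 m.2.2.2) fun i => (y i).2.2) := by
    intro hne
    by_cases e₁ : l₃.1 = m.1
    · have e₂ := hne.resolve_left (not_not.2 e₁)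
      rw [e₁] at u₂
      exact Or.inr (Or.inl ⟨l₃.2, mem_erase.2 ⟨e₂, mem_univ _⟩, u₂⟩)
    · by_cases e₂ : l₃.2 = m.2.1
      · rw [e₂] at u₁
        exact Or.inl ⟨l₃.1, mem_erase.2 ⟨e₁, mem_univ _⟩, u₁⟩
      · exact Or.inr (Or.inr ⟨l₃, mem_product.2 ⟨mem_erase.2 ⟨e₁, mem_univ _⟩,
          mem_erase.2 ⟨e₂, mem_univ _⟩⟩, u₁₂⟩)
  rcases h with h | h | h | h
  · rcases hu (Or.inl h) with h | h | h
    exacts [Or.inl h, Or.inr (Or.inl h), Or.inr (Or.inr (Or.inl h))]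
  · rcases hu (Or.inr h) with h | h | h
    exacts [Or.inl h, Or.inr (Or.inl h), Or.inr (Or.inr (Or.inl h))]
  -- If the auxiliary word is correct, the strategy word is wrong and has passed its test; otherwise
  -- the wrong auxiliary word has passed its own.
  · by_cases e : l₁.2 = m.2.2.2
    · rw [e] at uX
      exact Or.inr (Or.inr (Or.inr (Or.inr (Or.inl ⟨l₁.1, mem_erase.2 ⟨h, mem_univ _⟩, uX⟩))))
    · exact Or.inr (Or.inr (Or.inr (Or.inl ⟨l₁.2, mem_erase.2 ⟨e, mem_univ _⟩, uV₁⟩)))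
  · exact Or.inr (Or.inr (Or.inr (Or.inr (Or.inr ⟨l₂, mem_erase.2 ⟨h, mem_univ _⟩, uV₂⟩))))

/-- A union bound for the average error probability. -/
theorem avgProb_bad_le (h₁ : P₁ ∈ stdSimplex ℝ (ZMod q)) (h₂ : P₂ ∈ stdSimplex ℝ (ZMod q))
    (h₃ : P₃ ∈ stdSimplex ℝ (Fin k × ZMod q)) (hK₁ : 0 < K₁) (hK₂ : 0 < K₂) (hK₁₂ : 0 < K₁₂)
    (hKV₁ : 0 < KV₁) (hKX : 0 < KX) (hKV₂ : 0 < KV₂) (m : Msgs n R) :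
    avgProb ch P₁ P₂ P₃ m (fun C => C.Bad ch P₁ P₂ P₃ K₁ K₂ K₁₂ KV₁ KX KV₂ m) ≤
      ∑ t : Fin n → Letter q Y k, prodDist (letterDist ch P₁ P₂ P₃) t *
        ind (Fails ch P₁ P₂ P₃ K₁ K₂ K₁₂ KV₁ KX KV₂ t) +
      (((numMsg n (R .l13) - 1 : ℕ) : ℝ) * K₁⁻¹ +
      (((numMsg n (R .l23) - 1 : ℕ) : ℝ) * K₂⁻¹ +
      (((numMsg n (R .l13) - 1 : ℕ) : ℝ) * ((numMsg n (R .l23) - 1 : ℕ) : ℝ) * K₁₂⁻¹ +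
      (((numMsg n (R .l32) - 1 : ℕ) : ℝ) * KV₁⁻¹ +
      (((numMsg n (R .l31) - 1 : ℕ) : ℝ) * KX⁻¹ +
      ((numMsg n (R .l32) - 1 : ℕ) : ℝ) * KV₂⁻¹))))) := by
  have hcard : ∀ l (i : Msg n R l), #(univ.erase i) = numMsg n (R l) - 1 := fun l i => by
    rw [card_erase_of_mem (mem_univ _), card_univ, Fintype.card_fin]
  refine (avgProb_or_le ch h₁ h₂ h₃ m _ _).trans (add_le_add
    (avgProb_fails ch h₁ h₂ h₃ m).le ?_)
  refine (avgProb_or_le ch h₁ h₂ h₃ m _ _).trans (add_le_add ?_ ?_)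
  · rw [← hcard .l13 m.1]
    exact avgProb_exists_le ch h₁ h₂ h₃ m _ fun l hl =>
      avgProb_test₁_le ch h₁ h₂ h₃ m hK₁ (ne_of_mem_erase hl)
  refine (avgProb_or_le ch h₁ h₂ h₃ m _ _).trans (add_le_add ?_ ?_)
  · rw [← hcard .l23 m.2.1]
    exact avgProb_exists_le ch h₁ h₂ h₃ m _ fun l hl =>
      avgProb_test₂_le ch h₁ h₂ h₃ m hK₂ (ne_of_mem_erase hl)
  refine (avgProb_or_le ch h₁ h₂ h₃ m _ _).trans (add_le_add ?_ ?_)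
  · rw [← hcard .l13 m.1, ← hcard .l23 m.2.1, ← Nat.cast_mul, ← card_product]
    exact avgProb_exists_le ch h₁ h₂ h₃ m _ fun l hl =>
      avgProb_test₁₂_le ch h₁ h₂ h₃ m hK₁₂ (ne_of_mem_erase (mem_product.1 hl).1)
        (ne_of_mem_erase (mem_product.1 hl).2)
  refine (avgProb_or_le ch h₁ h₂ h₃ m _ _).trans (add_le_add ?_ ?_)
  · rw [← hcard .l32 m.2.2.2]
    exact avgProb_exists_le ch h₁ h₂ h₃ m _ fun l hl =>
      avgProb_testV₁_le ch h₁ h₂ h₃ m hKV₁ (ne_of_mem_erase hl)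
  refine (avgProb_or_le ch h₁ h₂ h₃ m _ _).trans (add_le_add ?_ ?_)
  · rw [← hcard .l31 m.2.2.1]
    exact avgProb_exists_le ch h₁ h₂ h₃ m _ fun l hl =>
      avgProb_testX_le ch h₁ h₂ h₃ m hKX (ne_of_mem_erase hl)
  · rw [← hcard .l32 m.2.2.2]
    exact avgProb_exists_le ch h₁ h₂ h₃ m _ fun l hl =>
      avgProb_testV₂_le ch h₁ h₂ h₃ m hKV₂ (ne_of_mem_erase hl)

/-- Random coding: some code is at least as good as the average. -/
theorem exists_code_errorProb_le (h₁ : P₁ ∈ stdSimplex ℝ (ZMod q))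
    (h₂ : P₂ ∈ stdSimplex ℝ (ZMod q)) (h₃ : P₃ ∈ stdSimplex ℝ (Fin k × ZMod q))
    [∀ l, Nonempty (Msg n R l)] {δ : ℝ}
    (hδ : ∀ m : Msgs n R,
      avgProb ch P₁ P₂ P₃ m (fun C => C.Bad ch P₁ P₂ P₃ K₁ K₂ K₁₂ KV₁ KX KV₂ m) ≤ δ) :
    ∃ c : Code q Y n R, c.errorProb ch ≤ δ := by
  classical
  have hC := codebookDist_mem_stdSimplex (n := n) (R := R) h₁ h₂ h₃
  suffices h : ∑ C, codebookDist P₁ P₂ P₃ C *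
      (C.toCode (n := n) (R := R) ch P₁ P₂ P₃ K₁ K₂ K₁₂ KV₁ KX KV₂).errorProb ch ≤ δ by
    obtain ⟨C, hC⟩ := exists_le_of_sum_mul_le hC h
    exact ⟨_, hC⟩
  have hN : (0 : ℝ) < Fintype.card (Msgs n R) := Nat.cast_pos.2 Fintype.card_pos
  have herr : ∀ C : Codebook q k n R,
      (C.toCode ch P₁ P₂ P₃ K₁ K₂ K₁₂ KV₁ KX KV₂).errorProb ch ≤
        (Fintype.card (Msgs n R) : ℝ)⁻¹ * ∑ m, ∑ y, C.outProb ch m y *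
          ind (C.Bad ch P₁ P₂ P₃ K₁ K₂ K₁₂ KV₁ KX KV₂ m y) := by
    intro C
    rw [Code.errorProb_eq, Fintype.sum_prod_type]
    simp only [mul_sum]
    refine sum_le_sum fun m _ => sum_le_sum fun y _ => ?_
    have h0 : 0 ≤ (Fintype.card (Msgs n R) : ℝ)⁻¹ * C.outProb ch m y :=
      mul_nonneg (inv_nonneg.2 hN.le) ((C.outProb_mem_stdSimplex ch m).1 y)
    rw [← mul_assoc]
    split_ifs with h
    · rw [ind, if_pos (C.bad_of_err ch h), mul_one]
      exact le_rfl
    · exact mul_nonneg h0 (ind_nonneg _)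
  calc _ ≤ ∑ C, codebookDist P₁ P₂ P₃ C * ((Fintype.card (Msgs n R) : ℝ)⁻¹ * ∑ m, ∑ y,
          C.outProb ch m y * ind (C.Bad ch P₁ P₂ P₃ K₁ K₂ K₁₂ KV₁ KX KV₂ m y)) :=
        sum_le_sum fun C _ => mul_le_mul_of_nonneg_left (herr C) (hC.1 C)
    _ = (Fintype.card (Msgs n R) : ℝ)⁻¹ * ∑ m, avgProb ch P₁ P₂ P₃ m
          (fun C => C.Bad ch P₁ P₂ P₃ K₁ K₂ K₁₂ KV₁ KX KV₂ m) := by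
        simp only [avgProb]
        rw [sum_comm, mul_sum]
        refine sum_congr rfl fun C _ => ?_
        rw [mul_left_comm, mul_sum]
    _ ≤ (Fintype.card (Msgs n R) : ℝ)⁻¹ * ∑ _m : Msgs n R, δ :=
        mul_le_mul_of_nonneg_left (sum_le_sum fun m _ => hδ m) (inv_nonneg.2 hN.le)
    _ = δ := by
        rw [sum_const, card_univ, nsmul_eq_mul, inv_mul_cancel_left₀ hN.ne']

end OneShot

end MADB

namespace MADB

open Finset Sample Filter Topology

/-! ### The direct part -/

section Achievability

theorem mul_rpow_inv_le {n : ℕ} {N s γ η : ℝ} (hN : N ≤ (2 : ℝ) ^ ((n : ℝ) * s)) (h : s + η ≤ γ) :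
    N * ((2 : ℝ) ^ ((n : ℝ) * γ))⁻¹ ≤ ((2 : ℝ) ^ (-η)) ^ n := by
  have h2 : (0 : ℝ) < 2 := by norm_num
  rw [← Real.rpow_neg h2.le, ← Real.rpow_natCast, ← Real.rpow_mul h2.le]
  refine (mul_le_mul_of_nonneg_right hN (Real.rpow_nonneg h2.le _)).trans ?_
  rw [← Real.rpow_add h2]
  refine Real.rpow_le_rpow_of_exponent_le (by norm_num) ?_
  have := mul_le_mul_of_nonneg_left h n.cast_nonneg (α := ℝ)
  linarith

theorem numMsg_sub_one_le (n : ℕ) (r : ℝ) :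
    ((numMsg n r - 1 : ℕ) : ℝ) ≤ (2 : ℝ) ^ ((n : ℝ) * r) :=
  (Nat.cast_le.2 (Nat.sub_le _ _)).trans (Nat.floor_le (by positivity))

theorem numMsg_zero (n : ℕ) : numMsg n 0 = 1 := by
  simp [numMsg]

/-- When the rate is truncated to 0 there is a single message and hence no wrong one. Counting only
wrong messages matters here, since the threshold exponent may then be negative. -/
theorem wrong_messages_le (n : ℕ) {r I ε : ℝ} (h : r ≤ I) :
    ((numMsg n (max 0 (r - ε)) - 1 : ℕ) : ℝ) * ((2 : ℝ) ^ ((n : ℝ) * (I - ε / 2)))⁻¹ ≤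
      ((2 : ℝ) ^ (-(ε / 2))) ^ n := by
  rcases max_cases 0 (r - ε) with ⟨e, -⟩ | ⟨e, -⟩
  · rw [e, numMsg_zero, Nat.sub_self, Nat.cast_zero, zero_mul]
    positivity
  · rw [e]
    exact mul_rpow_inv_le (numMsg_sub_one_le _ _) (by linarith)

theorem wrong_pairs_le (n : ℕ) {r r' I ε : ℝ} (hε : 0 ≤ ε) (h : r + r' ≤ I) :
    ((numMsg n (max 0 (r - ε)) - 1 : ℕ) : ℝ) * ((numMsg n (max 0 (r' - ε)) - 1 : ℕ) : ℝ) *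
      ((2 : ℝ) ^ ((n : ℝ) * (I - ε / 2)))⁻¹ ≤ ((2 : ℝ) ^ (-(ε / 2))) ^ n := by
  rcases max_cases 0 (r - ε) with ⟨e, -⟩ | ⟨e, -⟩
  · rw [e, numMsg_zero, Nat.sub_self, Nat.cast_zero, zero_mul, zero_mul]
    positivity
  rcases max_cases 0 (r' - ε) with ⟨e', -⟩ | ⟨e', -⟩
  · rw [e', numMsg_zero, Nat.sub_self, Nat.cast_zero, mul_zero, zero_mul]
    positivity
  rw [e, e']
  refine mul_rpow_inv_le (s := (r - ε) + (r' - ε)) ?_ (by linarith)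
  rw [mul_add, Real.rpow_add (by norm_num)]
  exact mul_le_mul (numMsg_sub_one_le _ _) (numMsg_sub_one_le _ _) (Nat.cast_nonneg _)
    (Real.rpow_nonneg (by norm_num) _)

variable {q : ℕ} [NeZero q] {Y : Type*} [Fintype Y] {k : ℕ} (ch : Channel q Y)
  {P₁ P₂ : ZMod q → ℝ} {P₃ : Fin k × ZMod q → ℝ}

theorem achievable_of_mem_rateRegion (h₁ : P₁ ∈ stdSimplex ℝ (ZMod q))
    (h₂ : P₂ ∈ stdSimplex ℝ (ZMod q)) (h₃ : P₃ ∈ stdSimplex ℝ (Fin k × ZMod q)) {R : Link → ℝ}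
    (hR : R ∈ rateRegion ch (productDist P₁ P₂ P₃)) {ε : ℝ} (hε : 0 < ε) :
    Achievable ch fun l => max 0 (R l - ε) := by
  rw [mem_rateRegion] at hR
  obtain ⟨-, hR₁, hR₂, hR₁₂, hRX, hRV⟩ := hR
  -- User 1 must decode M32 too; degradedness makes the rate admissible for it.
  have hRV₁ := hRV.trans (mutualInfo_w₂_le ch (productDist_mem_stdSimplex h₁ h₂ h₃))
  have hlt : ∀ I : ℝ, I - ε / 2 < I := fun I => by linarith
  -- Thresholds lie ε/2 below the informations and untruncated rates ε below their targets: both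
  -- kinds of error then decay exponentially.
  obtain ⟨ρ, hρ0, hρ1, hρ⟩ := exists_sum_fails_le ch h₁ h₂ h₃ (hlt _) (hlt _) (hlt _) (hlt _)
    (hlt _) (hlt _)
  set R' : Link → ℝ := fun l => max 0 (R l - ε) with hR'
  have hR'0 : ∀ l, 0 ≤ R' l := fun l => le_max_left _ _
  set θ : ℝ := (2 : ℝ) ^ (-(ε / 2)) with hθ
  have hc : ∀ n : ℕ, ∃ c : Code q Y n R', c.errorProb ch ≤ 6 * ρ ^ n + 6 * θ ^ n := by
    intro n
    have : ∀ l, Nonempty (Msg n R' l) := fun l => ⟨⟨0, numMsg_pos (hR'0 l)⟩⟩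
    have hpow : ∀ γ : ℝ, (0 : ℝ) < (2 : ℝ) ^ ((n : ℝ) * γ) := fun γ => by positivity
    refine exists_code_errorProb_le ch h₁ h₂ h₃ fun m =>
      (avgProb_bad_le ch h₁ h₂ h₃ (hpow _) (hpow _) (hpow _) (hpow _) (hpow _) (hpow _) m).trans
        (add_le_add (hρ n) ?_)
    have h6 : θ ^ n + (θ ^ n + (θ ^ n + (θ ^ n + (θ ^ n + θ ^ n)))) = 6 * θ ^ n := by ring
    rw [← h6]
    exact add_le_add (wrong_messages_le n hR₁) (add_le_add (wrong_messages_le n hR₂)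
      (add_le_add (wrong_pairs_le n hε.le hR₁₂) (add_le_add (wrong_messages_le n hRV₁)
        (add_le_add (wrong_messages_le n hRX) (wrong_messages_le n hRV)))))
  choose c hc using hc
  refine ⟨hR'0, c, ?_⟩
  have hθ1 : θ < 1 := Real.rpow_lt_one_of_one_lt_of_neg (by norm_num) (by linarith)
  have hlim := ((tendsto_pow_atTop_nhds_zero_of_lt_one hρ0 hρ1).const_mul 6).add
    ((tendsto_pow_atTop_nhds_zero_of_lt_one (by positivity) hθ1).const_mul 6)
  simp only [mul_zero, add_zero] at hlim
  exact tendsto_of_tendsto_of_tendsto_of_le_of_le tendsto_const_nhds hlim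
    (fun n => (c n).errorProb_nonneg ch) hc

/-- The direct part of the coding theorem. -/
theorem mem_closure_achievable (h₁ : P₁ ∈ stdSimplex ℝ (ZMod q))
    (h₂ : P₂ ∈ stdSimplex ℝ (ZMod q)) (h₃ : P₃ ∈ stdSimplex ℝ (Fin k × ZMod q)) {R : Link → ℝ}
    (hR : R ∈ rateRegion ch (productDist P₁ P₂ P₃)) : R ∈ closure {R | Achievable ch R} := by
  have h0 : ∀ l, 0 ≤ R l := ((mem_rateRegion ch _ R).1 hR).1
  refine mem_closure_of_tendsto (b := atTop)
    (f := fun (n : ℕ) l => max 0 (R l - 1 / ((n : ℝ) + 1))) ?_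
    (Eventually.of_forall fun n => achievable_of_mem_rateRegion ch h₁ h₂ h₃ hR (by positivity))
  rw [tendsto_pi_nhds]
  intro l
  have h := (tendsto_const_nhds (x := (0 : ℝ))).max
    ((tendsto_const_nhds (x := R l)).sub tendsto_one_div_add_atTop_nhds_zero_nat)
  rwa [sub_zero, max_eq_right (h0 l)] at h

end Achievability

/-! ### Comparison of the regions -/

section Capacity

variable {q : ℕ} [NeZero q] {Y : Type*} [Fintype Y] (ch : Channel q Y)

theorem innerBound_subset_outerBound : innerBound ch ⊆ outerBound ch := by
  refine closure_mono (convexHull_mono ?_)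
  rintro R ⟨k, hk, P₁, h₁, P₂, h₂, P₃, h₃, hR⟩
  exact ⟨k, hk, _, productDist_mem_stdSimplex h₁ h₂ h₃, hR⟩

theorem innerBound_subset_capacityRegion : innerBound ch ⊆ capacityRegion ch := by
  refine closure_minimal (convexHull_min ?_ (convex_convexHull ℝ _).closure) isClosed_closure
  rintro R ⟨k, -, P₁, h₁, P₂, h₂, P₃, h₃, hR⟩
  exact closure_mono (subset_convexHull ℝ _) (mem_closure_achievable ch h₁ h₂ h₃ hR)

end Capacity

end MADB

theorem theorem13 (q : ℕ) [NeZero q] (_hq : 2 ≤ q) {Y : Type*} [Fintype Y]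
    (ch : MADB.Channel q Y)
    (h : ∀ Q : ZMod q → ZMod q × ZMod q → ℝ,
      (∀ x₃, Q x₃ ∈ stdSimplex ℝ (ZMod q × ZMod q)) →
      ∃ P₁ ∈ stdSimplex ℝ (ZMod q), ∃ P₂ ∈ stdSimplex ℝ (ZMod q), ∀ x₃ : ZMod q,
        MADB.macInfo₁ ch (Q x₃) x₃ ≤ MADB.macInfo₁ ch (fun x => P₁ x.1 * P₂ x.2) x₃ ∧
        MADB.macInfo₂ ch (Q x₃) x₃ ≤ MADB.macInfo₂ ch (fun x => P₁ x.1 * P₂ x.2) x₃ ∧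
        MADB.macInfo₁₂ ch (Q x₃) x₃ ≤ MADB.macInfo₁₂ ch (fun x => P₁ x.1 * P₂ x.2) x₃) :
    MADB.innerBound ch = MADB.outerBound ch ∧
      MADB.capacityRegion ch = MADB.innerBound ch := by
  constructor
  · refine (MADB.innerBound_subset_outerBound ch).antisymm (closure_mono (convexHull_mono ?_))
    rintro R ⟨k, hk, P, hP, hR⟩
    -- The domination step keeps the alphabet of V, so the bound on its size carries over.
    obtain ⟨P₁, h₁, P₂, h₂, P₃, h₃, hR'⟩ := MADB.exists_productDist_of_mem_rateRegion ch h hP hR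
    exact ⟨k, hk, P₁, h₁, P₂, h₂, P₃, h₃, hR'⟩
  · refine Set.Subset.antisymm ?_ (MADB.innerBound_subset_capacityRegion ch)
    refine closure_minimal (convexHull_min ?_ (convex_convexHull ℝ _).closure) isClosed_closure
    intro R hR
    -- The converse yields alphabets of V of unbounded size; since the inner bound is closed, it is
    -- enough to place each of their regions in it.
    refine closure_minimal ?_ isClosed_closure (MADB.Achievable.mem_closure hR)
    rintro R ⟨k, P, hP, hR⟩
    obtain ⟨P₁, h₁, P₂, h₂, P₃, h₃, hR'⟩ := MADB.exists_productDist_of_mem_rateRegion ch h hP hR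
    obtain ⟨k', hk', P₃', h₃', hR''⟩ := MADB.exists_small_alphabet ch h₁ h₂ h₃ hR'
    exact subset_closure (subset_convexHull ℝ _ ⟨k', hk', P₁, h₁, P₂, h₂, P₃', h₃', hR''⟩)
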